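/- **Setting.** For $N,p,j\ge 0$ let $n_{p,j,N}$ be the multiplicity of the spin-$j$ irreducible representation $V^j$ of $SO(3)$ (of dimension $2j+1$, $j$ an integer) in the restriction of the irreducible representation $V^{\{p\}}=\mathrm{Sym}^p(\mathbb C^{3N})$ of $GL(3N)$ to $SO(3)$, where $SO(3)\subset GL(3N)$ is embedded by $g\mapsto \mathrm{diag}(g,\dots,g)$ ($N$ blocks). Put $$M(P,J)_N=\sum_{p,j\ge0} n_{p,j,N}P^pJ^j,\qquad M(P,J,\mathcal N)=\sum_{N\ge 0}M(P,J)_N\,\mathcal N^N=\sum_{p,j,N\ge0}n_{p,j,N}P^pJ^j\mathcal N^N,\qquad G(P,J)_N=(1+P)\,M(P,J)_N ,$$ as formal power series over $\mathbb Q$. **(1) Master generating function.** In the field of fractions of $\mathbb Q[[P,J,\mathcal N]]$, $$M(P,J,\mathcal N)=1+\frac12\,\frac{\mathcal N(1-J)}{J\mathcal N-(1-P)(1-JP)(J-P)}-\frac12\,\frac{\mathcal N(1+J)}{J\mathcal N-(1-P)(1-JP)(J-P)}\sqrt{\frac{\mathcal N-(1-P)^3}{\mathcal N-(1-P)(1+P)^2}},$$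 where the square root is the power series with constant term $1$. **(2) Fixed $N$.** $$M(P,J)_1=\frac1{(1-JP)(1-P^2)},\qquad M(P,J)_2=\frac{1+JP^2}{(1-JP)^2(1-P^2)^3},$$ $$M(P,J)_3=\frac{1+3JP^2+P^3-J^2P^3-3JP^4-J^2P^6}{(1-JP)^3(1-P^2)^6},\qquad M(P,J)_4=\frac{A(P,J)}{(1-JP)^4(1-P^2)^9},$$ with $$A=J^3P^{10}+J^3P^8+6J^2P^8+4J^3P^7-4JP^7+J^3P^6-10J^2P^6+P^6-10JP^4+P^4+J^3P^4-4J^2P^3+4P^3+6JP^2+P^2+1 .$$ In particular $$G(P,J)_1=\frac1{(1-JP)(1-P)},\qquad G(P,J)_2=\frac{(1+P)(1+P^2J)}{(1-P^2)^3(1-PJ)^2}.$$ **(3) Lie algebra version.** $n_{p,j,N}$ is also the multiplicity of the spin-$j$ representation of $\mathfrak{so}(3)$ in the representation $V^{\{p\}}$ of $\mathfrak{gl}(3N)$, restricted along $\mathfrak{so}(3)\to\mathfrak{gl}(3N)$, $A\mapsto\mathrm{diag}(A,\dots,A)$. **(4) Angular momentum content of $V(p)$.** Let $N,p\ge1$.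 Let $e_{ik}$ ($0\le i,k\le 3N$) be the matrix units of the Lie superalgebra $\mathfrak{gl}(1|3N)$ and let $V(p)$ be its finite-dimensional simple module of highest weight $\epsilon+(p-1)\delta_1$: it has a nonzero vector $v$ with $e_{ik}v=0$ for $i<k$, $e_{00}v=v$, $e_{11}v=(p-1)v$ and $e_{kk}v=0$ for $k\ge2$. Such a module exists. Any such module, restricted to $\mathfrak{gl}(1)\oplus\mathfrak{gl}(3N)$ with $\mathfrak{gl}(1)=\mathbb Ce_{00}$, is isomorphic to $V^{\{p\}}\oplus V^{\{p-1\}}$, with $e_{00}$ acting by $0$ on the first and by $1$ on the second summand. Restricted further to $\mathfrak{so}(3)$, it is isomorphic to $\bigoplus_{j=0}^p (V^j)^{\oplus m_j}$, where for every $j\ge 0$ the multiplicity $m_j$ of $V^j$ is the coefficient of $P^pJ^j$ in $G(P,J)_N=(1+P)M(P,J)_N$ (so $m_j=0$ for $j>p$). -/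

import Mathlib

open MvPolynomial

-- the commutator bracket on associative algebras
attribute [local instance 100] LieRing.ofAssociativeRing

namespace WQO

/-! ### Symmetric powers of the defining module of `GL(n)` -/

/-- Linear substitution `X_i ↦ ∑ₖ g k i • X_k`: the action of the matrix `g` on the symmetric
algebra `ℂ[X₁, …, Xₙ]` of `ℂⁿ` (the variable `X_i` is the `i`-th standard basis vector). -/
noncomputable def linSubst {n : ℕ} (g : Matrix (Fin n) (Fin n) ℂ) :
    MvPolynomial (Fin n) ℂ →ₐ[ℂ] MvPolynomial (Fin n) ℂ :=
  aeval fun i => ∑ k, C (g k i) * X k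

/-- The derivation of `ℂ[X₁, …, Xₙ]` with `X_i ↦ ∑ₖ A k i • X_k`: the action of `A ∈ gl(n)` on the
symmetric algebra of `ℂⁿ`. -/
noncomputable def linDer {n : ℕ} (A : Matrix (Fin n) (Fin n) ℂ) :
    Derivation ℂ (MvPolynomial (Fin n) ℂ) (MvPolynomial (Fin n) ℂ) :=
  mkDerivation ℂ fun i => ∑ k, C (A k i) * X k

/-- `Sym^p(ℂⁿ)`, the space underlying the irreducible module `V^{p}` of `GL(n)` and `gl(n)`
labelled by the one-row partition `(p)`: homogeneous polynomials of degree `p`. -/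
abbrev SymPow (n p : ℕ) : Type := ↥(homogeneousSubmodule (Fin n) ℂ p)

theorem linSubst_one {n : ℕ} : linSubst (1 : Matrix (Fin n) (Fin n) ℂ) = AlgHom.id ℂ _ := by
  ext1 i
  simp [linSubst, Matrix.one_apply]

theorem linSubst_mul {n : ℕ} (g h : Matrix (Fin n) (Fin n) ℂ) :
    linSubst (g * h) = (linSubst g).comp (linSubst h) := by
  ext1 i
  simp only [linSubst, aeval_X, AlgHom.comp_apply, map_sum, map_mul, algHom_C,
    Matrix.mul_apply, Finset.sum_mul, Finset.mul_sum, algebraMap_eq]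
  rw [Finset.sum_comm]
  exact Finset.sum_congr rfl fun l _ => Finset.sum_congr rfl fun k _ => by ring

theorem isHomogeneous_column {n : ℕ} (g : Matrix (Fin n) (Fin n) ℂ) (i : Fin n) :
    (∑ k, C (g k i) * X k : MvPolynomial (Fin n) ℂ).IsHomogeneous 1 :=
  IsHomogeneous.sum _ _ _ fun k _ => by
    simpa using (isHomogeneous_C (Fin n) (g k i)).mul (isHomogeneous_X ℂ k)

theorem linSubst_mem {n p : ℕ} (g : Matrix (Fin n) (Fin n) ℂ) {f : MvPolynomial (Fin n) ℂ}
    (hf : f ∈ homogeneousSubmodule (Fin n) ℂ p) :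
    linSubst g f ∈ homogeneousSubmodule (Fin n) ℂ p := by
  rw [mem_homogeneousSubmodule] at hf ⊢
  have h := hf.aeval (fun i => ∑ k, C (g k i) * X k) (isHomogeneous_column g)
  rwa [one_mul] at h

theorem linDer_eq_sum {n : ℕ} (A : Matrix (Fin n) (Fin n) ℂ) (f : MvPolynomial (Fin n) ℂ) :
    linDer A f = ∑ i, (∑ k, C (A k i) * X k) * pderiv i f := by
  induction f using MvPolynomial.induction_on with
  | C c => simp [linDer]
  | add f₁ f₂ h₁ h₂ => simp [h₁, h₂, mul_add, Finset.sum_add_distrib]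
  | mul_X f b h =>
    have hX : linDer A (X b) = ∑ k, C (A k b) * X k := mkDerivation_X _ _ _
    rw [Derivation.leibniz, h, hX]
    simp only [pderiv_mul, pderiv_X, Pi.single_apply, mul_add, Finset.sum_add_distrib,
      smul_eq_mul, mul_ite, mul_one, mul_zero, Finset.sum_ite_eq, Finset.mem_univ, if_true]
    rw [add_comm, Finset.mul_sum]
    congr 1
    · exact Finset.sum_congr rfl fun i _ => by ring
    · simp [mul_comm]

theorem linDer_mem {n p : ℕ} (A : Matrix (Fin n) (Fin n) ℂ) {f : MvPolynomial (Fin n) ℂ}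
    (hf : f ∈ homogeneousSubmodule (Fin n) ℂ p) :
    linDer A f ∈ homogeneousSubmodule (Fin n) ℂ p := by
  rw [mem_homogeneousSubmodule] at hf ⊢
  rw [linDer_eq_sum]
  refine IsHomogeneous.sum _ _ _ fun i _ => ?_
  rcases Nat.eq_zero_or_pos p with rfl | hp
  · have h0 : pderiv i f = 0 := by
      obtain ⟨c, rfl⟩ : ∃ c, f = C c :=
        ⟨_, totalDegree_eq_zero_iff_eq_C.1 (Nat.le_zero.1 hf.totalDegree_le)⟩
      exact pderiv_C
    rw [h0, mul_zero]
    exact isHomogeneous_zero _ _ _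
  · have h := (isHomogeneous_column A i).mul (hf.pderiv (i := i))
    rwa [Nat.add_sub_cancel' hp] at h

theorem linDer_X {n : ℕ} (A : Matrix (Fin n) (Fin n) ℂ) (i : Fin n) :
    linDer A (X i) = ∑ k, C (A k i) * X k :=
  mkDerivation_X _ _ _

theorem linDer_linDer_X {n : ℕ} (A B : Matrix (Fin n) (Fin n) ℂ) (i : Fin n) :
    linDer A (linDer B (X i)) = ∑ k, C ((A * B) k i) * X k := by
  rw [linDer_X, map_sum]
  have h : ∀ l, linDer A (C (B l i) * X l) = ∑ k, C (A k l * B l i) * X k := fun l => by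
    rw [C_mul', Derivation.map_smul, linDer_X, smul_eq_C_mul, Finset.mul_sum]
    exact Finset.sum_congr rfl fun k _ => by rw [C_mul]; ring
  rw [Finset.sum_congr rfl fun l _ => h l, Finset.sum_comm]
  exact Finset.sum_congr rfl fun k _ => by rw [Matrix.mul_apply, map_sum, Finset.sum_mul]

theorem linDer_lie {n : ℕ} (A B : Matrix (Fin n) (Fin n) ℂ) :
    linDer ⁅A, B⁆ = ⁅linDer A, linDer B⁆ := by
  refine derivation_ext fun i => ?_
  rw [Derivation.commutator_apply, linDer_linDer_X, linDer_linDer_X, linDer_X, Ring.lie_def,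
    ← Finset.sum_sub_distrib]
  exact Finset.sum_congr rfl fun k _ => by rw [Matrix.sub_apply, C_sub, sub_mul]

theorem linDer_add {n : ℕ} (A B : Matrix (Fin n) (Fin n) ℂ) :
    linDer (A + B) = linDer A + linDer B := by
  refine derivation_ext fun i => ?_
  simp [linDer, mkDerivation_X, add_mul, Finset.sum_add_distrib]

theorem linDer_smul {n : ℕ} (c : ℂ) (A : Matrix (Fin n) (Fin n) ℂ) :
    linDer (c • A) = c • linDer A := by
  refine derivation_ext fun i => ?_
  simp [linDer, mkDerivation_X, Finset.smul_sum, smul_eq_C_mul, mul_assoc]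

/-- The representation `V^{p}` of the group `GL(n)` over `ℂ`. -/
noncomputable def symRep (n p : ℕ) : Representation ℂ (GL (Fin n) ℂ) (SymPow n p) where
  toFun g := (linSubst (g : Matrix (Fin n) (Fin n) ℂ)).toLinearMap.restrict
    fun _ hf => linSubst_mem _ hf
  map_one' := by
    ext1 f
    apply Subtype.ext
    simp [LinearMap.restrict_apply, linSubst_one]
  map_mul' g h := by
    ext1 f
    apply Subtype.ext
    change linSubst ((g : Matrix (Fin n) (Fin n) ℂ) * (h : Matrix (Fin n) (Fin n) ℂ)) f.1 =
      linSubst (g : Matrix (Fin n) (Fin n) ℂ) (linSubst (h : Matrix (Fin n) (Fin n) ℂ) f.1)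
    rw [linSubst_mul, AlgHom.comp_apply]

/-- The representation `V^{p}` of the Lie algebra `gl(n)` over `ℂ`. -/
noncomputable def symLie (n p : ℕ) :
    Matrix (Fin n) (Fin n) ℂ →ₗ⁅ℂ⁆ Module.End ℂ (SymPow n p) where
  toFun A := (linDer A).toLinearMap.restrict fun _ hf => linDer_mem A hf
  map_add' A B := by
    ext1 f
    apply Subtype.ext
    simp [LinearMap.restrict_apply, linDer_add]
  map_smul' c A := by
    ext1 f
    apply Subtype.ext
    simp [LinearMap.restrict_apply, linDer_smul]
  map_lie' {A B} := by
    ext1 f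
    apply Subtype.ext
    change linDer ⁅A, B⁆ f.1 = linDer A (linDer B f.1) - linDer B (linDer A f.1)
    rw [linDer_lie, Derivation.commutator_apply]

/-! ### The spin `j` representations of `SO(3)` and `so(3)` -/

/-- The group `SO(3)`. -/
abbrev SO3 : Type := ↥(Matrix.specialOrthogonalGroup (Fin 3) ℝ)

/-- The Lie algebra `so(3)` over `ℂ`: skew-symmetric `3 × 3` matrices. -/
abbrev so3 : Type := ↥(LieAlgebra.Orthogonal.so (Fin 3) ℂ)

/-- The inclusion of `SO(3)` into complex `3 × 3` matrices. -/
noncomputable def so3Incl : SO3 →* Matrix (Fin 3) (Fin 3) ℂ :=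
  (Complex.ofRealHom.mapMatrix : Matrix (Fin 3) (Fin 3) ℝ →+* _).toMonoidHom.comp
    (Matrix.specialOrthogonalGroup (Fin 3) ℝ).subtype

theorem so3Incl_mul_transpose (g : SO3) : so3Incl g * (so3Incl g).transpose = 1 := by
  have h : (g : Matrix (Fin 3) (Fin 3) ℝ) * (g : Matrix (Fin 3) (Fin 3) ℝ).transpose = 1 :=
    (Matrix.mem_orthogonalGroup_iff _ _).1 (Matrix.mem_specialOrthogonalGroup_iff.1 g.2).1
  have h2 := congrArg (Complex.ofRealHom.mapMatrix : Matrix (Fin 3) (Fin 3) ℝ →+* _) h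
  rw [map_mul, map_one] at h2
  exact h2

/-- The Laplace operator `∂₁² + ∂₂² + ∂₃²` on polynomials in three variables. -/
noncomputable def laplacian : MvPolynomial (Fin 3) ℂ →ₗ[ℂ] MvPolynomial (Fin 3) ℂ :=
  ∑ i : Fin 3, (pderiv i).toLinearMap ∘ₗ (pderiv i).toLinearMap

theorem laplacian_apply (f : MvPolynomial (Fin 3) ℂ) :
    laplacian f = ∑ i : Fin 3, pderiv i (pderiv i f) := by
  simp [laplacian]

/-- The space of the spin `j` representation (of dimension `2 j + 1`): harmonic homogeneous
polynomials of degree `j` in three variables. -/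
noncomputable def harmonics (j : ℕ) : Submodule ℂ (MvPolynomial (Fin 3) ℂ) :=
  homogeneousSubmodule (Fin 3) ℂ j ⊓ LinearMap.ker laplacian

theorem pderiv_linSubst {n : ℕ} (g : Matrix (Fin n) (Fin n) ℂ) (i : Fin n)
    (f : MvPolynomial (Fin n) ℂ) :
    pderiv i (linSubst g f) = ∑ a, C (g i a) * linSubst g (pderiv a f) := by
  induction f using MvPolynomial.induction_on with
  | C c => simp [linSubst]
  | add f₁ f₂ h₁ h₂ => simp [h₁, h₂, mul_add, Finset.sum_add_distrib]
  | mul_X f b h =>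
    have hX : pderiv i (linSubst g (X b)) = C (g i b) := by
      simp [linSubst, pderiv_X, Pi.single_apply]
    have hS : ∀ a, C (g i a) * linSubst g (pderiv a (f * X b)) =
        C (g i a) * linSubst g (pderiv a f) * linSubst g (X b) +
          (if a = b then C (g i b) * linSubst g f else 0) := by
      intro a
      rw [pderiv_mul, pderiv_X, Pi.single_apply]
      by_cases hab : a = b
      · subst hab
        simp [mul_add, mul_assoc]
      · simp [hab, Ne.symm hab, mul_assoc]
    rw [map_mul, pderiv_mul, h, hX, Finset.sum_congr rfl fun a _ => hS a,
      Finset.sum_add_distrib, Finset.sum_mul]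
    simp [mul_comm]

theorem laplacian_linSubst (g : Matrix (Fin 3) (Fin 3) ℂ) (hg : g.transpose * g = 1)
    (f : MvPolynomial (Fin 3) ℂ) : laplacian (linSubst g f) = linSubst g (laplacian f) := by
  have hab : ∀ a b : Fin 3, ∑ i, g i a * g i b = if a = b then 1 else 0 := by
    intro a b
    have h := congrFun (congrFun hg a) b
    simpa [Matrix.mul_apply, Matrix.one_apply] using h
  rw [laplacian_apply, laplacian_apply]
  simp only [pderiv_linSubst, map_sum, pderiv_C_mul, Finset.mul_sum]
  rw [Finset.sum_comm]
  refine Finset.sum_congr rfl fun a _ => ?_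
  rw [Finset.sum_comm]
  have h : ∀ b : Fin 3, ∑ i, C (g i a) * (C (g i b) * linSubst g (pderiv b (pderiv a f))) =
      C (if a = b then 1 else 0) * linSubst g (pderiv b (pderiv a f)) := by
    intro b
    rw [← hab a b, map_sum, Finset.sum_mul]
    exact Finset.sum_congr rfl fun i _ => by rw [map_mul, mul_assoc]
  rw [Finset.sum_congr rfl fun b _ => h b]
  simp

theorem linSubst_mem_harmonics (g : SO3) {j : ℕ} {f : MvPolynomial (Fin 3) ℂ}
    (hf : f ∈ harmonics j) : linSubst (so3Incl g) f ∈ harmonics j := by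
  refine ⟨linSubst_mem _ hf.1, ?_⟩
  have h : laplacian f = 0 := hf.2
  change laplacian _ = 0
  rw [laplacian_linSubst _ (mul_eq_one_comm.1 (so3Incl_mul_transpose g)), h,
    map_zero]

theorem laplacian_linDer (A : Matrix (Fin 3) (Fin 3) ℂ) (hA : A.transpose = -A)
    (f : MvPolynomial (Fin 3) ℂ) : laplacian (linDer A f) = linDer A (laplacian f) := by
  have hs : ∀ i k : Fin 3, A k i = - A i k := fun i k => by
    have h := congrFun (congrFun hA i) k
    simpa using h
  have h0 : ∀ i : Fin 3, A i i = 0 := fun i => by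
    have h := hs i i
    linear_combination (1 / 2 : ℂ) * h
  have hc : ∀ i k : Fin 3, ∀ q : MvPolynomial (Fin 3) ℂ,
      pderiv i (pderiv k q) = pderiv k (pderiv i q) := fun i k q => by
    have h : (⁅pderiv (R := ℂ) i, pderiv (R := ℂ) k⁆ :
        Derivation ℂ (MvPolynomial (Fin 3) ℂ) (MvPolynomial (Fin 3) ℂ)) = 0 := by
      refine derivation_ext (R := ℂ) (σ := Fin 3) fun l => ?_
      rw [Derivation.commutator_apply, pderiv_X, pderiv_X, Pi.single_apply, Pi.single_apply]
      split_ifs <;> simp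
    have h2 := DFunLike.congr_fun h q
    simpa [Derivation.commutator_apply, sub_eq_zero] using h2
  have h1 : ∀ (i : Fin 3) (q : MvPolynomial (Fin 3) ℂ), pderiv i (linDer A q) =
      linDer A (pderiv i q) + ∑ a, C (A i a) * pderiv a q := by
    intro i q
    rw [linDer_eq_sum, linDer_eq_sum, map_sum, ← Finset.sum_add_distrib]
    refine Finset.sum_congr rfl fun a _ => ?_
    rw [pderiv_mul, hc i a, add_comm]
    congr 2
    simp [pderiv_X, Pi.single_apply]
  rw [laplacian_apply, laplacian_apply]
  simp only [h1, map_add, pderiv_C_mul, Fin.sum_univ_three, h0, hs 0 1, hs 0 2, hs 1 2,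
    hc 1 0, hc 2 0, hc 2 1, map_zero, map_neg]
  ring

theorem linDer_mem_harmonics (A : so3) {j : ℕ} {f : MvPolynomial (Fin 3) ℂ}
    (hf : f ∈ harmonics j) : linDer (A : Matrix (Fin 3) (Fin 3) ℂ) f ∈ harmonics j := by
  refine ⟨linDer_mem _ hf.1, ?_⟩
  have h : laplacian f = 0 := hf.2
  change laplacian _ = 0
  rw [laplacian_linDer _ ((LieAlgebra.Orthogonal.mem_so _ _ _).1 A.2), h,
    map_zero]

/-- The spin `j` representation of the group `SO(3)`. -/
noncomputable def spinRep (j : ℕ) : Representation ℂ SO3 (harmonics j) where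
  toFun g := (linSubst (so3Incl g)).toLinearMap.restrict fun _ hf => linSubst_mem_harmonics g hf
  map_one' := by
    ext1 f
    apply Subtype.ext
    simp [LinearMap.restrict_apply, linSubst_one]
  map_mul' g h := by
    ext1 f
    apply Subtype.ext
    change linSubst (so3Incl (g * h)) f.1 = linSubst (so3Incl g) (linSubst (so3Incl h) f.1)
    rw [map_mul, linSubst_mul, AlgHom.comp_apply]

/-- The spin `j` representation of the Lie algebra `so(3)`. -/
noncomputable def spinLie (j : ℕ) : so3 →ₗ⁅ℂ⁆ Module.End ℂ (harmonics j) where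
  toFun A := (linDer (A : Matrix (Fin 3) (Fin 3) ℂ)).toLinearMap.restrict
    fun _ hf => linDer_mem_harmonics A hf
  map_add' A B := by
    ext1 f
    apply Subtype.ext
    simp [LinearMap.restrict_apply, linDer_add]
  map_smul' c A := by
    ext1 f
    apply Subtype.ext
    simp [LinearMap.restrict_apply, linDer_smul]
  map_lie' {A B} := by
    ext1 f
    apply Subtype.ext
    change linDer ⁅(A : Matrix (Fin 3) (Fin 3) ℂ), (B : Matrix (Fin 3) (Fin 3) ℂ)⁆ f.1 =
      linDer A.1 (linDer B.1 f.1) - linDer B.1 (linDer A.1 f.1)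
    rw [linDer_lie, Derivation.commutator_apply]

/-! ### The embeddings `SO(3) ⊂ GL(3N)` and `so(3) ⊂ gl(3N)`, and multiplicities -/

/-- The block-diagonal embedding `A ↦ diag(A, …, A)` (`N` blocks) of `3 × 3` matrices into
`3N × 3N` matrices; the pair `(α, k)` of a block and a position corresponds to the index
`3 α + k` (counted from zero). -/
noncomputable def blockEmb (N : ℕ) :
    Matrix (Fin 3) (Fin 3) ℂ →ₐ[ℂ] Matrix (Fin (N * 3)) (Fin (N * 3)) ℂ :=
  (Matrix.reindexAlgEquiv ℂ ℂ (finProdFinEquiv (m := N) (n := 3))).toAlgHom.comp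
    (AlgHom.ofLinearMap
      (Matrix.kroneckerMapBilinear (LinearMap.mul ℂ ℂ) (1 : Matrix (Fin N) (Fin N) ℂ))
      (Matrix.one_kronecker_one (m := Fin N) (n := Fin 3))
      fun A B => by
        have h := Matrix.mul_kronecker_mul (1 : Matrix (Fin N) (Fin N) ℂ) (1 : Matrix (Fin N) (Fin N) ℂ) A B
        rwa [mul_one] at h)

theorem blockEmb_apply (N : ℕ) (A : Matrix (Fin 3) (Fin 3) ℂ) (α β : Fin N) (k l : Fin 3) :
    blockEmb N A (finProdFinEquiv (α, k)) (finProdFinEquiv (β, l)) =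
      if α = β then A k l else 0 := by
  have h : blockEmb N A (finProdFinEquiv (α, k)) (finProdFinEquiv (β, l)) =
      Matrix.kronecker (1 : Matrix (Fin N) (Fin N) ℂ) A (α, k) (β, l) := by
    simp [blockEmb]
    rfl
  rw [h, Matrix.kronecker, Matrix.kroneckerMap_apply, Matrix.one_apply, ite_mul, one_mul, zero_mul]

/-- The embedding `SO(3) → GL(3N)`. -/
noncomputable def so3ToGL (N : ℕ) : SO3 →* GL (Fin (N * 3)) ℂ :=
  (((blockEmb N : Matrix (Fin 3) (Fin 3) ℂ →* _)).comp so3Incl).toHomUnits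

/-- The embedding `so(3) → gl(3N)`. -/
noncomputable def so3ToGl (N : ℕ) : so3 →ₗ⁅ℂ⁆ Matrix (Fin (N * 3)) (Fin (N * 3)) ℂ :=
  (blockEmb N).toLieHom.comp (LieAlgebra.Orthogonal.so (Fin 3) ℂ).incl

/-- The multiplicity `n_{p,j,N}` of the spin `j` representation of `SO(3)` in the restriction of
the representation `V^{p}` of `GL(3N)`: the dimension of the space of intertwiners. -/
noncomputable def mult (p j N : ℕ) : ℕ :=
  Module.finrank ℂ
    (Representation.IntertwiningMap (spinRep j) ((symRep (N * 3) p).comp (so3ToGL N)))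

/-- The linear maps from the spin `j` representation of `so(3)` to another representation that
commute with the action of `so(3)`. -/
noncomputable def lieIntertwiners {W : Type*} [AddCommGroup W] [Module ℂ W] (j : ℕ)
    (σ : so3 →ₗ⁅ℂ⁆ Module.End ℂ W) : Submodule ℂ (harmonics j →ₗ[ℂ] W) where
  carrier := {T | ∀ A : so3, T ∘ₗ spinLie j A = σ A ∘ₗ T}
  add_mem' {S T} hS hT A := by rw [LinearMap.add_comp, LinearMap.comp_add, hS A, hT A]
  zero_mem' A := by rw [LinearMap.zero_comp, LinearMap.comp_zero]
  smul_mem' c T hT A := by rw [LinearMap.smul_comp, LinearMap.comp_smul, hT A]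

/-- The multiplicity of the spin `j` representation of `so(3)` in a representation of `so(3)`:
the dimension of the space of intertwiners. -/
noncomputable def lieMult {W : Type*} [AddCommGroup W] [Module ℂ W] (j : ℕ)
    (σ : so3 →ₗ⁅ℂ⁆ Module.End ℂ W) : ℕ :=
  Module.finrank ℂ (lieIntertwiners j σ)

/-! ### Generating functions -/

/-- `M(P,J)_N = ∑ n_{p,j,N} P^p J^j`; the variable `0` is `P`, the variable `1` is `J`. -/
noncomputable def genM (N : ℕ) : MvPowerSeries (Fin 2) ℚ := fun m => (mult (m 0) (m 1) N : ℚ)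

/-- The master generating function `∑ n_{p,j,N} P^p J^j 𝒩^N`; the variable `0` is `P`, the
variable `1` is `J`, the variable `2` is `𝒩`. -/
noncomputable def masterM : MvPowerSeries (Fin 3) ℚ :=
  fun m => (mult (m 0) (m 1) (m 2) : ℚ)

/-- `G(P,J)_N = (1 + P) M(P,J)_N`. -/
noncomputable def genG (N : ℕ) : MvPowerSeries (Fin 2) ℚ := (1 + MvPowerSeries.X 0) * genM N

/-- `S` is the power series in `P`, `J`, `𝒩` with constant term `1` that is the square root of
`(𝒩 - (1 - P)³) / (𝒩 - (1 - P)(1 + P)²)`; the denominator has constant term `-1`. -/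
def IsMasterSqrt (S : MvPowerSeries (Fin 3) ℚ) : Prop :=
  let P : MvPowerSeries (Fin 3) ℚ := MvPowerSeries.X 0
  let n : MvPowerSeries (Fin 3) ℚ := MvPowerSeries.X 2
  MvPowerSeries.constantCoeff S = 1 ∧
    S ^ 2 = (n - (1 - P) ^ 3) * (n - (1 - P) * (1 + P) ^ 2)⁻¹

/-- The field of fractions of the ring of formal power series in `P`, `J`, `𝒩`. -/
abbrev MasterField : Type := FractionRing (MvPowerSeries (Fin 3) ℚ)

/-! ### Representations of the Lie superalgebra `gl(1|n)` -/

/-- The degree of the index `i ∈ {0, 1, …, n}`: the index `0` is even, the others are odd. -/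
def indexDeg {n : ℕ} (i : Fin (n + 1)) : ZMod 2 := if i = 0 then 0 else 1

/-- `x ∈ gl(1|n)` is homogeneous of degree `a`; `e_{ij}` has degree `|i| + |j|`, so the odd
matrix units are `e_{i0}` and `e_{0i}` with `i ≠ 0`. -/
def IsHomog {n : ℕ} (a : ZMod 2) (x : Matrix (Fin (n + 1)) (Fin (n + 1)) ℂ) : Prop :=
  ∀ i j, x i j ≠ 0 → indexDeg i + indexDeg j = a

/-- The sign `(-1)^{ab}`. -/
def superSign (a b : ZMod 2) : ℂ := if a = 1 ∧ b = 1 then -1 else 1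

/-- A (`ℤ/2`-graded) representation of the Lie superalgebra `gl(1|n)` on `W`. -/
structure GLSuperRep (n : ℕ) (W : Type*) [AddCommGroup W] [Module ℂ W] where
  /-- the action -/
  act : Matrix (Fin (n + 1)) (Fin (n + 1)) ℂ →ₗ[ℂ] Module.End ℂ W
  /-- the even part (degree `0`) and the odd part (degree `1`) of `W` -/
  gr : ZMod 2 → Submodule ℂ W
  isInternal : DirectSum.IsInternal gr
  act_mem : ∀ (a b : ZMod 2) (x : Matrix (Fin (n + 1)) (Fin (n + 1)) ℂ), IsHomog a x →
    ∀ w ∈ gr b, act x w ∈ gr (a + b)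
  act_bracket : ∀ (a b : ZMod 2) (x y : Matrix (Fin (n + 1)) (Fin (n + 1)) ℂ),
    IsHomog a x → IsHomog b y →
      act (x * y - superSign a b • (y * x)) = act x * act y - superSign a b • (act y * act x)

/-- The embedding of `gl(n) = span {e_{ij} | i, j = 1, …, n}` into `gl(1|n)`. -/
def glEmb {n : ℕ} (A : Matrix (Fin n) (Fin n) ℂ) : Matrix (Fin (n + 1)) (Fin (n + 1)) ℂ :=
  Matrix.of fun i j => Fin.cases 0 (fun k => Fin.cases 0 (fun l => A k l) j) i

@[simp] theorem glEmb_zero_left {n : ℕ} (A : Matrix (Fin n) (Fin n) ℂ) (j : Fin (n + 1)) :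
    glEmb A 0 j = 0 := rfl

@[simp] theorem glEmb_zero_right {n : ℕ} (A : Matrix (Fin n) (Fin n) ℂ) (i : Fin (n + 1)) :
    glEmb A i 0 = 0 := by
  refine Fin.cases ?_ (fun k => ?_) i <;> rfl

@[simp] theorem glEmb_succ {n : ℕ} (A : Matrix (Fin n) (Fin n) ℂ) (k l : Fin n) :
    glEmb A k.succ l.succ = A k l := rfl

theorem isHomog_glEmb {n : ℕ} (A : Matrix (Fin n) (Fin n) ℂ) : IsHomog 0 (glEmb A) := by
  intro i j
  refine Fin.cases ?_ (fun k => ?_) i <;> refine Fin.cases ?_ (fun l => ?_) j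
  · simp
  · simp
  · simp
  · intro _
    simp only [indexDeg, Fin.succ_ne_zero, if_false]
    decide

theorem glEmb_add {n : ℕ} (A B : Matrix (Fin n) (Fin n) ℂ) :
    glEmb (A + B) = glEmb A + glEmb B := by
  ext i j
  refine Fin.cases ?_ (fun k => ?_) i <;> refine Fin.cases ?_ (fun l => ?_) j <;> simp

theorem glEmb_smul {n : ℕ} (c : ℂ) (A : Matrix (Fin n) (Fin n) ℂ) :
    glEmb (c • A) = c • glEmb A := by
  ext i j
  refine Fin.cases ?_ (fun k => ?_) i <;> refine Fin.cases ?_ (fun l => ?_) j <;> simp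

theorem glEmb_lie {n : ℕ} (A B : Matrix (Fin n) (Fin n) ℂ) :
    glEmb ⁅A, B⁆ = glEmb A * glEmb B - glEmb B * glEmb A := by
  ext i j
  refine Fin.cases ?_ (fun k => ?_) i <;> refine Fin.cases ?_ (fun l => ?_) j <;>
    simp [Matrix.mul_apply, Fin.sum_univ_succ, Ring.lie_def]

namespace GLSuperRep

variable {n : ℕ} {W : Type*} [AddCommGroup W] [Module ℂ W]

/-- The restriction of a representation of `gl(1|n)` to `gl(n)`. -/
def toGl (ρ : GLSuperRep n W) : Matrix (Fin n) (Fin n) ℂ →ₗ⁅ℂ⁆ Module.End ℂ W where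
  toFun A := ρ.act (glEmb A)
  map_add' A B := by rw [glEmb_add, map_add]
  map_smul' c A := by rw [glEmb_smul, map_smul, RingHom.id_apply]
  map_lie' {A B} := by
    have h := ρ.act_bracket 0 0 _ _ (isHomog_glEmb A) (isHomog_glEmb B)
    simp only [superSign, zero_ne_one, false_and, if_false, one_smul] at h
    change ρ.act (glEmb ⁅A, B⁆) = _
    rw [glEmb_lie, h, Ring.lie_def]

/-- Simplicity: `W ≠ 0`, and `0` and `W` are the only graded invariant subspaces. -/
def IsSimple (ρ : GLSuperRep n W) : Prop :=
  Nontrivial W ∧ ∀ U : Submodule ℂ W, U ≤ (U ⊓ ρ.gr 0) ⊔ (U ⊓ ρ.gr 1) →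
    (∀ x, ∀ w ∈ U, ρ.act x w ∈ U) → U = ⊥ ∨ U = ⊤

/-- There is a nonzero vector of weight `Λ` that is killed by all `e_{ij}` with `i < j`. -/
def HasHighestWeight (ρ : GLSuperRep n W) (Λ : Fin (n + 1) → ℂ) : Prop :=
  ∃ v : W, v ≠ 0 ∧ (∀ i j, i < j → ρ.act (Matrix.single i j 1) v = 0) ∧
    ∀ i, ρ.act (Matrix.single i i 1) v = Λ i • v

/-- `W` is the module `V(p)`: the finite-dimensional simple module of highest weight
`Λ = ε + (p - 1) δ₁`. -/
def IsV (ρ : GLSuperRep n W) (p : ℕ) : Prop :=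
  FiniteDimensional ℂ W ∧ ρ.IsSimple ∧
    ρ.HasHighestWeight fun i => if i.val = 0 then 1 else if i.val = 1 then (p : ℂ) - 1 else 0

end GLSuperRep

end WQO

/-!
The first three assertions come down to counting weights. In `so(3) ⊗ ℂ = sl(2)` let `H` be the
angular momentum along the third axis, with eigenvalues `-j, …, j` on spin `j`. The highest weight
vectors of weight `j` in a finite-dimensional representation are the kernel of the raising operator
`E` on the weight space `W_j`, and `E` maps `W_j` onto `W_{j+1}` for `j ≥ 0`
(`IsSpinTriple.finrank_highest`); hence the multiplicity of spin `j` is `dim W_j - dim W_{j+1}`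
(`lieMult_add_card`), and the isotypic components exhaust a representation with symmetric weights
(`exists_decomposition`). The group `SO(3)` gives the same multiplicities as its Lie algebra
(`lieMult_eq_mult`) without any exponential map: by Euler's theorem every rotation is conjugate to
one about the third axis, a rotation about an axis is a polynomial in the angular momentum along it,
and this angular momentum is in turn a polynomial in the rotation by one radian, since `π` is
irrational.

In the basis of monomials in `x ± i y, z` of each block, the weights of `Sym(ℂ^{3N})` have the
generating function `((1 - P) (1 - T P) (1 - T⁻¹ P))⁻ᴺ`. Multiplying by `1 - T⁻¹` and keeping the
nonnegative powers of `T = J` gives `M(P,J)_N`; the passage from `N` to `N + 1` becomes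

`(1 - P)(J - P)(1 - PJ) M_{N+1}(P,J) + P(1 - P)(1 + J) M_{N+1}(P,0) = J M_N(P,J)`

(`genM_succ`). This functional equation determines `M_{N+1}` (`eq_zero_of_functionalEq`), so the
formulas for `N ≤ 4` are verified by substitution, and so is the closed form for the sum over `N`.
For the latter put `α = (1 - P)(1 + P²) - 𝒩` and `β = P(1 - P)`; the kernel `αJ - β(1 + J²)` of the
summed equation has a power series root `J = Y`, which yields `M(P,J,𝒩) - 1` explicitly
(`two_mul_killVar_masterM`).

For the superalgebra, `gl(1|n)` acts on `ℂ[X₁, …, Xₙ] ⊗ Λ[θ]` by first order differential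
operators, and the component of degree `p` is `Sym^p ⊕ θ Sym^{p-1}`. It is simple with highest
weight vector `θ X₁^{p-1}` (`superRep_isV`). A simple module is determined by its highest weight
(`GLSuperRep.IsSimple.exists_equiv`): the descendants of a pair of highest weight vectors form the
graph of an isomorphism. Thus every `V(p)` is this polynomial model, and its weights for `so(3)` are
those of `V^{p} ⊕ V^{p-1}`.
-/


namespace WQO

/-! ### Representations of `sl(2)` by triples of operators -/

/-- Operators `H`, `E`, `F` satisfying the angular momentum relations `[H, E] = E`,
`[H, F] = -F`, `[E, F] = 2 H`: a representation of `sl(2)` in the normalisation in which `H`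
measures spin, so that its eigenvalues on the spin `j` module are `-j, …, j`. -/
structure IsSpinTriple {W : Type*} [AddCommGroup W] [Module ℂ W] (H E F : Module.End ℂ W) :
    Prop where
  HE : H * E - E * H = E
  HF : H * F - F * H = -F
  EF : E * F - F * E = (2 : ℂ) • H

namespace IsSpinTriple

variable {W : Type*} [AddCommGroup W] [Module ℂ W] {H E F : Module.End ℂ W}

theorem H_E (t : IsSpinTriple H E F) (v : W) : H (E v) = E (H v) + E v := by
  have h := LinearMap.congr_fun t.HE v
  simp only [LinearMap.sub_apply, Module.End.mul_apply] at h
  exact sub_eq_iff_eq_add'.1 h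

theorem H_F (t : IsSpinTriple H E F) (v : W) : H (F v) = F (H v) - F v := by
  have h := LinearMap.congr_fun t.HF v
  simp only [LinearMap.sub_apply, Module.End.mul_apply, LinearMap.neg_apply] at h
  rw [sub_eq_iff_eq_add'] at h
  rw [h, sub_eq_add_neg]

theorem E_F (t : IsSpinTriple H E F) (v : W) : E (F v) = F (E v) + (2 : ℂ) • H v := by
  have h := LinearMap.congr_fun t.EF v
  simp only [LinearMap.sub_apply, Module.End.mul_apply, LinearMap.smul_apply] at h
  exact sub_eq_iff_eq_add'.1 h

theorem H_pow_F (t : IsSpinTriple H E F) {v : W} {μ : ℂ} (hv : H v = μ • v) (k : ℕ) :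
    H ((F ^ k) v) = (μ - k) • (F ^ k) v := by
  induction k with
  | zero => simpa using hv
  | succ k ih =>
    rw [pow_succ', Module.End.mul_apply, t.H_F, ih, map_smul]
    push_cast
    module

theorem H_pow_E (t : IsSpinTriple H E F) {v : W} {μ : ℂ} (hv : H v = μ • v) (k : ℕ) :
    H ((E ^ k) v) = (μ + k) • (E ^ k) v := by
  induction k with
  | zero => simpa using hv
  | succ k ih =>
    rw [pow_succ', Module.End.mul_apply, t.H_E, ih, map_smul]
    push_cast
    module

theorem E_pow_F (t : IsSpinTriple H E F) {v : W} {μ : ℂ} (hv : H v = μ • v) (hE : E v = 0)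
    (k : ℕ) : E ((F ^ (k + 1)) v) = ((k + 1) * (2 * μ - k) : ℂ) • (F ^ k) v := by
  induction k with
  | zero => simp [t.E_F, hE, hv, smul_smul]
  | succ k ih =>
    rw [pow_succ', Module.End.mul_apply, t.E_F, ih, map_smul, t.H_pow_F hv, ← Module.End.mul_apply,
      ← pow_succ', smul_smul]
    push_cast
    module

theorem pow_E_F (t : IsSpinTriple H E F) {v : W} {μ : ℂ} (hv : H v = μ • v) (k : ℕ) :
    (E ^ (k + 1)) (F v) = F ((E ^ (k + 1)) v) + ((k + 1) * (2 * μ + k) : ℂ) • (E ^ k) v := by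
  induction k with
  | zero => simp [t.E_F, hv, smul_smul]
  | succ k ih =>
    have hp : ∀ m w, E ((E ^ m) w) = (E ^ (m + 1)) w := fun m w => by
      rw [pow_succ', Module.End.mul_apply]
    rw [← hp (k + 1) (F v), ih, map_add, t.E_F, map_smul, t.H_pow_E hv, hp, hp, smul_smul, add_assoc,
      ← add_smul]
    congr 2
    push_cast
    ring

variable [FiniteDimensional ℂ W]

/-- In finite dimension a sequence of eigenvectors with distinct eigenvalues hits zero. -/
theorem _root_.Module.End.exists_eq_zero_of_eigen (H : Module.End ℂ W) (x : ℕ → W) (μ : ℕ → ℂ)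
    (hμ : Function.Injective μ) (h : ∀ k, H (x k) = μ k • x k) : ∃ k, x k = 0 := by
  by_contra! hx
  have hli := Module.End.eigenvectors_linearIndependent' H μ hμ x
    fun k => ⟨Module.End.mem_eigenspace_iff.2 (h k), hx k⟩
  have := hli.finite
  exact not_finite ℕ

theorem exists_pow_E_eq_zero (t : IsSpinTriple H E F) {v : W} {μ : ℂ} (hv : H v = μ • v) :
    ∃ k, (E ^ k) v = 0 :=
  Module.End.exists_eq_zero_of_eigen H _ _ (fun a b h => by simpa using h) (t.H_pow_E hv)

theorem exists_pow_F_eq_zero (t : IsSpinTriple H E F) {v : W} {μ : ℂ} (hv : H v = μ • v) :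
    ∃ k, (F ^ k) v = 0 :=
  Module.End.exists_eq_zero_of_eigen H _ _ (fun a b h => by simpa using h) (t.H_pow_F hv)

omit [FiniteDimensional ℂ W] in
/-- Lowering a highest weight vector of weight `μ` can give zero after `n` steps only if `2 μ` is one
of `0, …, n - 1`: otherwise the factors in `E_pow_F` do not vanish. -/
theorem pow_F_ne_zero (t : IsSpinTriple H E F) {v : W} {μ : ℂ} (hv : H v = μ • v) (hE : E v = 0)
    (h0 : v ≠ 0) (n : ℕ) (hn : ∀ k < n, 2 * μ ≠ k) : (F ^ n) v ≠ 0 := by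
  induction n with
  | zero => simpa using h0
  | succ n ih =>
    intro h
    have h1 := t.E_pow_F hv hE n
    rw [h, map_zero, eq_comm, smul_eq_zero, mul_eq_zero, sub_eq_zero] at h1
    rcases h1 with (h1 | h1) | h1
    · exact Nat.cast_add_one_ne_zero n h1
    · exact hn n n.lt_succ_self h1
    · exact ih (fun k hk => hn k (hk.trans n.lt_succ_self)) h1

/-- The lowerings of a highest weight vector of weight `j` stop after `2 j` steps. -/
theorem pow_F_eq_zero (t : IsSpinTriple H E F) {v : W} {j : ℕ} (hv : H v = (j : ℂ) • v)
    (hE : E v = 0) : (F ^ (2 * j + 1)) v = 0 := by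
  by_contra h0
  have hH := t.H_pow_F hv (2 * j + 1)
  have hE' := t.E_pow_F hv hE (2 * j)
  rw [Nat.cast_mul, Nat.cast_ofNat, sub_self, mul_zero, zero_smul] at hE'
  obtain ⟨k, hk⟩ := t.exists_pow_F_eq_zero hH
  refine t.pow_F_ne_zero hH hE' h0 k (fun l _ hl => ?_) hk
  -- `F ^ (2 j + 1) v` is killed by `E` and its weight `-(j + 1)` is negative, so that lowering it
  -- further would never give zero
  have h : ((l + 2 * (j + 1) : ℕ) : ℂ) = 0 := by
    push_cast at hl ⊢
    linear_combination -hl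
  have := Nat.cast_eq_zero.1 h
  omega

/-- `E F` is injective on a weight space of positive weight. -/
theorem eq_zero_of_E_F (t : IsSpinTriple H E F) {v : W} {j : ℕ} (hv : H v = (j + 1 : ℂ) • v)
    (h : E (F v) = 0) : v = 0 := by
  by_contra h0
  obtain ⟨n, hn⟩ := t.exists_pow_E_eq_zero hv
  have h0' : ¬ (E ^ 0) v = 0 := by simpa using h0
  -- `E ^ m v` is the last nonzero vector
  obtain ⟨m, hm0, hm⟩ := Nat.exists_not_and_succ_of_not_zero_of_exists
    (p := fun k => (E ^ k) v = 0) h0' ⟨n, hn⟩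
  have h1 := t.pow_E_F hv m
  rw [hm, map_zero, zero_add, pow_succ, Module.End.mul_apply, h, map_zero, eq_comm,
    smul_eq_zero, or_iff_left hm0] at h1
  have h2 : (((m + 1) * (2 * (j + 1) + m) : ℕ) : ℂ) = 0 := by
    push_cast
    exact h1
  have := Nat.cast_eq_zero.1 h2
  simp at this

/-- `E` maps the weight space of weight `j ≥ 0` onto that of weight `j + 1`. -/
theorem exists_E_eq (t : IsSpinTriple H E F) {v : W} {j : ℕ} (hv : H v = (j + 1 : ℂ) • v) :
    ∃ u, H u = (j : ℂ) • u ∧ E u = v := by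
  have hmaps : ∀ w ∈ H.eigenspace (j + 1 : ℂ), (E * F) w ∈ H.eigenspace (j + 1 : ℂ) := by
    intro w hw
    rw [Module.End.mem_eigenspace_iff] at hw ⊢
    rw [Module.End.mul_apply, t.H_E, t.H_F, hw]
    simp only [map_smul, map_sub]
    module
  have hinj : Function.Injective ((E * F).restrict hmaps) := by
    rw [← LinearMap.ker_eq_bot, LinearMap.ker_eq_bot']
    intro w hw
    exact Subtype.ext (t.eq_zero_of_E_F (Module.End.mem_eigenspace_iff.1 w.2)
      (congrArg Subtype.val hw))
  obtain ⟨w, hw⟩ := LinearMap.injective_iff_surjective.1 hinj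
    ⟨v, Module.End.mem_eigenspace_iff.2 hv⟩
  have hw2 := Module.End.mem_eigenspace_iff.1 w.2
  refine ⟨F w, ?_, congrArg Subtype.val hw⟩
  rw [t.H_F, hw2, map_smul]
  module

/-- The space of highest weight vectors of weight `μ`. -/
def highest (H E : Module.End ℂ W) (μ : ℂ) : Submodule ℂ W :=
  LinearMap.ker E ⊓ H.eigenspace μ

omit [FiniteDimensional ℂ W] in
theorem mem_highest {μ : ℂ} {v : W} : v ∈ highest H E μ ↔ E v = 0 ∧ H v = μ • v := by
  rw [highest, Submodule.mem_inf, LinearMap.mem_ker, Module.End.mem_eigenspace_iff]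

/-- The highest weight vectors of weight `j` form the kernel of `E`, which maps the weight space of
weight `j` onto that of weight `j + 1`. -/
theorem finrank_highest (t : IsSpinTriple H E F) (j : ℕ) :
    Module.finrank ℂ (highest H E j) + Module.finrank ℂ (H.eigenspace (j + 1 : ℂ)) =
      Module.finrank ℂ (H.eigenspace (j : ℂ)) := by
  have hmaps : ∀ w ∈ H.eigenspace (j : ℂ), E w ∈ H.eigenspace (j + 1 : ℂ) := by
    intro w hw
    rw [Module.End.mem_eigenspace_iff] at hw ⊢
    rw [t.H_E, hw, map_smul]
    module
  have hr : LinearMap.range (E.restrict hmaps) = ⊤ := by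
    rw [LinearMap.range_eq_top]
    intro v
    obtain ⟨u, hu, huv⟩ := t.exists_E_eq (Module.End.mem_eigenspace_iff.1 v.2)
    exact ⟨⟨u, Module.End.mem_eigenspace_iff.2 hu⟩, Subtype.ext huv⟩
  have h := LinearMap.finrank_range_add_finrank_ker (E.restrict hmaps)
  rw [hr, finrank_top] at h
  rw [← h, add_comm]
  congr 1
  have hk : LinearMap.ker (E.restrict hmaps) =
      (highest H E j).comap (H.eigenspace (j : ℂ)).subtype := by
    ext v
    rw [LinearMap.mem_ker, Submodule.mem_comap, mem_highest, Submodule.subtype_apply,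
      ← Subtype.coe_inj]
    exact ⟨fun h => ⟨h, Module.End.mem_eigenspace_iff.1 v.2⟩, fun h => h.1⟩
  rw [hk]
  exact ((Submodule.comapSubtypeEquivOfLe inf_le_right).finrank_eq).symm

end IsSpinTriple


/-! ### Linear substitutions and derivations: conjugation, diagonal matrices, monomial bases -/

theorem linSubst_X {n : ℕ} (g : Matrix (Fin n) (Fin n) ℂ) (i : Fin n) :
    linSubst g (X i) = ∑ k, C (g k i) * X k := by
  rw [linSubst, aeval_X]

/-- The derivation of `g A g⁻¹` is the conjugate of that of `A` by the substitution of `g`. -/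
theorem linSubst_linDer {n : ℕ} {g A B : Matrix (Fin n) (Fin n) ℂ} (h : g * A = B * g)
    (f : MvPolynomial (Fin n) ℂ) : linSubst g (linDer A f) = linDer B (linSubst g f) := by
  induction f using MvPolynomial.induction_on with
  | C c => simp [linDer, linSubst, algebraMap_eq]
  | add f₁ f₂ h₁ h₂ => simp [h₁, h₂]
  | mul_X f b ih =>
    have hX : linSubst g (linDer A (X b)) = linDer B (linSubst g (X b)) := by
      have h1 : linSubst g (linDer A (X b)) = ∑ k, C ((g * A) k b) * X k := by
        rw [linDer_X, ← linSubst_X, ← linSubst_X, linSubst_mul, AlgHom.comp_apply]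
      have h2 : linDer B (linSubst g (X b)) = ∑ k, C ((B * g) k b) * X k := by
        rw [linSubst_X, ← linDer_X, linDer_linDer_X]
      rw [h1, h2, h]
    simp only [Derivation.leibniz, map_mul, map_add, smul_eq_mul, ih, hX]

theorem linDer_diagonal_monomial {n : ℕ} (d : Fin n → ℂ) (s : Fin n →₀ ℕ) (c : ℂ) :
    linDer (Matrix.diagonal d) (monomial s c) = (∑ i, s i * d i) • monomial s c := by
  rw [linDer_eq_sum, Finset.sum_smul]
  refine Finset.sum_congr rfl fun i _ => ?_
  have h : ∑ k, C (Matrix.diagonal d k i) * X k = (C (d i) * X i : MvPolynomial (Fin n) ℂ) := by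
    rw [Finset.sum_eq_single i]
    · simp
    · intro k _ hk
      simp [Matrix.diagonal_apply_ne _ hk]
    · simp
  rw [h, mul_assoc, X_mul_pderiv_monomial, C_mul', mul_comm, mul_smul, Nat.cast_smul_eq_nsmul,
    smul_comm]

theorem linSubst_diagonal_monomial {n : ℕ} (t : Fin n → ℂ) (s : Fin n →₀ ℕ) (c : ℂ) :
    linSubst (Matrix.diagonal t) (monomial s c) = (∏ i, t i ^ s i) • monomial s c := by
  have h : ∀ i, ∑ k, C (Matrix.diagonal t k i) * X k = (C (t i) * X i : MvPolynomial (Fin n) ℂ) := by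
    intro i
    rw [Finset.sum_eq_single i]
    · simp
    · intro k _ hk
      simp [Matrix.diagonal_apply_ne _ hk]
    · simp
  rw [linSubst, aeval_monomial, Finsupp.prod_fintype _ _ (by simp)]
  simp only [h, mul_pow, Finset.prod_mul_distrib]
  rw [monomial_eq, Finsupp.prod_fintype _ _ (by simp), algebraMap_eq, smul_eq_C_mul, map_prod]
  simp only [C_pow]
  ring

/-- The exponents of the monomials of degree `p` in `n` variables. -/
abbrev Expo (n p : ℕ) : Type := {d : Fin n →₀ ℕ // d.degree = p}

instance (n p : ℕ) : Finite (Expo n p) := by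
  refine Finite.of_injective (β := ↥(Finset.finsuppAntidiag (Finset.univ : Finset (Fin n)) p))
    (fun d => ⟨d.1, ?_⟩) fun a b h => Subtype.ext (congrArg (fun x => x.1) h)
  rw [Finset.mem_finsuppAntidiag]
  exact ⟨by simpa [Finsupp.degree_eq_sum] using d.2, Finset.subset_univ _⟩

noncomputable instance (n p : ℕ) : Fintype (Expo n p) := Fintype.ofFinite _

/-- The monomials of degree `p` form a basis of `Sym^p(ℂⁿ)`. -/
noncomputable def monoBasis (n p : ℕ) : Module.Basis (Expo n p) ℂ (SymPow n p) :=
  Module.Basis.ofRepr ((LinearEquiv.ofEq _ _ (homogeneousSubmodule_eq_finsupp_supported _ _ p)).trans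
    (AddMonoidAlgebra.supportedEquivFinsupp _))

theorem monoBasis_repr {n p : ℕ} (f : SymPow n p) (d : Expo n p) :
    (monoBasis n p).repr f d = coeff d.1 (f : MvPolynomial (Fin n) ℂ) := rfl

theorem coe_monoBasis {n p : ℕ} (d : Expo n p) :
    (monoBasis n p d : MvPolynomial (Fin n) ℂ) = monomial d.1 1 := by
  have h : monoBasis n p d = ⟨monomial d.1 1, isHomogeneous_monomial _ d.2⟩ := by
    rw [Module.Basis.apply_eq_iff]
    ext e
    rw [monoBasis_repr, coeff_monomial, Finsupp.single_apply]
    exact if_congr Subtype.coe_inj rfl rfl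
  rw [h]

instance (n p : ℕ) : FiniteDimensional ℂ (SymPow n p) := (monoBasis n p).finiteDimensional_of_finite

theorem coe_symLie {n p : ℕ} (A : Matrix (Fin n) (Fin n) ℂ) (f : SymPow n p) :
    (symLie n p A f : MvPolynomial (Fin n) ℂ) = linDer A f := rfl

theorem coe_symRep {n p : ℕ} (g : GL (Fin n) ℂ) (f : SymPow n p) :
    (symRep n p g f : MvPolynomial (Fin n) ℂ) = linSubst (g : Matrix (Fin n) (Fin n) ℂ) f := rfl

theorem symRep_symLie {n p : ℕ} (g : GL (Fin n) ℂ) {A B : Matrix (Fin n) (Fin n) ℂ}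
    (h : (g : Matrix (Fin n) (Fin n) ℂ) * A = B * g) (f : SymPow n p) :
    symRep n p g (symLie n p A f) = symLie n p B (symRep n p g f) :=
  Subtype.ext (linSubst_linDer h f)

/-- The basis of `Sym^p(ℂⁿ)` formed by the monomials in the columns of the invertible matrix `g`. -/
noncomputable def twistBasis {n : ℕ} (g : GL (Fin n) ℂ) (p : ℕ) :
    Module.Basis (Expo n p) ℂ (SymPow n p) :=
  (monoBasis n p).map (LinearEquiv.ofBijective (symRep n p g)
    ⟨((symRep n p).apply_bijective g).1, ((symRep n p).apply_bijective g).2⟩)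

theorem twistBasis_apply {n p : ℕ} (g : GL (Fin n) ℂ) (d : Expo n p) :
    twistBasis g p d = symRep n p g (monoBasis n p d) := by
  rw [twistBasis, Module.Basis.map_apply]
  rfl

/-- If the columns of `g` are eigenvectors of `A`, the monomials in these columns are eigenvectors of
the action of `A` on `Sym^p(ℂⁿ)`. -/
theorem symLie_twistBasis {n p : ℕ} (g : GL (Fin n) ℂ) {A : Matrix (Fin n) (Fin n) ℂ}
    {w : Fin n → ℂ} (h : (g : Matrix (Fin n) (Fin n) ℂ) * Matrix.diagonal w = A * g)
    (d : Expo n p) :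
    symLie n p A (twistBasis g p d) = (∑ i, (d.1 i : ℂ) * w i) • twistBasis g p d := by
  rw [twistBasis_apply, ← symRep_symLie g h, ← map_smul]
  congr 1
  apply Subtype.ext
  rw [coe_symLie, Submodule.coe_smul, coe_monoBasis, linDer_diagonal_monomial]

theorem symRep_twistBasis {n p : ℕ} (g B : GL (Fin n) ℂ)
    {t : Fin n → ℂ} (h : (g : Matrix (Fin n) (Fin n) ℂ) * Matrix.diagonal t = B * g)
    (d : Expo n p) :
    symRep n p B (twistBasis g p d) = (∏ i, t i ^ d.1 i) • twistBasis g p d := by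
  apply Subtype.ext
  rw [twistBasis_apply, coe_symRep, coe_symRep, Submodule.coe_smul, coe_symRep, coe_monoBasis,
    ← AlgHom.comp_apply, ← linSubst_mul, ← h, linSubst_mul, AlgHom.comp_apply,
    linSubst_diagonal_monomial, map_smul]


/-! ### The angular momentum operators in `so(3)` -/

/-- The component `i L₃` of the angular momentum along the third axis. -/
noncomputable def spinH : so3 :=
  ⟨!![0, -Complex.I, 0; Complex.I, 0, 0; 0, 0, 0], by
    rw [LieAlgebra.Orthogonal.mem_so]
    ext i k
    fin_cases i <;> fin_cases k <;> simp⟩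

/-- The raising operator `i (L₁ + i L₂)`. -/
noncomputable def spinE : so3 :=
  ⟨!![0, 0, -1; 0, 0, -Complex.I; 1, Complex.I, 0], by
    rw [LieAlgebra.Orthogonal.mem_so]
    ext i k
    fin_cases i <;> fin_cases k <;> simp⟩

/-- The lowering operator `i (L₁ - i L₂)`. -/
noncomputable def spinF : so3 :=
  ⟨!![0, 0, 1; 0, 0, -Complex.I; -1, Complex.I, 0], by
    rw [LieAlgebra.Orthogonal.mem_so]
    ext i k
    fin_cases i <;> fin_cases k <;> simp⟩

theorem lie_spinH_spinE : ⁅spinH, spinE⁆ = spinE := by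
  apply Subtype.ext
  rw [LieSubalgebra.coe_bracket, Ring.lie_def]
  ext i k
  fin_cases i <;> fin_cases k <;> simp [spinH, spinE]

theorem lie_spinH_spinF : ⁅spinH, spinF⁆ = -spinF := by
  apply Subtype.ext
  rw [LieSubalgebra.coe_bracket, Ring.lie_def]
  ext i k
  fin_cases i <;> fin_cases k <;> simp [spinH, spinF]

theorem lie_spinE_spinF : ⁅spinE, spinF⁆ = (2 : ℂ) • spinH := by
  apply Subtype.ext
  rw [LieSubalgebra.coe_bracket, Ring.lie_def]
  ext i k
  fin_cases i <;> fin_cases k <;>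
    simp [spinH, spinE, spinF] <;> ring

theorem so3_eq_smul_add (A : so3) : ∃ a b c : ℂ, A = a • spinH + b • spinE + c • spinF := by
  have hs : ∀ i k, A.1 k i = -A.1 i k := fun i k => by
    have h := congrFun (congrFun ((LieAlgebra.Orthogonal.mem_so _ _ _).1 A.2) i) k
    simpa using h
  have h0 : ∀ i, A.1 i i = 0 := fun i => by
    linear_combination (1 / 2 : ℂ) * hs i i
  refine ⟨-Complex.I * A.1 1 0, (A.1 2 0 - Complex.I * A.1 2 1) / 2,
    (-Complex.I * A.1 2 1 - A.1 2 0) / 2, Subtype.ext ?_⟩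
  have hI := Complex.I_mul_I
  ext i k
  fin_cases i <;> fin_cases k <;>
    simp [spinH, spinE, spinF, h0, hs 1 0, hs 2 0, hs 2 1, -Complex.I_mul_I]
  all_goals first
    | ring1
    | linear_combination (-A.1 1 0) * hI
    | linear_combination A.1 1 0 * hI
    | linear_combination (-A.1 2 1) * hI
    | linear_combination A.1 2 1 * hI

section

variable {W : Type*} [AddCommGroup W] [Module ℂ W]

theorem isSpinTriple (σ : so3 →ₗ⁅ℂ⁆ Module.End ℂ W) :
    IsSpinTriple (σ spinH) (σ spinE) (σ spinF) where
  HE := by rw [← Ring.lie_def, ← LieHom.map_lie, lie_spinH_spinE]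
  HF := by rw [← Ring.lie_def, ← LieHom.map_lie, lie_spinH_spinF, map_neg]
  EF := by rw [← Ring.lie_def, ← LieHom.map_lie, lie_spinE_spinF, map_smul]

theorem mem_lieIntertwiners_iff {j : ℕ} {σ : so3 →ₗ⁅ℂ⁆ Module.End ℂ W}
    {T : harmonics j →ₗ[ℂ] W} : T ∈ lieIntertwiners j σ ↔ ∀ A v, T (spinLie j A v) = σ A (T v) :=
  ⟨fun h A v => LinearMap.congr_fun (h A) v, fun h A => LinearMap.ext (h A)⟩

/-- It suffices to test equivariance on `H`, `E`, `F`. -/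
theorem equivariant_of_spin {V : Type*} [AddCommGroup V] [Module ℂ V]
    {τ : so3 →ₗ⁅ℂ⁆ Module.End ℂ V} {σ : so3 →ₗ⁅ℂ⁆ Module.End ℂ W} {T : V →ₗ[ℂ] W} {v : V}
    (hH : T (τ spinH v) = σ spinH (T v)) (hE : T (τ spinE v) = σ spinE (T v))
    (hF : T (τ spinF v) = σ spinF (T v)) (A : so3) : T (τ A v) = σ A (T v) := by
  obtain ⟨a, b, c, rfl⟩ := so3_eq_smul_add A
  simp [hH, hE, hF]

end

/-! ### The weight basis -/

/-- The change of basis of `ℂ³` to eigenvectors of `spinH`, of weights `1`, `-1`, `0`. -/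
noncomputable def spinBasis : GL (Fin 3) ℂ :=
  Matrix.GeneralLinearGroup.mkOfDetNeZero !![1, 1, 0; Complex.I, -Complex.I, 0; 0, 0, 1] (by
    rw [Matrix.det_fin_three]
    simp
    intro h
    have := congrArg Complex.im h
    norm_num at this)

theorem coe_spinBasis : (spinBasis : Matrix (Fin 3) (Fin 3) ℂ) =
    !![1, 1, 0; Complex.I, -Complex.I, 0; 0, 0, 1] := rfl

/-- The weights of `ℂ³`. -/
def spinWt : Fin 3 → ℤ := ![1, -1, 0]

theorem spinBasis_mul_diagonal :
    (spinBasis : Matrix (Fin 3) (Fin 3) ℂ) * Matrix.diagonal (fun i => (spinWt i : ℂ)) =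
      spinH.1 * spinBasis := by
  rw [coe_spinBasis]
  ext i k
  fin_cases i <;> fin_cases k <;>
    simp [spinH, spinWt, Matrix.mul_apply, Fin.sum_univ_three, Matrix.diagonal]

theorem blockEmb_diagonal (N : ℕ) (d : Fin 3 → ℂ) :
    blockEmb N (Matrix.diagonal d) = Matrix.diagonal fun i => d (finProdFinEquiv.symm i).2 := by
  ext i k
  obtain ⟨⟨α, a⟩, rfl⟩ := finProdFinEquiv.surjective i
  obtain ⟨⟨β, b⟩, rfl⟩ := finProdFinEquiv.surjective k
  rw [blockEmb_apply, Matrix.diagonal_apply, Matrix.diagonal_apply]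
  simp only [EmbeddingLike.apply_eq_iff_eq, Prod.mk.injEq, Equiv.symm_apply_apply]
  by_cases h : α = β <;> simp [h]

/-- The image of an invertible matrix under the block-diagonal embedding. -/
noncomputable def blockGL (N : ℕ) : GL (Fin 3) ℂ →* GL (Fin (N * 3)) ℂ :=
  Units.map (blockEmb N : Matrix (Fin 3) (Fin 3) ℂ →* _)

theorem coe_blockGL (N : ℕ) (g : GL (Fin 3) ℂ) :
    (blockGL N g : Matrix (Fin (N * 3)) (Fin (N * 3)) ℂ) = blockEmb N g := rfl

/-- The weight `∑ᵢ dᵢ wᵢ` of a monomial with exponents `d` in variables of weights `w`. -/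
def wtOf {n : ℕ} (w : Fin n → ℤ) (d : Fin n →₀ ℕ) : ℤ := ∑ i, d i * w i

/-- The weight of a monomial of `Sym^p(ℂ^{3N})` in the variables given by the weight basis. -/
def expoWt {N p : ℕ} (d : Expo (N * 3) p) : ℤ :=
  wtOf (fun i => spinWt (finProdFinEquiv.symm i).2) d.1

/-- The weight basis of `Sym^p(ℂ^{3N})`. -/
noncomputable def wtBasis (N p : ℕ) : Module.Basis (Expo (N * 3) p) ℂ (SymPow (N * 3) p) :=
  twistBasis (blockGL N spinBasis) p

/-- The restriction of `V^{p}` to `so(3)`. -/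
noncomputable abbrev symSo3 (N p : ℕ) : so3 →ₗ⁅ℂ⁆ Module.End ℂ (SymPow (N * 3) p) :=
  (symLie (N * 3) p).comp (so3ToGl N)

theorem symSo3_spinH_wtBasis {N p : ℕ} (d : Expo (N * 3) p) :
    symSo3 N p spinH (wtBasis N p d) = (expoWt d : ℂ) • wtBasis N p d := by
  have h := congrArg (blockEmb N) spinBasis_mul_diagonal
  rw [map_mul, map_mul, blockEmb_diagonal, ← coe_blockGL] at h
  have h2 := symLie_twistBasis (p := p) _ h d
  rw [expoWt, wtOf]
  push_cast
  exact h2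


/-! ### Harmonic polynomials: highest weight vector and dimension -/

theorem highestVec_mem (j : ℕ) :
    (X 0 + C Complex.I * X 1 : MvPolynomial (Fin 3) ℂ) ^ j ∈ harmonics j := by
  constructor
  · have h : (X 0 + C Complex.I * X 1 : MvPolynomial (Fin 3) ℂ).IsHomogeneous 1 :=
      (isHomogeneous_X ℂ _).add (by simpa using (isHomogeneous_C _ _).mul (isHomogeneous_X ℂ _))
    simpa using h.pow j
  · have hI : (C Complex.I * C Complex.I : MvPolynomial (Fin 3) ℂ) = -1 := by
      rw [← C_mul, Complex.I_mul_I, C_neg, C_1]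
    change laplacian _ = 0
    rw [laplacian_apply, Fin.sum_univ_three]
    simp only [pderiv_pow, pderiv_mul, map_add, pderiv_X, pderiv_C,
      Derivation.map_natCast, Pi.single_apply]
    simp
    linear_combination ((j : MvPolynomial (Fin 3) ℂ) * (((j - 1 : ℕ) : MvPolynomial (Fin 3) ℂ) *
      (X 0 + C Complex.I * X 1 : MvPolynomial (Fin 3) ℂ) ^ (j - 1 - 1))) * hI

/-- The highest weight vector `(x + i y)^j` of the spin `j` representation. -/
noncomputable def highestVec (j : ℕ) : harmonics j := ⟨_, highestVec_mem j⟩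

theorem highestVec_ne_zero (j : ℕ) : highestVec j ≠ 0 := by
  intro h
  have h1 := congrArg (fun f : harmonics j => aeval (![1, 0, 0] : Fin 3 → ℂ) f.1) h
  simp [highestVec] at h1

theorem coe_spinLie {j : ℕ} (A : so3) (f : harmonics j) :
    (spinLie j A f : MvPolynomial (Fin 3) ℂ) = linDer (A : Matrix (Fin 3) (Fin 3) ℂ) f := rfl

theorem spinLie_spinH_highestVec (j : ℕ) :
    spinLie j spinH (highestVec j) = (j : ℂ) • highestVec j := by
  apply Subtype.ext
  have hu : linDer spinH.1 (X 0 + C Complex.I * X 1) =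
      (X 0 + C Complex.I * X 1 : MvPolynomial (Fin 3) ℂ) := by
    rw [map_add, C_mul', Derivation.map_smul, linDer_X, linDer_X, Fin.sum_univ_three,
      Fin.sum_univ_three]
    simp [spinH, smul_eq_C_mul, ← mul_assoc, ← C_mul, add_comm]
  rw [coe_spinLie, Submodule.coe_smul, highestVec, Derivation.leibniz_pow, hu]
  rcases j with _ | j
  · simp
  · rw [Nat.add_sub_cancel, smul_eq_mul, ← pow_succ, Nat.cast_smul_eq_nsmul]

theorem spinLie_spinE_highestVec (j : ℕ) : spinLie j spinE (highestVec j) = 0 := by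
  apply Subtype.ext
  have hu : linDer spinE.1 (X 0 + C Complex.I * X 1) = (0 : MvPolynomial (Fin 3) ℂ) := by
    rw [map_add, C_mul', Derivation.map_smul, linDer_X, linDer_X, Fin.sum_univ_three,
      Fin.sum_univ_three]
    simp [spinE, smul_eq_C_mul, ← mul_assoc, ← C_mul]
  rw [coe_spinLie, highestVec, Derivation.leibniz_pow, hu]
  simp

/-- The exponent vector `(a, b, c)`. -/
noncomputable def expo3 (a b c : ℕ) : Fin 3 →₀ ℕ := Finsupp.equivFunOnFinite.symm ![a, b, c]

@[simp] theorem expo3_zero (a b c : ℕ) : expo3 a b c 0 = a := rfl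

@[simp] theorem expo3_one (a b c : ℕ) : expo3 a b c 1 = b := rfl

@[simp] theorem expo3_two (a b c : ℕ) : expo3 a b c 2 = c := rfl

/-- A harmonic polynomial `f` is determined by the restrictions of `f` and `∂₃ f` to the plane
`x₃ = 0`, that is, by its coefficients of degree at most one in `x₃`. -/
theorem harmonic_eq_zero {j : ℕ} (f : harmonics j)
    (h0 : ∀ a < j + 1, coeff (expo3 a (j - a) 0) f.1 = 0)
    (h1 : ∀ a < j, coeff (expo3 a (j - 1 - a) 1) f.1 = 0) : f = 0 := by
  have hL : ∑ i : Fin 3, pderiv i (pderiv i f.1) = 0 := by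
    rw [← laplacian_apply]
    exact f.2.2
  have key : ∀ n, ∀ s : Fin 3 →₀ ℕ, s 2 = n → coeff s f.1 = 0 := by
    intro n
    induction n using Nat.strong_induction_on with
    | _ n ih =>
      intro s hs
      by_cases hd : s.degree = j
      swap
      · exact f.2.1.coeff_eq_zero hd
      rw [Finsupp.degree_eq_sum, Fin.sum_univ_three, hs] at hd
      rcases n with _ | _ | n
      · have e : s = expo3 (s 0) (j - s 0) 0 := by
          ext i
          fin_cases i <;> (simp [hs]; try omega)
        rw [e]
        exact h0 _ (by omega)
      · have e : s = expo3 (s 0) (j - 1 - s 0) 1 := by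
          ext i
          fin_cases i <;> (simp [hs]; try omega)
        rw [e]
        exact h1 _ (by omega)
      -- the Laplace equation expresses the coefficient of `x₃^(n + 2)` by coefficients of `x₃^n`
      · have e : s = expo3 (s 0) (s 1) n + Finsupp.single 2 1 + Finsupp.single 2 1 := by
          ext i
          fin_cases i <;> simp [hs]
        have h := congrArg (coeff (expo3 (s 0) (s 1) n)) hL
        rw [Fin.sum_univ_three, coeff_add, coeff_add] at h
        simp only [coeff_pderiv, coeff_zero] at h
        rw [← e, ih n (by omega) (expo3 (s 0) (s 1) n + Finsupp.single 0 1 + Finsupp.single 0 1)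
          (by simp), ih n (by omega)
          (expo3 (s 0) (s 1) n + Finsupp.single 1 1 + Finsupp.single 1 1) (by simp),
          zero_mul, zero_mul, zero_mul, zero_mul, zero_add, zero_add, mul_eq_zero, mul_eq_zero] at h
        rcases h with (h | h) | h
        · exact h
        · exact absurd h (by simpa [Finsupp.single_apply] using Nat.cast_add_one_ne_zero (R := ℂ) (n + 1))
        · exact absurd h (Nat.cast_add_one_ne_zero _)
  apply Subtype.ext
  ext s
  exact key _ s rfl

/-- The coefficients of degree at most one in `x₃`. -/
noncomputable def lowCoeffs (j : ℕ) : harmonics j →ₗ[ℂ] (Fin (j + 1) ⊕ Fin j → ℂ) where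
  toFun f := Sum.elim (fun a => coeff (expo3 a (j - a) 0) f.1)
    fun a => coeff (expo3 a (j - 1 - a) 1) f.1
  map_add' f g := by
    ext (a | a) <;> simp
  map_smul' c f := by
    ext (a | a) <;> simp

theorem lowCoeffs_injective (j : ℕ) : Function.Injective (lowCoeffs j) := by
  rw [← LinearMap.ker_eq_bot, LinearMap.ker_eq_bot']
  intro f hf
  exact harmonic_eq_zero f (fun a ha => congrFun hf (Sum.inl ⟨a, ha⟩))
    fun a ha => congrFun hf (Sum.inr ⟨a, ha⟩)

instance (j : ℕ) : FiniteDimensional ℂ (harmonics j) :=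
  Module.Finite.of_injective _ (lowCoeffs_injective j)

theorem finrank_harmonics_le (j : ℕ) : Module.finrank ℂ (harmonics j) ≤ 2 * j + 1 := by
  have h := LinearMap.finrank_le_finrank_of_injective (lowCoeffs_injective j)
  simp only [Module.finrank_fintype_fun_eq_card, Fintype.card_sum, Fintype.card_fin] at h
  omega

/-- The lowerings of the highest weight vector have different weights. -/
theorem linearIndependent_lowering (j : ℕ) :
    LinearIndependent ℂ fun k : Fin (2 * j + 1) => (spinLie j spinF ^ (k : ℕ)) (highestVec j) := by
  have t := isSpinTriple (spinLie j)
  refine Module.End.eigenvectors_linearIndependent' (spinLie j spinH)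
    (fun k : Fin (2 * j + 1) => (j : ℂ) - (k : ℕ))
    (fun a b h => ?_) _ fun k => ⟨?_, ?_⟩
  · have h' : (j : ℂ) - (a : ℕ) = j - (b : ℕ) := h
    exact Fin.ext (Nat.cast_injective (sub_right_injective h'))
  · exact Module.End.mem_eigenspace_iff.2 (t.H_pow_F (spinLie_spinH_highestVec j) k)
  · refine t.pow_F_ne_zero (spinLie_spinH_highestVec j) (spinLie_spinE_highestVec j)
      (highestVec_ne_zero j) k fun l hl h => ?_
    have h2 : ((2 * j : ℕ) : ℂ) = (l : ℂ) := by
      push_cast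
      exact h
    have := Nat.cast_injective h2
    omega

theorem finrank_harmonics (j : ℕ) : Module.finrank ℂ (harmonics j) = 2 * j + 1 := by
  refine le_antisymm (finrank_harmonics_le j) ?_
  simpa using (linearIndependent_lowering j).fintype_card_le_finrank

/-- The basis of the spin `j` representation obtained by lowering the highest weight vector. -/
noncomputable def spinLadder (j : ℕ) : Module.Basis (Fin (2 * j + 1)) ℂ (harmonics j) :=
  basisOfLinearIndependentOfCardEqFinrank (linearIndependent_lowering j)
    (by rw [finrank_harmonics, Fintype.card_fin])

theorem spinLadder_apply (j : ℕ) (k : Fin (2 * j + 1)) :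
    spinLadder j k = (spinLie j spinF ^ (k : ℕ)) (highestVec j) := by
  simp [spinLadder]


/-! ### Multiplicities are dimensions of spaces of highest weight vectors -/

section

variable {W : Type*} [AddCommGroup W] [Module ℂ W]

theorem map_pow_spinLie {j : ℕ} {σ : so3 →ₗ⁅ℂ⁆ Module.End ℂ W} {T : harmonics j →ₗ[ℂ] W}
    (hT : T ∈ lieIntertwiners j σ) (A : so3) (k : ℕ) (v : harmonics j) :
    T ((spinLie j A ^ k) v) = (σ A ^ k) (T v) := by
  induction k with
  | zero => simp
  | succ k ih =>
    rw [pow_succ', Module.End.mul_apply, mem_lieIntertwiners_iff.1 hT, ih, pow_succ',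
      Module.End.mul_apply]

/-- An intertwiner from the spin `j` representation is determined by the image of the highest
weight vector. -/
theorem eq_zero_of_map_highestVec {j : ℕ} {σ : so3 →ₗ⁅ℂ⁆ Module.End ℂ W} {T : harmonics j →ₗ[ℂ] W}
    (hT : T ∈ lieIntertwiners j σ) (h : T (highestVec j) = 0) : T = 0 := by
  refine (spinLadder j).ext fun k => ?_
  rw [spinLadder_apply, map_pow_spinLie hT, h, map_zero, LinearMap.zero_apply]

theorem map_highestVec_mem {j : ℕ} {σ : so3 →ₗ⁅ℂ⁆ Module.End ℂ W} {T : harmonics j →ₗ[ℂ] W}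
    (hT : T ∈ lieIntertwiners j σ) :
    T (highestVec j) ∈ IsSpinTriple.highest (σ spinH) (σ spinE) j := by
  rw [IsSpinTriple.mem_highest, ← mem_lieIntertwiners_iff.1 hT, ← mem_lieIntertwiners_iff.1 hT,
    spinLie_spinE_highestVec, spinLie_spinH_highestVec, map_zero, map_smul]
  exact ⟨rfl, rfl⟩

variable [FiniteDimensional ℂ W]

/-- Every highest weight vector of weight `j` is the image of the highest weight vector of the
spin `j` representation under an intertwiner. -/
theorem exists_intertwiner {j : ℕ} (σ : so3 →ₗ⁅ℂ⁆ Module.End ℂ W) {w : W}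
    (hw : w ∈ IsSpinTriple.highest (σ spinH) (σ spinE) j) :
    ∃ T ∈ lieIntertwiners j σ, T (highestVec j) = w := by
  rw [IsSpinTriple.mem_highest] at hw
  obtain ⟨hE, hH⟩ := hw
  have t := isSpinTriple σ
  have t' := isSpinTriple (spinLie j)
  have hE' := spinLie_spinE_highestVec j
  have hH' := spinLie_spinH_highestVec j
  set T : harmonics j →ₗ[ℂ] W := (spinLadder j).constr ℂ fun k => (σ spinF ^ (k : ℕ)) w with hTdef
  have hT : ∀ k ≤ 2 * j + 1,
      T ((spinLie j spinF ^ k) (highestVec j)) = (σ spinF ^ k) w := by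
    intro k hk
    rcases hk.lt_or_eq with hk | rfl
    · have h := (spinLadder j).constr_basis ℂ (fun k => (σ spinF ^ (k : ℕ)) w) ⟨k, hk⟩
      rwa [spinLadder_apply] at h
    · rw [t'.pow_F_eq_zero hH' hE', t.pow_F_eq_zero hH hE, map_zero]
  refine ⟨T, mem_lieIntertwiners_iff.2 fun A v => ?_, by simpa using hT 0 (by omega)⟩
  suffices h : T ∘ₗ spinLie j A = σ A ∘ₗ T from LinearMap.congr_fun h v
  refine (spinLadder j).ext fun k => ?_
  have hk := k.2
  rw [LinearMap.comp_apply, LinearMap.comp_apply, spinLadder_apply]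
  refine equivariant_of_spin ?_ ?_ ?_ A
  · rw [t'.H_pow_F hH', map_smul, hT k (by omega), t.H_pow_F hH]
  · rcases hk0 : (k : ℕ) with _ | l
    · have h0 := hT 0 (by omega)
      simp only [pow_zero, Module.End.one_apply] at h0 ⊢
      rw [h0, hE, hE', map_zero]
    · rw [t'.E_pow_F hH' hE', map_smul, hT l (by omega), hT (l + 1) (by omega), t.E_pow_F hH hE]
  · rw [← Module.End.mul_apply, ← pow_succ', hT (k + 1) (by omega), hT k (by omega),
      ← Module.End.mul_apply, ← pow_succ']

theorem lieMult_eq_finrank_highest (j : ℕ) (σ : so3 →ₗ⁅ℂ⁆ Module.End ℂ W) :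
    lieMult j σ = Module.finrank ℂ (IsSpinTriple.highest (σ spinH) (σ spinE) j) := by
  let φ : lieIntertwiners j σ →ₗ[ℂ] IsSpinTriple.highest (σ spinH) (σ spinE) (j : ℂ) :=
    { toFun := fun T => ⟨T.1 (highestVec j), map_highestVec_mem T.2⟩
      map_add' := fun S T => rfl
      map_smul' := fun c T => rfl }
  refine (LinearEquiv.ofBijective φ ⟨?_, ?_⟩).finrank_eq
  · rw [← LinearMap.ker_eq_bot, LinearMap.ker_eq_bot']
    intro T hT
    exact Subtype.ext (eq_zero_of_map_highestVec T.2 (congrArg Subtype.val hT))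
  · rintro ⟨w, hw⟩
    obtain ⟨T, hT, rfl⟩ := exists_intertwiner σ hw
    exact ⟨⟨T, hT⟩, rfl⟩

variable {ι : Type*} [Fintype ι]

omit [FiniteDimensional ℂ W] in
/-- If a basis consists of eigenvectors of `H` with integral eigenvalues, the dimension of a weight
space is the number of basis vectors of that weight. -/
theorem finrank_eigenspace_eq_card {H : Module.End ℂ W} (b : Module.Basis ι ℂ W) (wt : ι → ℤ)
    (hb : ∀ i, H (b i) = (wt i : ℂ) • b i) (m : ℤ) :
    Module.finrank ℂ (H.eigenspace (m : ℂ)) = (Finset.univ.filter fun i => wt i = m).card := by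
  have hr : ∀ (v : W) i, b.repr (H v) i = wt i * b.repr v i := by
    intro v i
    conv_lhs => rw [← b.sum_repr v]
    rw [map_sum, map_sum, Finsupp.finsetSum_apply, Finset.sum_eq_single i]
    · simp [hb, mul_comm]
    · intro k _ hk
      simp [hb, hk]
    · simp
  have h : H.eigenspace (m : ℂ) =
      Submodule.span ℂ (Set.range fun i : {i // wt i = m} => b i) := by
    apply le_antisymm
    · intro v hv
      rw [← b.sum_repr v]
      refine Submodule.sum_mem _ fun i _ => ?_
      by_cases hi : wt i = m
      · exact Submodule.smul_mem _ _ (Submodule.subset_span ⟨⟨i, hi⟩, rfl⟩)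
      · have h1 := hr v i
        rw [Module.End.mem_eigenspace_iff.1 hv, map_smul, Finsupp.smul_apply, smul_eq_mul] at h1
        have h2 : b.repr v i = 0 := by
          by_contra h0
          exact hi (by exact_mod_cast (mul_right_cancel₀ h0 h1).symm)
        rw [h2, zero_smul]
        exact Submodule.zero_mem _
    · rw [Submodule.span_le]
      rintro _ ⟨⟨i, rfl⟩, rfl⟩
      exact Module.End.mem_eigenspace_iff.2 (hb i)
  have hc := finrank_span_eq_card
    (b.linearIndependent.comp (Subtype.val : {i // wt i = m} → ι) Subtype.val_injective)
  rw [Fintype.card_subtype] at hc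
  rw [h]
  exact hc

omit [FiniteDimensional ℂ W] in
/-- The multiplicity of spin `j` is the number of weights equal to `j` minus the number of weights
equal to `j + 1`. -/
theorem lieMult_add_card (σ : so3 →ₗ⁅ℂ⁆ Module.End ℂ W) (b : Module.Basis ι ℂ W) (wt : ι → ℤ)
    (hb : ∀ i, σ spinH (b i) = (wt i : ℂ) • b i) (j : ℕ) :
    lieMult j σ + (Finset.univ.filter fun i => wt i = j + 1).card =
      (Finset.univ.filter fun i => wt i = j).card := by
  have := b.finiteDimensional_of_finite
  have h := (isSpinTriple σ).finrank_highest j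
  rw [lieMult_eq_finrank_highest]
  have h1 := finrank_eigenspace_eq_card b wt hb j
  have h2 := finrank_eigenspace_eq_card b wt hb (j + 1)
  rw [Int.cast_natCast] at h1
  rw [Int.cast_add, Int.cast_natCast, Int.cast_one] at h2
  rw [← h1, ← h2, h]

end

/-! ### Complete decomposition -/

/-- A vector of the spin `j` representation killed by `E` is a multiple of the highest weight
vector. -/
theorem exists_eq_smul_highestVec {j : ℕ} {y : harmonics j} (hy : spinLie j spinE y = 0) :
    ∃ c : ℂ, y = c • highestVec j := by
  have t := isSpinTriple (spinLie j)
  have hE := spinLie_spinE_highestVec j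
  have hH := spinLie_spinH_highestVec j
  set a := (spinLadder j).repr y with ha
  have hsum := (spinLadder j).sum_repr y
  rw [← ha, Fin.sum_univ_succ] at hsum
  simp only [spinLadder_apply, Fin.val_zero, pow_zero, Module.End.one_apply, Fin.val_succ] at hsum
  have h0 := hy
  rw [← hsum, map_add, map_smul, hE, smul_zero, zero_add, map_sum] at h0
  simp only [map_smul, t.E_pow_F hH hE, smul_smul] at h0
  have hli := (linearIndependent_lowering j).comp _ (Fin.castSucc_injective (2 * j))
  have h1 := Fintype.linearIndependent_iff.1 hli _ h0
  refine ⟨a 0, ?_⟩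
  rw [← hsum, add_eq_left]
  refine Finset.sum_eq_zero fun k _ => ?_
  have h2 := h1 k
  rw [mul_eq_zero, mul_eq_zero, sub_eq_zero] at h2
  rcases h2 with h2 | h2 | h2
  · rw [h2, zero_smul]
  · exact absurd h2 (Nat.cast_add_one_ne_zero _)
  · have h3 : ((2 * j : ℕ) : ℂ) = ((k : ℕ) : ℂ) := by
      push_cast
      exact h2
    have := Nat.cast_injective h3
    have := k.2
    omega

theorem mem_maxGenEigenspace_zero {V : Type*} [AddCommGroup V] [Module ℂ V] (A : Module.End ℂ V)
    (v : V) : v ∈ A.maxGenEigenspace 0 ↔ ∃ k, (A ^ k) v = 0 := by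
  rw [Module.End.mem_maxGenEigenspace, zero_smul, sub_zero]

theorem exists_pow_spinE_eq_zero {j : ℕ} (y : harmonics j) : ∃ k, (spinLie j spinE ^ k) y = 0 := by
  have h : (spinLie j spinE).maxGenEigenspace 0 = ⊤ := by
    rw [eq_top_iff, ← (spinLadder j).span_eq, Submodule.span_le]
    rintro _ ⟨k, rfl⟩
    rw [SetLike.mem_coe, mem_maxGenEigenspace_zero, spinLadder_apply]
    have t := isSpinTriple (spinLie j)
    exact t.exists_pow_E_eq_zero (t.H_pow_F (spinLie_spinH_highestVec j) k)
  exact (mem_maxGenEigenspace_zero _ y).1 (h ▸ Submodule.mem_top)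

section

variable {W : Type*} [AddCommGroup W] [Module ℂ W] [FiniteDimensional ℂ W]

/-- A basis of the space of intertwiners. -/
noncomputable def intertwinerBasis (j : ℕ) (σ : so3 →ₗ⁅ℂ⁆ Module.End ℂ W) :
    Module.Basis (Fin (lieMult j σ)) ℂ (lieIntertwiners j σ) :=
  Module.finBasis ℂ (lieIntertwiners j σ)

/-- The evaluation map from the sum of the isotypic components of spin at most `p` to the
representation. -/
noncomputable def isotypicSum (σ : so3 →ₗ⁅ℂ⁆ Module.End ℂ W) (p : ℕ) :
    ((j : Fin (p + 1)) → Fin (lieMult (j : ℕ) σ) → harmonics (j : ℕ)) →ₗ[ℂ] W :=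
  ∑ j : Fin (p + 1), ∑ i : Fin (lieMult (j : ℕ) σ),
    (intertwinerBasis j σ i).1 ∘ₗ LinearMap.proj i ∘ₗ LinearMap.proj j

theorem isotypicSum_apply (σ : so3 →ₗ⁅ℂ⁆ Module.End ℂ W) (p : ℕ)
    (x : (j : Fin (p + 1)) → Fin (lieMult (j : ℕ) σ) → harmonics (j : ℕ)) :
    isotypicSum σ p x =
      ∑ j : Fin (p + 1), ∑ i, (intertwinerBasis j σ i).1 (x j i) := by
  simp [isotypicSum, LinearMap.sum_apply]

theorem isotypicSum_equivariant (σ : so3 →ₗ⁅ℂ⁆ Module.End ℂ W) (p : ℕ) (A : so3) (k : ℕ)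
    (x : (j : Fin (p + 1)) → Fin (lieMult (j : ℕ) σ) → harmonics (j : ℕ)) :
    isotypicSum σ p (fun j i => (spinLie j A ^ k) (x j i)) = (σ A ^ k) (isotypicSum σ p x) := by
  rw [isotypicSum_apply, isotypicSum_apply, map_sum]
  refine Finset.sum_congr rfl fun j _ => ?_
  rw [map_sum]
  exact Finset.sum_congr rfl fun i _ => map_pow_spinLie (Subtype.prop _) A k _

/-- A nonzero vector of the kernel could be raised to one killed by `E`; its components would
be highest weight vectors, contradicting the linear independence of the intertwiners. -/
theorem isotypicSum_injective (σ : so3 →ₗ⁅ℂ⁆ Module.End ℂ W) (p : ℕ) :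
    Function.Injective (isotypicSum σ p) := by
  rw [← LinearMap.ker_eq_bot, LinearMap.ker_eq_bot']
  intro x hx
  by_contra hne
  -- `y k` is the vector `E ^ k x`
  let y : ℕ → (j : Fin (p + 1)) → Fin (lieMult (j : ℕ) σ) → harmonics (j : ℕ) :=
    fun k j i => (spinLie j spinE ^ k) (x j i)
  have hex : ∃ k, y k = 0 := by
    choose k hk using fun (j : Fin (p + 1)) (i : Fin (lieMult (j : ℕ) σ)) =>
      exists_pow_spinE_eq_zero (x j i)
    refine ⟨∑ j, ∑ i, k j i, ?_⟩
    ext1 j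
    ext1 i
    have hle : k j i ≤ ∑ j, ∑ i, k j i :=
      (Finset.single_le_sum (f := fun i => k j i) (fun _ _ => Nat.zero_le _)
        (Finset.mem_univ i)).trans
        (Finset.single_le_sum (f := fun j => ∑ i, k j i) (fun _ _ => Nat.zero_le _)
          (Finset.mem_univ j))
    obtain ⟨l, hl⟩ := Nat.exists_eq_add_of_le' hle
    change (spinLie j spinE ^ _) (x j i) = 0
    rw [hl, pow_add, Module.End.mul_apply, hk, map_zero]
  -- the last nonzero `y k` has components that are highest weight vectors
  obtain ⟨k, hk0, hk⟩ := Nat.exists_not_and_succ_of_not_zero_of_exists (p := fun k => y k = 0)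
    hne hex
  have hyE : ∀ (j : Fin (p + 1)) i, spinLie j spinE (y k j i) = 0 := fun j i => by
    have h := congrFun (congrFun hk j) i
    change (spinLie j spinE ^ (k + 1)) (x j i) = 0 at h
    rwa [pow_succ', Module.End.mul_apply] at h
  choose c hc using fun (j : Fin (p + 1)) i => exists_eq_smul_highestVec (hyE j i)
  have hS : isotypicSum σ p (y k) = 0 := by
    rw [isotypicSum_equivariant, hx, map_zero]
  rw [isotypicSum_apply] at hS
  have hT : ∀ j : Fin (p + 1), (∑ i : Fin (lieMult (j : ℕ) σ),
      c j i • intertwinerBasis j σ i).1 (highestVec j) =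
      ∑ i, (intertwinerBasis j σ i).1 (y k j i) := by
    intro j
    simp [hc, LinearMap.sum_apply]
  -- the contributions of different spins `j` to the sum have different weights
  have hind := (iSupIndep_iff_finsetSum_eq_zero_imp_eq_zero _).1
    ((Module.End.eigenspaces_iSupIndep (σ spinH)).comp (f := fun j : Fin (p + 1) => ((j : ℕ) : ℂ))
      fun a b h => Fin.ext (Nat.cast_injective h)) Finset.univ
    (fun j => ∑ i, (intertwinerBasis j σ i).1 (y k j i))
    (fun j _ => by
      rw [← hT]
      exact (map_highestVec_mem (Subtype.prop _)).2) hS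
  refine hk0 ?_
  ext1 j
  ext1 i
  have h1 : (∑ i : Fin (lieMult (j : ℕ) σ),
      c j i • intertwinerBasis j σ i) = 0 :=
    Subtype.ext (eq_zero_of_map_highestVec (Subtype.prop _)
      ((hT j).trans (hind j (Finset.mem_univ _))))
  have h2 := Fintype.linearIndependent_iff.1
    (intertwinerBasis j σ).linearIndependent _ h1 i
  rw [hc, h2, zero_smul]
  rfl

omit [FiniteDimensional ℂ W] in
/-- A representation of `so(3)` with a basis of weight vectors, whose weights are symmetric and
bounded by `p`, is the sum of its isotypic components of spin at most `p`. -/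
theorem exists_decomposition {ι : Type*} [Fintype ι] (σ : so3 →ₗ⁅ℂ⁆ Module.End ℂ W)
    (b : Module.Basis ι ℂ W) (wt : ι → ℤ) (hb : ∀ i, σ spinH (b i) = (wt i : ℂ) • b i)
    (hsymm : ∀ m : ℤ, (Finset.univ.filter fun i => wt i = -m).card =
      (Finset.univ.filter fun i => wt i = m).card)
    (p : ℕ) (hp : ∀ i, (wt i).natAbs ≤ p) :
    ∃ Ψ : W ≃ₗ[ℂ] ((j : Fin (p + 1)) → Fin (lieMult (j : ℕ) σ) → harmonics (j : ℕ)),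
      ∀ (A : so3) w j i, Ψ (σ A w) j i = spinLie j A (Ψ w j i) := by
  classical
  have := b.finiteDimensional_of_finite
  have hmult := lieMult_add_card σ b wt hb
  -- the weights of absolute value at most `n`, counted with the multiplicities of the spins
  have hcount : ∀ n : ℕ, (Finset.univ.filter fun i => (wt i).natAbs ≤ n).card =
      ∑ j ∈ Finset.range (n + 1), (2 * j + 1) * lieMult j σ +
        (2 * n + 1) * (Finset.univ.filter fun i => wt i = n + 1).card := by
    intro n
    induction n with
    | zero =>
      have h := hmult 0
      simp only [Nat.le_zero, Int.natAbs_eq_zero]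
      simpa using h.symm
    | succ n ih =>
      have h1 : (Finset.univ.filter fun i => (wt i).natAbs ≤ n + 1) =
          (Finset.univ.filter fun i => (wt i).natAbs ≤ n) ∪
            ((Finset.univ.filter fun i => wt i = n + 1) ∪
              (Finset.univ.filter fun i => wt i = -(n + 1))) := by
        ext i
        simp only [Finset.mem_filter_univ, Finset.mem_union]
        omega
      rw [h1, Finset.card_union_of_disjoint, Finset.card_union_of_disjoint, ih, hsymm,
        Finset.sum_range_succ _ (n + 1)]
      · have := hmult (n + 1)
        push_cast at this ⊢
        rw [← this]
        ring
      · rw [Finset.disjoint_filter]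
        intro i _ h2 h3
        omega
      · rw [Finset.disjoint_union_right, Finset.disjoint_filter, Finset.disjoint_filter]
        constructor <;>
        · intro i _ h2 h3
          omega
  have hfin : Module.finrank ℂ ((j : Fin (p + 1)) → Fin (lieMult (j : ℕ) σ) → harmonics (j : ℕ)) =
      Module.finrank ℂ W := by
    rw [Module.finrank_pi_fintype, Module.finrank_eq_card_basis b]
    have h1 := hcount p
    rw [Finset.filter_true_of_mem fun i _ => hp i, Finset.card_univ,
      Finset.filter_false_of_mem fun i _ => by have := hp i; omega, Finset.card_empty, mul_zero,
      add_zero, ← Fin.sum_univ_eq_sum_range (fun j => (2 * j + 1) * lieMult j σ)] at h1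
    rw [h1]
    refine Finset.sum_congr rfl fun j _ => ?_
    rw [Module.finrank_pi_fintype, Finset.sum_const, finrank_harmonics, Finset.card_univ,
      Fintype.card_fin, smul_eq_mul, mul_comm]
  let Φ := LinearEquiv.ofInjectiveOfFinrankEq (isotypicSum σ p) (isotypicSum_injective σ p) hfin
  have hΦ : ∀ x, Φ x = isotypicSum σ p x := fun x => rfl
  refine ⟨Φ.symm, fun A w j i => ?_⟩
  have h := isotypicSum_equivariant σ p A 1 (Φ.symm w)
  simp only [pow_one] at h
  rw [← hΦ, ← hΦ, LinearEquiv.apply_symm_apply, ← LinearEquiv.eq_symm_apply] at h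
  exact congrFun (congrFun h.symm j) i

end


/-! ### Rotations -/

/-- The rotation by `θ` about the third axis. -/
noncomputable def rotZ (θ : ℝ) : SO3 :=
  ⟨!![Real.cos θ, -Real.sin θ, 0; Real.sin θ, Real.cos θ, 0; 0, 0, 1], by
    have h := Real.cos_sq_add_sin_sq θ
    rw [Matrix.mem_specialOrthogonalGroup_iff, Matrix.mem_orthogonalGroup_iff]
    constructor
    · ext i k
      fin_cases i <;> fin_cases k <;> simp [Matrix.mul_apply, Fin.sum_univ_three] <;>
        first
        | ring1
        | linear_combination h
    · rw [Matrix.det_fin_three]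
      simp
      linear_combination h⟩

theorem exists_cos_sin {x y : ℝ} (h : x ^ 2 + y ^ 2 = 1) :
    ∃ θ : ℝ, x = Real.cos θ ∧ y = Real.sin θ := by
  have hn : ‖(⟨x, y⟩ : ℂ)‖ = 1 := by
    rw [Complex.norm_def, Complex.normSq_mk, Real.sqrt_eq_one]
    linear_combination h
  have h0 : (⟨x, y⟩ : ℂ) ≠ 0 := by
    rw [← norm_ne_zero_iff, hn]
    exact one_ne_zero
  exact ⟨Complex.arg ⟨x, y⟩, by rw [Complex.cos_arg h0, hn, div_one],
    by rw [Complex.sin_arg, hn, div_one]⟩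

theorem so3_mul_transpose (g : SO3) : g.1 * g.1.transpose = 1 :=
  (Matrix.mem_orthogonalGroup_iff _ _).1 (Matrix.mem_specialOrthogonalGroup_iff.1 g.2).1

theorem so3_det (g : SO3) : g.1.det = 1 := (Matrix.mem_specialOrthogonalGroup_iff.1 g.2).2

/-- A rotation fixing the third basis vector is a rotation about the third axis. -/
theorem exists_eq_rotZ (h : SO3) (h3 : h.1.mulVec ![0, 0, 1] = ![0, 0, 1]) : ∃ θ, h = rotZ θ := by
  have h02 : h.1 0 2 = 0 := by
    have := congrFun h3 0
    simpa [Matrix.mulVec, dotProduct, Fin.sum_univ_three] using this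
  have h12 : h.1 1 2 = 0 := by
    have := congrFun h3 1
    simpa [Matrix.mulVec, dotProduct, Fin.sum_univ_three] using this
  have h22 : h.1 2 2 = 1 := by
    have := congrFun h3 2
    simpa [Matrix.mulVec, dotProduct, Fin.sum_univ_three] using this
  have ho : ∀ i k, h.1 i 0 * h.1 k 0 + h.1 i 1 * h.1 k 1 + h.1 i 2 * h.1 k 2 =
      if i = k then 1 else 0 := by
    intro i k
    have := congrFun (congrFun (so3_mul_transpose h) i) k
    simpa [Matrix.mul_apply, Fin.sum_univ_three, Matrix.one_apply] using this
  have o22 := ho 2 2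
  have o00 := ho 0 0
  have o11 := ho 1 1
  have hd := so3_det h
  rw [Matrix.det_fin_three] at hd
  simp only [h02, h12, h22, if_true] at o22 o00 o11 hd
  have h20 : h.1 2 0 = 0 := by nlinarith [sq_nonneg (h.1 2 0), sq_nonneg (h.1 2 1)]
  have h21 : h.1 2 1 = 0 := by nlinarith [sq_nonneg (h.1 2 0), sq_nonneg (h.1 2 1)]
  -- an orthogonal `2 × 2` matrix of determinant `1` has the form `((c, -s), (s, c))`
  have hs : (h.1 0 0 - h.1 1 1) ^ 2 + (h.1 0 1 + h.1 1 0) ^ 2 = 0 := by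
    linear_combination o00 + o11 - 2 * hd
  have e1 : h.1 1 1 = h.1 0 0 := by
    nlinarith [sq_nonneg (h.1 0 0 - h.1 1 1), sq_nonneg (h.1 0 1 + h.1 1 0)]
  have e2 : h.1 0 1 = -h.1 1 0 := by
    nlinarith [sq_nonneg (h.1 0 0 - h.1 1 1), sq_nonneg (h.1 0 1 + h.1 1 0)]
  obtain ⟨θ, hc, hs⟩ := exists_cos_sin (x := h.1 0 0) (y := h.1 1 0) (by
    rw [e2] at o00
    linear_combination o00)
  refine ⟨θ, Subtype.ext ?_⟩
  ext i k
  fin_cases i <;> fin_cases k <;> simp [rotZ, h02, h12, h22, h20, h21, e1, e2, ← hc, ← hs]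

/-- A rotation carrying the third basis vector to `(a, b, c)`, when `(a, b) ≠ 0`. -/
theorem exists_rotation_mulVec {a b c : ℝ} (h1 : a ^ 2 + b ^ 2 + c ^ 2 = 1)
    (h0 : a ^ 2 + b ^ 2 ≠ 0) : ∃ k : SO3, k.1.mulVec ![0, 0, 1] = ![a, b, c] := by
  set r := Real.sqrt (a ^ 2 + b ^ 2) with hr
  have hr2 : r ^ 2 = a ^ 2 + b ^ 2 := Real.sq_sqrt (by positivity)
  have hr0 : r ≠ 0 := fun h => h0 (by rw [← hr2, h]; ring)
  refine ⟨⟨!![-b / r, -a * c / r, a; a / r, -b * c / r, b; 0, r, c], ?_⟩, ?_⟩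
  · rw [Matrix.mem_specialOrthogonalGroup_iff, Matrix.mem_orthogonalGroup_iff]
    have hc : c ^ 2 = 1 - r ^ 2 := by linear_combination h1 + hr2
    constructor
    · ext i k
      fin_cases i <;> fin_cases k <;> simp [Matrix.mul_apply, Fin.sum_univ_three] <;> field_simp
      all_goals first
        | ring1
        | linear_combination hc
        | linear_combination b * a * hc
        | linear_combination a ^ 2 * hc - hr2
        | linear_combination b ^ 2 * hc - hr2
    · rw [Matrix.det_fin_three]
      simp
      field_simp
      linear_combination (a ^ 2 + b ^ 2) * hc - hr2
  · ext i
    fin_cases i <;> simp [Matrix.mulVec, dotProduct, Fin.sum_univ_three]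

/-- Euler's theorem: every rotation of space is conjugate to a rotation about the third axis. -/
theorem exists_conj_rotZ (g : SO3) : ∃ (k : SO3) (θ : ℝ), g * k = k * rotZ θ := by
  -- `g - 1 = g (1 - g)ᵀ`, and the determinant of `1 - g` is that of `g - 1` with the opposite sign
  have hdet : (g.1 - 1).det = 0 := by
    have h : (g.1 - 1).det = -(g.1 - 1).det := by
      conv_lhs =>
        rw [show g.1 - 1 = g.1 * (-(g.1 - 1)).transpose by
          rw [Matrix.transpose_neg, Matrix.transpose_sub, neg_sub, mul_sub, so3_mul_transpose,
            Matrix.transpose_one, mul_one]]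
      rw [Matrix.det_mul, so3_det, one_mul, Matrix.det_transpose, Matrix.det_neg, Fintype.card_fin]
      ring
    linarith
  obtain ⟨v, hv0, hv⟩ := Matrix.exists_mulVec_eq_zero_iff.2 hdet
  rw [Matrix.sub_mulVec, Matrix.one_mulVec, sub_eq_zero] at hv
  -- a rotation taking the third axis to the axis of `g`
  obtain ⟨k, c, hc0, hk⟩ : ∃ (k : SO3) (c : ℝ), c ≠ 0 ∧ k.1.mulVec ![0, 0, 1] = c • v := by
    set n := v 0 ^ 2 + v 1 ^ 2 + v 2 ^ 2 with hn
    have hn0 : 0 < n := by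
      by_contra hle
      apply hv0
      ext i
      fin_cases i <;> simp <;> nlinarith [sq_nonneg (v 0), sq_nonneg (v 1), sq_nonneg (v 2)]
    by_cases h01 : v 0 ^ 2 + v 1 ^ 2 = 0
    · have e0 : v 0 = 0 := by nlinarith [sq_nonneg (v 0), sq_nonneg (v 1)]
      have e1 : v 1 = 0 := by nlinarith [sq_nonneg (v 0), sq_nonneg (v 1)]
      have e2 : v 2 ≠ 0 := by
        intro e2
        rw [hn, e0, e1, e2] at hn0
        norm_num at hn0
      refine ⟨1, (v 2)⁻¹, inv_ne_zero e2, ?_⟩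
      ext i
      fin_cases i <;> simp [e0, e1, e2]
    · set s := Real.sqrt n with hs
      have hs2 : s ^ 2 = n := Real.sq_sqrt hn0.le
      have hs0 : s ≠ 0 := (Real.sqrt_pos.2 hn0).ne'
      obtain ⟨k, hk⟩ := exists_rotation_mulVec (a := s⁻¹ * v 0) (b := s⁻¹ * v 1) (c := s⁻¹ * v 2)
        (by
          field_simp
          rw [hs2])
        (by
          rw [mul_pow, mul_pow, ← mul_add]
          exact mul_ne_zero (pow_ne_zero _ (inv_ne_zero hs0)) h01)
      refine ⟨k, s⁻¹, inv_ne_zero hs0, ?_⟩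
      rw [hk]
      ext i
      fin_cases i <;> simp
  have hfix : (k⁻¹ * g * k).1.mulVec ![0, 0, 1] = ![0, 0, 1] := by
    have e1 : (k⁻¹ * g * k).1 = (k⁻¹).1 * g.1 * k.1 := rfl
    have e2 : (k⁻¹).1 * k.1 = 1 := congrArg Subtype.val (inv_mul_cancel k)
    rw [e1, ← Matrix.mulVec_mulVec, ← Matrix.mulVec_mulVec, hk, Matrix.mulVec_smul, hv, ← hk,
      Matrix.mulVec_mulVec, e2, Matrix.one_mulVec]
  obtain ⟨θ, hθ⟩ := exists_eq_rotZ _ hfix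
  exact ⟨k, θ, by rw [← hθ, mul_assoc, mul_inv_cancel_left]⟩


/-! ### Equivariance under `SO(3)` and under `so(3)` -/

/-- A map intertwining two operators intertwines their polynomials. -/
theorem comp_aeval {V W : Type*} [AddCommGroup V] [Module ℂ V] [AddCommGroup W] [Module ℂ W]
    {A : Module.End ℂ V} {B : Module.End ℂ W} {T : V →ₗ[ℂ] W} (h : T ∘ₗ A = B ∘ₗ T)
    (q : Polynomial ℂ) : T ∘ₗ Polynomial.aeval A q = Polynomial.aeval B q ∘ₗ T := by
  have hp : ∀ n v, T ((A ^ n) v) = (B ^ n) (T v) := by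
    intro n v
    induction n with
    | zero => simp
    | succ n ih =>
      have h2 : ∀ u, T (A u) = B (T u) := LinearMap.congr_fun h
      rw [pow_succ', Module.End.mul_apply, h2, ih, pow_succ', Module.End.mul_apply]
  induction q using Polynomial.induction_on' with
  | add p q hp hq => rw [map_add, map_add, LinearMap.comp_add, LinearMap.add_comp, hp, hq]
  | monomial n c =>
    ext v
    simp [Polynomial.aeval_monomial, hp, Module.algebraMap_end_apply]

/-- An operator that is diagonal in an eigenbasis of `A` is a polynomial in `A` as soon as the
polynomial interpolates the eigenvalues. -/
theorem aeval_eq_of_eigenbasis {V ι : Type*} [AddCommGroup V] [Module ℂ V]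
    (b : Module.Basis ι ℂ V) {A B : Module.End ℂ V} {μ ν : ι → ℂ} (hA : ∀ i, A (b i) = μ i • b i)
    (hB : ∀ i, B (b i) = ν i • b i) {q : Polynomial ℂ} (hq : ∀ i, q.eval (μ i) = ν i) :
    Polynomial.aeval A q = B :=
  b.ext fun i => by
    rw [hB, ← hq, Module.End.aeval_apply_of_hasEigenvector
      ⟨Module.End.mem_eigenspace_iff.2 (hA i), b.ne_zero i⟩]

/-- A rotation as an invertible complex matrix. -/
noncomputable def so3GL : SO3 →* GL (Fin 3) ℂ := so3Incl.toHomUnits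

theorem coe_so3GL (g : SO3) : (so3GL g : Matrix (Fin 3) (Fin 3) ℂ) = so3Incl g := rfl

theorem so3ToGL_eq (N : ℕ) (g : SO3) : so3ToGL N g = blockGL N (so3GL g) :=
  Units.ext rfl

/-- The angular momentum along the axis that the rotation `k` makes of the third axis. -/
noncomputable def spinAxis (k : SO3) : so3 :=
  ⟨so3Incl k * spinH.1 * (so3Incl k).transpose, by
    rw [LieAlgebra.Orthogonal.mem_so, Matrix.transpose_mul, Matrix.transpose_mul,
      Matrix.transpose_transpose, (LieAlgebra.Orthogonal.mem_so _ _ _).1 spinH.2, Matrix.neg_mul,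
      Matrix.mul_neg, mul_assoc]⟩

theorem spinAxis_mul (k : SO3) :
    (spinAxis k).1 * so3Incl k = so3Incl k * spinH.1 := by
  change so3Incl k * spinH.1 * (so3Incl k).transpose * so3Incl k = _
  rw [mul_assoc, mul_eq_one_comm.1 (so3Incl_mul_transpose k), mul_one]

/-- The rotation by `θ` about the third axis is `exp (-i θ H)`. -/
theorem rotZ_mul_spinBasis (θ : ℝ) :
    (spinBasis : Matrix (Fin 3) (Fin 3) ℂ) *
      Matrix.diagonal (fun i => Complex.exp (-Complex.I * θ * spinWt i)) =
      so3Incl (rotZ θ) * spinBasis := by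
  have h1 : Complex.exp (-(Complex.I * θ)) = Complex.cos θ - Complex.sin θ * Complex.I := by
    rw [show -(Complex.I * (θ : ℂ)) = -(θ : ℂ) * Complex.I by ring, Complex.exp_mul_I,
      Complex.cos_neg, Complex.sin_neg]
    ring
  have h2 : Complex.exp (Complex.I * θ) = Complex.cos θ + Complex.sin θ * Complex.I := by
    rw [mul_comm, Complex.exp_mul_I]
  have hI := Complex.I_mul_I
  rw [coe_spinBasis]
  ext i k
  fin_cases i <;> fin_cases k <;>
    simp [so3Incl, rotZ, spinWt, Matrix.mul_apply, Fin.sum_univ_three, Matrix.diagonal, h1, h2,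
      -Complex.I_mul_I] <;>
    first
    | ring1
    | linear_combination (-Complex.sin θ) * hI

section

variable {n p : ℕ} (g : GL (Fin n) ℂ) (w : Fin n → ℤ)

/-- If `A` has the weights `w` and `B = exp (-i θ A)`, the action of `B` on `Sym^p(ℂⁿ)` is a
polynomial in the action of `A`. -/
theorem aeval_symLie {A : Matrix (Fin n) (Fin n) ℂ} {B : GL (Fin n) ℂ} {θ : ℝ}
    (hA : (g : Matrix (Fin n) (Fin n) ℂ) * Matrix.diagonal (fun i => (w i : ℂ)) = A * g)
    (hB : (g : Matrix (Fin n) (Fin n) ℂ) *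
      Matrix.diagonal (fun i => Complex.exp (-Complex.I * θ * w i)) = B * g)
    {q : Polynomial ℂ}
    (hq : ∀ d : Expo n p, q.eval (wtOf w d.1 : ℂ) = Complex.exp (-Complex.I * θ * wtOf w d.1)) :
    Polynomial.aeval (symLie n p A) q = symRep n p B := by
  refine aeval_eq_of_eigenbasis (twistBasis g p) (fun d => symLie_twistBasis g hA d)
    (fun d => symRep_twistBasis g B hB d) fun d => ?_
  have h := hq d
  rw [wtOf] at h
  push_cast at h
  rw [h, Finset.mul_sum, Complex.exp_sum]
  exact Finset.prod_congr rfl fun i _ => by rw [← Complex.exp_nat_mul]; congr 1; ring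

/-- If `A` has the weights `w` and `B = exp (-i θ A)`, and the action of `B` separates the weights,
the action of `A` on `Sym^p(ℂⁿ)` is a polynomial in the action of `B`. -/
theorem aeval_symRep {A : Matrix (Fin n) (Fin n) ℂ} {B : GL (Fin n) ℂ} {θ : ℝ}
    (hA : (g : Matrix (Fin n) (Fin n) ℂ) * Matrix.diagonal (fun i => (w i : ℂ)) = A * g)
    (hB : (g : Matrix (Fin n) (Fin n) ℂ) *
      Matrix.diagonal (fun i => Complex.exp (-Complex.I * θ * w i)) = B * g)
    {q : Polynomial ℂ}
    (hq : ∀ d : Expo n p, q.eval (Complex.exp (-Complex.I * θ * wtOf w d.1)) = wtOf w d.1) :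
    Polynomial.aeval (symRep n p B) q = symLie n p A := by
  refine aeval_eq_of_eigenbasis (twistBasis g p) (fun d => symRep_twistBasis g B hB d)
    (fun d => symLie_twistBasis g hA d) fun d => ?_
  have h := hq d
  rw [wtOf] at h
  push_cast at h
  rw [← h, Finset.mul_sum, Complex.exp_sum]
  congr 1
  exact Finset.prod_congr rfl fun i _ => by rw [← Complex.exp_nat_mul]; congr 1; ring

end

/-- The rotation by `θ` about the axis that `k` makes of the third axis. -/
noncomputable def rotAxis (k : SO3) (θ : ℝ) : SO3 := k * rotZ θ * k⁻¹

theorem spinAxis_diagonal (k : SO3) :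
    ((so3GL k * spinBasis : GL (Fin 3) ℂ) : Matrix (Fin 3) (Fin 3) ℂ) *
      Matrix.diagonal (fun i => (spinWt i : ℂ)) =
      (spinAxis k).1 * (so3GL k * spinBasis : GL (Fin 3) ℂ) := by
  rw [Units.val_mul, mul_assoc, spinBasis_mul_diagonal, coe_so3GL, ← mul_assoc, ← mul_assoc,
    spinAxis_mul]

theorem rotAxis_diagonal (k : SO3) (θ : ℝ) :
    ((so3GL k * spinBasis : GL (Fin 3) ℂ) : Matrix (Fin 3) (Fin 3) ℂ) *
      Matrix.diagonal (fun i => Complex.exp (-Complex.I * θ * spinWt i)) =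
      so3GL (rotAxis k θ) * (so3GL k * spinBasis : GL (Fin 3) ℂ) := by
  rw [Units.val_mul, mul_assoc, rotZ_mul_spinBasis, coe_so3GL, coe_so3GL, ← mul_assoc, ← mul_assoc,
    ← map_mul, ← map_mul, rotAxis, inv_mul_cancel_right]

theorem blockEmb_eq_of_diagonal (N : ℕ) {g : GL (Fin 3) ℂ} {A : Matrix (Fin 3) (Fin 3) ℂ}
    {t : Fin 3 → ℂ} (h : (g : Matrix (Fin 3) (Fin 3) ℂ) * Matrix.diagonal t = A * g) :
    (blockGL N g : Matrix (Fin (N * 3)) (Fin (N * 3)) ℂ) *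
      Matrix.diagonal (fun i => t (finProdFinEquiv.symm i).2) =
      blockEmb N A * (blockGL N g : Matrix (Fin (N * 3)) (Fin (N * 3)) ℂ) := by
  rw [← blockEmb_diagonal, coe_blockGL, ← map_mul, h, map_mul]

/-- The inclusion of the harmonic polynomials into all homogeneous ones. -/
noncomputable def harmIncl (j : ℕ) : harmonics j →ₗ[ℂ] SymPow 3 j :=
  Submodule.inclusion inf_le_left

theorem harmIncl_injective (j : ℕ) : Function.Injective (harmIncl j) :=
  Submodule.inclusion_injective _

theorem harmIncl_spinLie (j : ℕ) (A : so3) :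
    harmIncl j ∘ₗ spinLie j A = symLie 3 j A.1 ∘ₗ harmIncl j := rfl

theorem harmIncl_spinRep (j : ℕ) (g : SO3) :
    harmIncl j ∘ₗ spinRep j g = symRep 3 j (so3GL g) ∘ₗ harmIncl j := rfl

/-- Polynomial relations between operators on the homogeneous polynomials restrict to the harmonic
ones. -/
theorem aeval_harmonics {j : ℕ} {A B : Module.End ℂ (harmonics j)}
    {A' B' : Module.End ℂ (SymPow 3 j)} (hA : harmIncl j ∘ₗ A = A' ∘ₗ harmIncl j)
    (hB : harmIncl j ∘ₗ B = B' ∘ₗ harmIncl j) {q : Polynomial ℂ}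
    (h : Polynomial.aeval A' q = B') : Polynomial.aeval A q = B := by
  ext1 v
  apply harmIncl_injective j
  have h1 := LinearMap.congr_fun (comp_aeval hA q) v
  have h2 := LinearMap.congr_fun hB v
  rw [h] at h1
  exact h1.trans h2.symm

/-- The rotation by one radian separates the integral weights, because `π` is irrational. -/
theorem exp_neg_I_mul_injective :
    Function.Injective fun m : ℤ => Complex.exp (-Complex.I * (1 : ℝ) * m) := by
  intro a b h
  obtain ⟨n, hn⟩ := Complex.exp_eq_exp_iff_exists_int.1 h
  have h1 : ((b - a : ℤ) : ℝ) = 2 * n * Real.pi := by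
    have h2 : ((b - a : ℤ) : ℂ) = ((2 * n * Real.pi : ℝ) : ℂ) := by
      have h3 : Complex.I * ((b - a : ℤ) : ℂ) = Complex.I * ((2 * n * Real.pi : ℝ) : ℂ) := by
        push_cast at hn ⊢
        linear_combination hn
      exact mul_left_cancel₀ Complex.I_ne_zero h3
    exact_mod_cast h2
  by_cases hn0 : n = 0
  · rw [hn0] at h1
    have h2 : ((b - a : ℤ) : ℝ) = 0 := by rw [h1]; simp
    have h3 : b - a = 0 := by exact_mod_cast h2
    omega
  · exfalso
    refine irrational_pi ⟨(b - a : ℤ) / (2 * n : ℤ), ?_⟩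
    have : (n : ℝ) ≠ 0 := Int.cast_ne_zero.2 hn0
    push_cast at h1 ⊢
    rw [h1]
    field_simp

/-- The finitely many weights occurring in the spin `j` representation and in `V^{p}`. -/
noncomputable def weightSet (N p j : ℕ) : Finset ℤ :=
  (Finset.univ.image fun d : Expo 3 j => wtOf spinWt d.1) ∪
    Finset.univ.image fun d : Expo (N * 3) p => expoWt d

theorem exists_interpolate {S : Finset ℤ} (u v : ℤ → ℂ) (hu : Function.Injective u) :
    ∃ q : Polynomial ℂ, ∀ m ∈ S, q.eval (u m) = v m :=
  ⟨Lagrange.interpolate S u v, fun _ hm => Lagrange.eval_interpolate_at_node _ hu.injOn hm⟩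

theorem symSo3_apply (N p : ℕ) (A : so3) :
    symSo3 N p A = symLie (N * 3) p (blockEmb N A.1) := rfl

theorem blockGL_spinAxis_diagonal (N : ℕ) (k : SO3) :
    (blockGL N (so3GL k * spinBasis) : Matrix (Fin (N * 3)) (Fin (N * 3)) ℂ) *
      Matrix.diagonal (fun i => (spinWt (finProdFinEquiv.symm i).2 : ℂ)) =
      blockEmb N (spinAxis k).1 *
        (blockGL N (so3GL k * spinBasis) : Matrix (Fin (N * 3)) (Fin (N * 3)) ℂ) :=
  blockEmb_eq_of_diagonal N (g := so3GL k * spinBasis) (A := (spinAxis k).1)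
    (t := fun i => (spinWt i : ℂ)) (spinAxis_diagonal k)

theorem blockGL_rotAxis_diagonal (N : ℕ) (k : SO3) (θ : ℝ) :
    (blockGL N (so3GL k * spinBasis) : Matrix (Fin (N * 3)) (Fin (N * 3)) ℂ) *
      Matrix.diagonal (fun i =>
        Complex.exp (-Complex.I * θ * (spinWt (finProdFinEquiv.symm i).2 : ℤ))) =
      (blockGL N (so3GL (rotAxis k θ)) : Matrix (Fin (N * 3)) (Fin (N * 3)) ℂ) *
        (blockGL N (so3GL k * spinBasis) : Matrix (Fin (N * 3)) (Fin (N * 3)) ℂ) :=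
  blockEmb_eq_of_diagonal N (rotAxis_diagonal k θ)

theorem comm_rotAxis_of_comm_spinAxis {N p j : ℕ} {T : harmonics j →ₗ[ℂ] SymPow (N * 3) p} (k : SO3)
    (θ : ℝ) (h : T ∘ₗ spinLie j (spinAxis k) = symSo3 N p (spinAxis k) ∘ₗ T) :
    T ∘ₗ spinRep j (rotAxis k θ) = symRep (N * 3) p (so3ToGL N (rotAxis k θ)) ∘ₗ T := by
  obtain ⟨q, hq⟩ := exists_interpolate (S := weightSet N p j) (fun m => (m : ℂ))
    (fun m => Complex.exp (-Complex.I * θ * m)) Int.cast_injective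
  have h1 : Polynomial.aeval (spinLie j (spinAxis k)) q = spinRep j (rotAxis k θ) :=
    aeval_harmonics (harmIncl_spinLie j _) (harmIncl_spinRep j _)
      (aeval_symLie _ spinWt (spinAxis_diagonal k) (rotAxis_diagonal k θ)
        fun d => hq _ (Finset.mem_union_left _ (Finset.mem_image_of_mem _ (Finset.mem_univ d))))
  have h2 : Polynomial.aeval (symSo3 N p (spinAxis k)) q =
      symRep (N * 3) p (so3ToGL N (rotAxis k θ)) := by
    rw [so3ToGL_eq, symSo3_apply]
    exact aeval_symLie _ (fun i => spinWt (finProdFinEquiv.symm i).2)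
        (blockGL_spinAxis_diagonal N k) (blockGL_rotAxis_diagonal N k θ)
        fun d => hq _ (Finset.mem_union_right _ (Finset.mem_image_of_mem _ (Finset.mem_univ d)))
  rw [← h1, ← h2]
  exact comp_aeval h q

theorem comm_spinAxis_of_comm_rotAxis {N p j : ℕ} {T : harmonics j →ₗ[ℂ] SymPow (N * 3) p} (k : SO3)
    (h : T ∘ₗ spinRep j (rotAxis k 1) = symRep (N * 3) p (so3ToGL N (rotAxis k 1)) ∘ₗ T) :
    T ∘ₗ spinLie j (spinAxis k) = symSo3 N p (spinAxis k) ∘ₗ T := by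
  obtain ⟨q, hq⟩ := exists_interpolate (S := weightSet N p j) _
    (fun m => (m : ℂ)) exp_neg_I_mul_injective
  have h1 : Polynomial.aeval (spinRep j (rotAxis k 1)) q = spinLie j (spinAxis k) :=
    aeval_harmonics (harmIncl_spinRep j _) (harmIncl_spinLie j _)
      (aeval_symRep _ spinWt (spinAxis_diagonal k) (rotAxis_diagonal k 1)
        fun d => hq _ (Finset.mem_union_left _ (Finset.mem_image_of_mem _ (Finset.mem_univ d))))
  have h2 : Polynomial.aeval (symRep (N * 3) p (so3ToGL N (rotAxis k 1))) q =
      symSo3 N p (spinAxis k) := by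
    rw [so3ToGL_eq, symSo3_apply]
    exact aeval_symRep _ (fun i => spinWt (finProdFinEquiv.symm i).2)
        (blockGL_spinAxis_diagonal N k) (blockGL_rotAxis_diagonal N k 1)
        fun d => hq _ (Finset.mem_union_right _ (Finset.mem_image_of_mem _ (Finset.mem_univ d)))
  rw [← h1, ← h2]
  exact comp_aeval h q

/-- The cyclic permutation of the three axes. -/
def cyclicRot : SO3 :=
  ⟨!![0, 0, 1; 1, 0, 0; 0, 1, 0], by
    rw [Matrix.mem_specialOrthogonalGroup_iff, Matrix.mem_orthogonalGroup_iff]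
    constructor
    · ext i k
      fin_cases i <;> fin_cases k <;> simp [Matrix.mul_apply, Fin.sum_univ_three]
    · rw [Matrix.det_fin_three]
      simp⟩

theorem spinE_eq : spinE =
    spinAxis cyclicRot + Complex.I • spinAxis (cyclicRot * cyclicRot) := by
  apply Subtype.ext
  ext i k
  fin_cases i <;> fin_cases k <;>
    simp [spinE, spinAxis, spinH, so3Incl, cyclicRot, Matrix.mul_apply, Fin.sum_univ_three]

theorem spinF_eq : spinF =
    spinAxis cyclicRot - Complex.I • spinAxis (cyclicRot * cyclicRot) := by
  apply Subtype.ext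
  ext i k
  fin_cases i <;> fin_cases k <;>
    simp [spinF, spinAxis, spinH, so3Incl, cyclicRot, Matrix.mul_apply, Fin.sum_univ_three]

theorem spinH_eq : spinH = spinAxis 1 := by
  apply Subtype.ext
  simp [spinAxis]

/-- A linear map is equivariant under `SO(3)` if and only if it is equivariant under `so(3)`:
every rotation about an axis is a polynomial in the angular momentum along that axis, and the
latter is a polynomial in the rotation by one radian. -/
theorem comm_group_iff_comm_lie {N p j : ℕ} {T : harmonics j →ₗ[ℂ] SymPow (N * 3) p} :
    (∀ g, T ∘ₗ spinRep j g = symRep (N * 3) p (so3ToGL N g) ∘ₗ T) ↔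
      T ∈ lieIntertwiners j (symSo3 N p) := by
  constructor
  · intro h
    have hk : ∀ k v, T (spinLie j (spinAxis k) v) = symSo3 N p (spinAxis k) (T v) := fun k v =>
      LinearMap.congr_fun (comm_spinAxis_of_comm_rotAxis k (h _)) v
    rw [mem_lieIntertwiners_iff]
    refine fun A v => equivariant_of_spin ?_ ?_ ?_ A
    · rw [spinH_eq, hk]
    · simp only [spinE_eq, map_add, map_smul, LinearMap.add_apply, LinearMap.smul_apply, hk]
    · simp only [spinF_eq, map_sub, map_smul, LinearMap.sub_apply, LinearMap.smul_apply, hk]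
  · intro h g
    obtain ⟨k, θ, hg⟩ := exists_conj_rotZ g
    have e : g = rotAxis k θ := by rw [rotAxis, ← hg, mul_inv_cancel_right]
    rw [e]
    exact comm_rotAxis_of_comm_spinAxis k θ (h _)

theorem lieMult_eq_mult (p j N : ℕ) : lieMult j (symSo3 N p) = mult p j N := by
  let φ : lieIntertwiners j (symSo3 N p) →ₗ[ℂ]
      Representation.IntertwiningMap (spinRep j) ((symRep (N * 3) p).comp (so3ToGL N)) :=
    { toFun := fun T => ⟨T.1, comm_group_iff_comm_lie.2 T.2⟩
      map_add' := fun S T => rfl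
      map_smul' := fun c T => rfl }
  refine (LinearEquiv.ofBijective φ ⟨?_, ?_⟩).finrank_eq
  · intro S T h
    exact Subtype.ext (congrArg Representation.IntertwiningMap.toLinearMap h)
  · intro T
    exact ⟨⟨T.toLinearMap, comm_group_iff_comm_lie.1 T.isIntertwining'⟩, rfl⟩


/-! ### Characters -/

/-- The dimension of the weight `m` space of `Sym^p(ℂ^{3N})`. -/
noncomputable def wtMult (p : ℕ) (m : ℤ) (N : ℕ) : ℕ :=
  (Finset.univ.filter fun d : Expo (N * 3) p => expoWt d = m).card

/-- The multiplicity of spin `j` is the dimension of the weight `j` space minus that of the weight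
`j + 1` space. -/
theorem mult_add_wtMult (p j N : ℕ) : mult p j N + wtMult p (j + 1) N = wtMult p j N := by
  rw [← lieMult_eq_mult]
  exact lieMult_add_card (symSo3 N p) (wtBasis N p) expoWt symSo3_spinH_wtBasis j

/-- The permutation of the variables exchanging the weights `1` and `-1`. -/
def flipVar (N : ℕ) : Equiv.Perm (Fin (N * 3)) :=
  (finProdFinEquiv.symm.trans ((Equiv.refl _).prodCongr (Equiv.swap 0 1))).trans finProdFinEquiv

theorem spinWt_flipVar {N : ℕ} (i : Fin (N * 3)) :
    spinWt (finProdFinEquiv.symm (flipVar N i)).2 = -spinWt (finProdFinEquiv.symm i).2 := by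
  have h : ∀ k : Fin 3, spinWt (Equiv.swap 0 1 k) = -spinWt k := by decide
  simp only [flipVar, Equiv.trans_apply, Equiv.symm_apply_apply]
  exact h _

/-- Exchange of the variables of weights `1` and `-1` in a monomial. -/
noncomputable def flipExpo (N p : ℕ) : Expo (N * 3) p ≃ Expo (N * 3) p :=
  (Finsupp.domCongr (flipVar N)).toEquiv.subtypeEquiv fun d => by
    have h : ((Finsupp.domCongr (flipVar N)).toEquiv d).degree = d.degree := by
      rw [Finsupp.degree_eq_sum, Finsupp.degree_eq_sum]
      exact Equiv.sum_comp (flipVar N).symm d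
    rw [h]

theorem expoWt_flipExpo {N p : ℕ} (d : Expo (N * 3) p) : expoWt (flipExpo N p d) = -expoWt d := by
  have h : ∀ i, (flipExpo N p d).1 i = d.1 ((flipVar N).symm i) := fun i => rfl
  rw [expoWt, expoWt, wtOf, wtOf, ← Equiv.sum_comp (flipVar N), ← Finset.sum_neg_distrib]
  refine Finset.sum_congr rfl fun i _ => ?_
  rw [h, Equiv.symm_apply_apply, spinWt_flipVar, mul_neg]

theorem wtMult_neg (p : ℕ) (m : ℤ) (N : ℕ) : wtMult p (-m) N = wtMult p m N := by
  refine Finset.card_equiv (flipExpo N p) fun d => ?_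
  rw [Finset.mem_filter_univ, Finset.mem_filter_univ, expoWt_flipExpo, neg_eq_iff_eq_neg]

theorem natAbs_expoWt_le {N p : ℕ} (d : Expo (N * 3) p) : (expoWt d).natAbs ≤ p := by
  have h1 : ∀ k : Fin 3, |spinWt k| ≤ 1 := by decide
  have h2 : |expoWt d| ≤ p := by
    rw [expoWt, wtOf]
    calc _ ≤ ∑ i, |(d.1 i : ℤ) * spinWt (finProdFinEquiv.symm i).2| :=
          Finset.abs_sum_le_sum_abs _ _
      _ ≤ ∑ i, (d.1 i : ℤ) := Finset.sum_le_sum fun i _ => by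
          rw [abs_mul, Nat.abs_cast]
          exact mul_le_of_le_one_right (by positivity) (h1 _)
      _ = p := by
          rw [← Nat.cast_sum, ← Finsupp.degree_eq_sum, d.2]
  rw [Int.abs_eq_natAbs] at h2
  exact_mod_cast h2

open scoped LaurentPolynomial PowerSeries

/-- The formal character `∑ T^m` of the weights `m` of `Sym^p(ℂ^{3N})`, summed over `p`. -/
noncomputable def charSeries (N : ℕ) : ℚ[T;T⁻¹]⟦X⟧ :=
  PowerSeries.mk fun p => ∑ d : Expo (N * 3) p, LaurentPolynomial.T (expoWt d)

/-- The geometric series of ratio `T^w X`. -/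
noncomputable def geomSeries (w : ℤ) : ℚ[T;T⁻¹]⟦X⟧ :=
  PowerSeries.mk fun k => LaurentPolynomial.T (k * w)

theorem geomSeries_mul (w : ℤ) :
    geomSeries w * (1 - PowerSeries.C (LaurentPolynomial.T w) * PowerSeries.X) = 1 := by
  ext1 n
  rw [mul_sub, mul_one, ← mul_assoc, map_sub]
  rcases n with _ | n
  · rw [PowerSeries.coeff_zero_mul_X]
    simp [geomSeries]
  · rw [PowerSeries.coeff_succ_mul_X, PowerSeries.coeff_mul_C]
    rw [geomSeries, PowerSeries.coeff_mk, PowerSeries.coeff_mk, ← LaurentPolynomial.T_add,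
      PowerSeries.coeff_one, if_neg n.succ_ne_zero, Nat.cast_succ, add_one_mul, sub_self]

theorem T_sum {ι : Type*} (s : Finset ι) (f : ι → ℤ) :
    (LaurentPolynomial.T (∑ i ∈ s, f i) : ℚ[T;T⁻¹]) = ∏ i ∈ s, LaurentPolynomial.T (f i) := by
  classical
  induction s using Finset.induction_on with
  | empty => simp
  | insert a s ha ih => rw [Finset.sum_insert ha, Finset.prod_insert ha, LaurentPolynomial.T_add, ih]

/-- Each variable of weight `w` contributes the factor `1 / (1 - T^w X)`. -/
theorem charSeries_eq_prod (N : ℕ) : charSeries N = (∏ k : Fin 3, geomSeries (spinWt k)) ^ N := by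
  have h1 : charSeries N = ∏ i : Fin (N * 3), geomSeries (spinWt (finProdFinEquiv.symm i).2) := by
    ext1 p
    rw [PowerSeries.coeff_prod, charSeries, PowerSeries.coeff_mk,
      Finset.sum_subtype (p := fun d : Fin (N * 3) →₀ ℕ => d.degree = p) _ (fun d => ?_)]
    · refine Finset.sum_congr rfl fun d _ => ?_
      rw [expoWt, wtOf, T_sum]
      exact Finset.prod_congr rfl fun i _ => by rw [geomSeries, PowerSeries.coeff_mk]
    · simp [Finset.mem_finsuppAntidiag, Finsupp.degree_eq_sum]
  rw [h1, Equiv.prod_comp finProdFinEquiv.symm (fun x : Fin N × Fin 3 => geomSeries (spinWt x.2)),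
    Fintype.prod_prod_type]
  simp

/-- The denominator `(1 - X) (1 - T X) (1 - T⁻¹ X)` of the character of one block. -/
noncomputable def charDenom : ℚ[T;T⁻¹]⟦X⟧ :=
  (1 - PowerSeries.X) * (1 - PowerSeries.C (LaurentPolynomial.T 1) * PowerSeries.X) *
    (1 - PowerSeries.C (LaurentPolynomial.T (-1)) * PowerSeries.X)

theorem charDenom_mul_charSeries_succ (N : ℕ) : charDenom * charSeries (N + 1) = charSeries N := by
  have h1 := geomSeries_mul 1
  have h2 := geomSeries_mul (-1)
  have h3 := geomSeries_mul 0
  rw [LaurentPolynomial.T_zero, map_one, one_mul] at h3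
  have h : charDenom * (geomSeries 1 * geomSeries (-1) * geomSeries 0) = 1 := by
    rw [charDenom]
    linear_combination geomSeries (-1) *
      (1 - PowerSeries.C (LaurentPolynomial.T (-1)) * PowerSeries.X) * geomSeries 0 *
        (1 - PowerSeries.X) * h1 + geomSeries 0 * (1 - PowerSeries.X) * h2 + h3
  rw [charSeries_eq_prod, charSeries_eq_prod, Fin.prod_univ_three, pow_succ']
  change charDenom * (geomSeries 1 * geomSeries (-1) * geomSeries 0 * _) = _
  rw [← mul_assoc, h, one_mul]

/-- The series `(1 - T⁻¹) ∑ T^m`, whose coefficients at `T^j`, `j ≥ 0`, are the multiplicities. -/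
noncomputable def diffSeries (N : ℕ) : ℚ[T;T⁻¹]⟦X⟧ :=
  PowerSeries.C (1 - LaurentPolynomial.T (-1)) * charSeries N

theorem charDenom_mul_diffSeries_succ (N : ℕ) : charDenom * diffSeries (N + 1) = diffSeries N := by
  rw [diffSeries, diffSeries, ← charDenom_mul_charSeries_succ N]
  ring

theorem coeff_T_mul (n m : ℤ) (f : ℚ[T;T⁻¹]) :
    (LaurentPolynomial.T n * f).coeff m = f.coeff (m - n) := by
  rw [LaurentPolynomial.T,
    AddMonoidAlgebra.coeff_single_mul_eq_mul_coeff (m - n) (fun a _ => by omega), one_mul]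

theorem coeff_charSeries (N p : ℕ) (m : ℤ) :
    (PowerSeries.coeff p (charSeries N)).coeff m = wtMult p m N := by
  rw [charSeries, PowerSeries.coeff_mk, AddMonoidAlgebra.coeff_sum, Finsupp.finsetSum_apply, wtMult,
    Finset.card_filter, Nat.cast_sum]
  exact Finset.sum_congr rfl fun d _ => by simp

theorem coeff_diffSeries (N p : ℕ) (m : ℤ) :
    (PowerSeries.coeff p (diffSeries N)).coeff m = wtMult p m N - wtMult p (m + 1) N := by
  rw [diffSeries, PowerSeries.coeff_C_mul, sub_mul, one_mul, AddMonoidAlgebra.coeff_sub,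
    Finsupp.sub_apply, coeff_T_mul, coeff_charSeries, coeff_charSeries, sub_neg_eq_add]

theorem coeff_diffSeries_natCast (N p j : ℕ) :
    (PowerSeries.coeff p (diffSeries N)).coeff j = mult p j N := by
  rw [coeff_diffSeries, sub_eq_iff_eq_add, ← Nat.cast_add, mult_add_wtMult]

/-- The weights `1` and `-1` have the same dimension. -/
theorem coeff_diffSeries_neg_one (N p : ℕ) :
    (PowerSeries.coeff p (diffSeries N)).coeff (-1) =
      -(PowerSeries.coeff p (diffSeries N)).coeff 0 := by
  rw [coeff_diffSeries, coeff_diffSeries, wtMult_neg, neg_add_cancel, zero_add]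
  ring

/-! ### The functional equation of the generating functions -/

section

variable {σ : Type*}

theorem coeff_X_mul_eq (s : σ) (f : MvPowerSeries σ ℚ) (m : σ →₀ ℕ) :
    MvPowerSeries.coeff m (MvPowerSeries.X s * f) =
      if m s = 0 then 0 else MvPowerSeries.coeff (m - Finsupp.single s 1) f := by
  have h : Finsupp.single s 1 ≤ m ↔ m s ≠ 0 := by
    rw [Finsupp.single_le_iff, Nat.one_le_iff_ne_zero]
  rw [MvPowerSeries.X, MvPowerSeries.coeff_monomial_mul]
  by_cases h0 : m s = 0
  · rw [if_neg (fun hle => h.1 hle h0), if_pos h0]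
  · rw [if_pos (h.2 h0), if_neg h0, one_mul]

/-- The part of a power series that does not involve `X_t`. -/
noncomputable def freePart (t : σ) (f : MvPowerSeries σ ℚ) : MvPowerSeries σ ℚ :=
  fun m => if m t = 0 then MvPowerSeries.coeff m f else 0

theorem coeff_freePart (t : σ) (f : MvPowerSeries σ ℚ) (m : σ →₀ ℕ) :
    MvPowerSeries.coeff m (freePart t f) = if m t = 0 then MvPowerSeries.coeff m f else 0 := rfl

/-- The substitution `X_t ↦ 0` in power series. -/
noncomputable def killVar (t : σ) : MvPowerSeries σ ℚ →+* MvPowerSeries σ ℚ where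
  toFun := freePart t
  map_one' := by
    classical
    ext m
    rw [coeff_freePart, MvPowerSeries.coeff_one]
    split_ifs with h1 h2 h2
    · rfl
    · rfl
    · exact absurd (by rw [h2]; rfl) h1
    · rfl
  map_mul' f g := by
    classical
    ext m
    rw [coeff_freePart, MvPowerSeries.coeff_mul, MvPowerSeries.coeff_mul]
    simp only [coeff_freePart]
    split_ifs with h
    · refine Finset.sum_congr rfl fun x hx => ?_
      have hx' : x.1 t + x.2 t = m t := by
        rw [← Finsupp.add_apply, Finset.HasAntidiagonal.mem_antidiagonal.1 hx]
      rw [if_pos (by omega), if_pos (by omega)]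
    · refine (Finset.sum_eq_zero fun x hx => ?_).symm
      have hx' : x.1 t + x.2 t = m t := by
        rw [← Finsupp.add_apply, Finset.HasAntidiagonal.mem_antidiagonal.1 hx]
      by_cases h1 : x.1 t = 0
      · rw [if_neg (show ¬ x.2 t = 0 by omega), mul_zero]
      · rw [if_neg h1, zero_mul]
  map_zero' := by
    ext m
    simp [coeff_freePart]
  map_add' f g := by
    ext m
    rw [map_add, coeff_freePart, coeff_freePart, coeff_freePart, map_add]
    split_ifs <;> simp

theorem coeff_killVar (t : σ) (f : MvPowerSeries σ ℚ) (m : σ →₀ ℕ) :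
    MvPowerSeries.coeff m (killVar t f) = if m t = 0 then MvPowerSeries.coeff m f else 0 := rfl

theorem killVar_X_self (t : σ) : killVar t (MvPowerSeries.X t) = 0 := by
  classical
  ext m
  rw [coeff_killVar, MvPowerSeries.coeff_X]
  split_ifs with h1 h2
  · rw [h2, Finsupp.single_eq_same] at h1
    exact absurd h1 one_ne_zero
  · rfl
  · rfl

theorem killVar_X_of_ne {s t : σ} (h : s ≠ t) :
    killVar t (MvPowerSeries.X s) = MvPowerSeries.X s := by
  classical
  ext m
  rw [coeff_killVar, MvPowerSeries.coeff_X]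
  split_ifs with h1 h2 h2
  · rfl
  · rfl
  · exact absurd (by rw [h2, Finsupp.single_eq_of_ne h.symm]) h1
  · rfl

end

/-- The part of a series that involves nonnegative powers of `T` only, with `T` renamed `J`. -/
noncomputable def nonnegPart (f : ℚ[T;T⁻¹]⟦X⟧) : MvPowerSeries (Fin 2) ℚ :=
  fun m => (PowerSeries.coeff (m 0) f).coeff (m 1 : ℤ)

theorem coeff_nonnegPart (f : ℚ[T;T⁻¹]⟦X⟧) (m : Fin 2 →₀ ℕ) :
    MvPowerSeries.coeff m (nonnegPart f) = (PowerSeries.coeff (m 0) f).coeff (m 1 : ℤ) := rfl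

theorem nonnegPart_add (f g : ℚ[T;T⁻¹]⟦X⟧) : nonnegPart (f + g) = nonnegPart f + nonnegPart g := by
  ext m
  simp [coeff_nonnegPart]

theorem nonnegPart_sub (f g : ℚ[T;T⁻¹]⟦X⟧) : nonnegPart (f - g) = nonnegPart f - nonnegPart g := by
  ext m
  simp [coeff_nonnegPart]

theorem nonnegPart_X_mul (f : ℚ[T;T⁻¹]⟦X⟧) :
    nonnegPart (PowerSeries.X * f) = MvPowerSeries.X 0 * nonnegPart f := by
  ext m
  rw [coeff_X_mul_eq, coeff_nonnegPart]
  rcases h : m 0 with _ | p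
  · simp
  · rw [if_neg p.succ_ne_zero, coeff_nonnegPart, PowerSeries.coeff_succ_X_mul]
    simp [h]

theorem X_mul_nonnegPart_T_inv (f : ℚ[T;T⁻¹]⟦X⟧) :
    MvPowerSeries.X 1 * nonnegPart (PowerSeries.C (LaurentPolynomial.T (-1)) * f) =
      nonnegPart f - killVar 1 (nonnegPart f) := by
  ext m
  rw [coeff_X_mul_eq, map_sub, coeff_killVar, coeff_nonnegPart]
  split_ifs with h
  · simp
  · rw [coeff_nonnegPart, PowerSeries.coeff_C_mul, coeff_T_mul, sub_zero]
    have e : (((m - Finsupp.single 1 1 : Fin 2 →₀ ℕ) 1 : ℕ) : ℤ) - -1 = m 1 := by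
      simp
      omega
    rw [e]
    simp

/-- Multiplication by `T` moves the coefficient at `T⁻¹`, the negative of that at `T⁰`, into the
nonnegative part. -/
theorem nonnegPart_T_diffSeries (N : ℕ) :
    nonnegPart (PowerSeries.C (LaurentPolynomial.T 1) * diffSeries N) =
      MvPowerSeries.X 1 * nonnegPart (diffSeries N) - killVar 1 (nonnegPart (diffSeries N)) := by
  ext m
  rw [map_sub, coeff_X_mul_eq, coeff_killVar, coeff_nonnegPart, PowerSeries.coeff_C_mul, coeff_T_mul]
  split_ifs with h
  · rw [coeff_nonnegPart, h, zero_sub, Nat.cast_zero, zero_sub, coeff_diffSeries_neg_one]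
  · rw [coeff_nonnegPart, sub_zero]
    have e : (((m - Finsupp.single 1 1 : Fin 2 →₀ ℕ) 1 : ℕ) : ℤ) = m 1 - 1 := by
      simp
      omega
    rw [e]
    simp

theorem genM_eq_nonnegPart (N : ℕ) : genM N = nonnegPart (diffSeries N) := by
  ext m
  rw [coeff_nonnegPart, coeff_diffSeries_natCast]
  rfl

/-- The recurrence in the number of blocks: multiplication by the denominator of the character of
one block, read off on the nonnegative powers of `T`. -/
theorem genM_succ (N : ℕ) :
    let P : MvPowerSeries (Fin 2) ℚ := MvPowerSeries.X 0
    let J : MvPowerSeries (Fin 2) ℚ := MvPowerSeries.X 1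
    (1 - P) * (J - P) * (1 - P * J) * genM (N + 1) +
      P * (1 - P) * (1 + J) * killVar 1 (genM (N + 1)) = J * genM N := by
  intro P J
  have h1 := X_mul_nonnegPart_T_inv (diffSeries (N + 1))
  have h2 := nonnegPart_T_diffSeries (N + 1)
  set b := diffSeries (N + 1) with hb
  set u := PowerSeries.C (LaurentPolynomial.T 1) * b with hu
  set v := PowerSeries.C (LaurentPolynomial.T (-1)) * b with hv
  have hT : (PowerSeries.C (LaurentPolynomial.T 1) * PowerSeries.C (LaurentPolynomial.T (-1)) :
      ℚ[T;T⁻¹]⟦X⟧) = 1 := by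
    rw [← map_mul, ← LaurentPolynomial.T_add, add_neg_cancel, LaurentPolynomial.T_zero, map_one]
  have hE : diffSeries N =
      b + PowerSeries.X * (PowerSeries.X * b) - PowerSeries.X * u - PowerSeries.X * v -
        PowerSeries.X * b - PowerSeries.X * (PowerSeries.X * (PowerSeries.X * b)) +
        PowerSeries.X * (PowerSeries.X * u) + PowerSeries.X * (PowerSeries.X * v) := by
    rw [← charDenom_mul_diffSeries_succ, ← hb, charDenom, hu, hv]
    linear_combination (1 - PowerSeries.X) * PowerSeries.X ^ 2 * b * hT
  rw [genM_eq_nonnegPart, genM_eq_nonnegPart, hE]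
  simp only [nonnegPart_add, nonnegPart_sub, nonnegPart_X_mul]
  rw [h2]
  linear_combination (P - P ^ 2) * h1


/-! ### Uniqueness of the solution of the functional equation -/

theorem mvPowerSeries_eq_zero_of_X_pow_dvd {σ : Type*} {s : σ} {B : MvPowerSeries σ ℚ}
    (h : ∀ k, MvPowerSeries.X s ^ k ∣ B) : B = 0 := by
  ext m
  exact MvPowerSeries.X_pow_dvd_iff.1 (h (m s + 1)) m (Nat.lt_succ_self _)

/-- The homogeneous functional equation has only the solution `0`: a solution divisible by
`P^k` is divisible by `P^(k+1)`. -/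
theorem eq_zero_of_functionalEq {σ : Type*} {s t : σ} (hst : s ≠ t) {α β B : MvPowerSeries σ ℚ}
    (hα : IsUnit α) (hβ : MvPowerSeries.X s ∣ β)
    (h : α * (MvPowerSeries.X t * B) =
      β * ((1 + MvPowerSeries.X t ^ 2) * B - (1 + MvPowerSeries.X t) * killVar t B)) : B = 0 := by
  refine mvPowerSeries_eq_zero_of_X_pow_dvd (s := s) fun k => ?_
  induction k with
  | zero =>
    rw [pow_zero]
    exact one_dvd _
  | succ k ih =>
    have h0 : MvPowerSeries.X s ^ k ∣ killVar t B := by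
      rw [MvPowerSeries.X_pow_dvd_iff] at ih ⊢
      intro m hm
      rw [coeff_killVar, ih m hm, ite_self]
    have h1 : MvPowerSeries.X s ^ (k + 1) ∣ α * (MvPowerSeries.X t * B) := by
      rw [h, pow_succ']
      exact mul_dvd_mul hβ (dvd_sub (ih.mul_left _) (h0.mul_left _))
    rw [hα.dvd_mul_left, MvPowerSeries.X_pow_dvd_iff] at h1
    rw [MvPowerSeries.X_pow_dvd_iff]
    intro m hm
    have h2 := h1 (m + Finsupp.single t 1) (by
      rw [Finsupp.add_apply, Finsupp.single_eq_of_ne hst, add_zero]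
      exact hm)
    rw [coeff_X_mul_eq, if_neg (by simp)] at h2
    simpa using h2

/-! ### Small numbers of blocks -/

theorem genM_zero : genM 0 = 1 := by
  classical
  rw [genM_eq_nonnegPart, diffSeries, charSeries_eq_prod, pow_zero, mul_one]
  ext m
  have hm : m = 0 ↔ m 0 = 0 ∧ m 1 = 0 := by
    rw [Finsupp.ext_iff, Fin.forall_fin_two]
    rfl
  rw [coeff_nonnegPart, PowerSeries.coeff_C, MvPowerSeries.coeff_one]
  by_cases h0 : m 0 = 0
  · rw [if_pos h0, AddMonoidAlgebra.coeff_sub, Finsupp.sub_apply, LaurentPolynomial.T_apply,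
      if_neg (by omega), ← LaurentPolynomial.T_zero, LaurentPolynomial.T_apply, sub_zero]
    refine if_congr ?_ rfl rfl
    rw [hm]
    omega
  · rw [if_neg h0, if_neg fun h => h0 (hm.1 h).1]
    rfl

theorem constantCoeff_ne_zero_of_eq_one {σ : Type*} {f : MvPowerSeries σ ℚ}
    (h : MvPowerSeries.constantCoeff f = 1) : MvPowerSeries.constantCoeff f ≠ 0 := by
  rw [h]
  exact one_ne_zero

theorem ne_zero_of_constantCoeff_eq_one {σ : Type*} {f : MvPowerSeries σ ℚ}
    (h : MvPowerSeries.constantCoeff f = 1) : f ≠ 0 := by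
  rintro rfl
  rw [map_zero] at h
  exact zero_ne_one h

theorem genM_succ_eq {N : ℕ} {R : MvPowerSeries (Fin 2) ℚ}
    (h : let P : MvPowerSeries (Fin 2) ℚ := MvPowerSeries.X 0
      let J : MvPowerSeries (Fin 2) ℚ := MvPowerSeries.X 1
      (1 - P) * (J - P) * (1 - P * J) * R + P * (1 - P) * (1 + J) * killVar 1 R = J * genM N) :
    genM (N + 1) = R := by
  have h1 := genM_succ N
  simp only at h h1
  rw [← sub_eq_zero]
  refine eq_zero_of_functionalEq (s := (0 : Fin 2)) (t := 1) (by decide)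
    (α := (1 - MvPowerSeries.X 0) * (1 + MvPowerSeries.X 0 ^ 2))
    (β := MvPowerSeries.X 0 * (1 - MvPowerSeries.X 0)) ?_ (dvd_mul_right _ _) ?_
  · rw [MvPowerSeries.isUnit_iff_constantCoeff]
    simp
  · rw [map_sub]
    linear_combination h1 - h

/-- A rational expression `A' / D'` for `genM (N + 1)` is verified from one for `genM N` by a
polynomial identity. Here `D' = Q D`, and `Z` is the quotient of `D'` by its value at `J = 0`, so
that the value of `A' / D'` at `J = 0` is `a Z / D'`. -/
theorem genM_succ_mul_eq {N : ℕ} {A D A' D' a Q Z : MvPowerSeries (Fin 2) ℚ}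
    (hA : genM N * D = A) (hD' : MvPowerSeries.constantCoeff D' = 1) (hQ : D' = Q * D)
    (hZ : D' = killVar 1 D' * Z) (ha : killVar 1 A' = a)
    (h : let P : MvPowerSeries (Fin 2) ℚ := MvPowerSeries.X 0
      let J : MvPowerSeries (Fin 2) ℚ := MvPowerSeries.X 1
      (1 - P) * (J - P) * (1 - P * J) * A' + P * (1 - P) * (1 + J) * a * Z = J * A * Q) :
    genM (N + 1) * D' = A' := by
  have hc := constantCoeff_ne_zero_of_eq_one hD'
  have hR : A' * D'⁻¹ * D' = A' := by rw [mul_assoc, MvPowerSeries.inv_mul_cancel _ hc, mul_one]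
  have hK := congrArg (killVar 1) hR
  rw [map_mul _ _ D', ha] at hK
  rw [genM_succ_eq (R := A' * D'⁻¹), hR]
  intro P J
  apply mul_right_cancel₀ (ne_zero_of_constantCoeff_eq_one hD')
  simp only at h
  linear_combination h + (1 - P) * (J - P) * (1 - P * J) * hR + P * (1 - P) * (1 + J) * Z * hK +
    P * (1 - P) * (1 + J) * killVar 1 (A' * D'⁻¹) * hZ - J * genM N * hQ - J * Q * hA

theorem killVar_one_X_zero :
    killVar 1 (MvPowerSeries.X 0 : MvPowerSeries (Fin 2) ℚ) = MvPowerSeries.X 0 :=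
  killVar_X_of_ne (by decide)

section

variable (P J : MvPowerSeries (Fin 2) ℚ)

/-- The numerator of `genM 3`. -/
noncomputable def numer3 : MvPowerSeries (Fin 2) ℚ :=
  1 + 3 * J * P ^ 2 + P ^ 3 - J ^ 2 * P ^ 3 - 3 * J * P ^ 4 - J ^ 2 * P ^ 6

/-- The numerator of `genM 4`. -/
noncomputable def numer4 : MvPowerSeries (Fin 2) ℚ :=
  J ^ 3 * P ^ 10 + J ^ 3 * P ^ 8 + 6 * J ^ 2 * P ^ 8 + 4 * J ^ 3 * P ^ 7 - 4 * J * P ^ 7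
    + J ^ 3 * P ^ 6 - 10 * J ^ 2 * P ^ 6 + P ^ 6 - 10 * J * P ^ 4 + P ^ 4 + J ^ 3 * P ^ 4
    - 4 * J ^ 2 * P ^ 3 + 4 * P ^ 3 + 6 * J * P ^ 2 + P ^ 2 + 1

end

theorem genM_one_mul :
    let P : MvPowerSeries (Fin 2) ℚ := MvPowerSeries.X 0
    let J : MvPowerSeries (Fin 2) ℚ := MvPowerSeries.X 1
    genM 1 * ((1 - J * P) * (1 - P ^ 2)) = 1 := by
  intro P J
  refine genM_succ_mul_eq (A := 1) (D := 1) (a := 1) (Q := (1 - J * P) * (1 - P ^ 2))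
    (Z := 1 - J * P) (by rw [genM_zero, mul_one]) (by simp [P]) (by ring) ?_ (by simp) ?_
  · simp only [P, J, map_mul, map_sub, map_pow, map_one, killVar_X_self, killVar_one_X_zero]
    ring
  · intro P J
    ring

theorem genM_two_mul :
    let P : MvPowerSeries (Fin 2) ℚ := MvPowerSeries.X 0
    let J : MvPowerSeries (Fin 2) ℚ := MvPowerSeries.X 1
    genM 2 * ((1 - J * P) ^ 2 * (1 - P ^ 2) ^ 3) = 1 + J * P ^ 2 := by
  intro P J
  refine genM_succ_mul_eq (a := 1) (Q := (1 - J * P) * (1 - P ^ 2) ^ 2)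
    (Z := (1 - J * P) ^ 2) genM_one_mul (by simp [P]) (by ring) ?_ (by simp [J, killVar_X_self]) ?_
  · simp only [P, J, map_mul, map_sub, map_pow, map_one, killVar_X_self, killVar_one_X_zero]
    ring
  · intro P J
    ring

theorem genM_three_mul :
    let P : MvPowerSeries (Fin 2) ℚ := MvPowerSeries.X 0
    let J : MvPowerSeries (Fin 2) ℚ := MvPowerSeries.X 1
    genM 3 * ((1 - J * P) ^ 3 * (1 - P ^ 2) ^ 6) = numer3 P J := by
  intro P J
  refine genM_succ_mul_eq (a := 1 + P ^ 3) (Q := (1 - J * P) * (1 - P ^ 2) ^ 3)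
    (Z := (1 - J * P) ^ 3) genM_two_mul (by simp [P]) (by ring) ?_
    (by simp [P, J, numer3, killVar_X_self, killVar_one_X_zero]) ?_
  · simp only [P, J, map_mul, map_sub, map_pow, map_one, killVar_X_self, killVar_one_X_zero]
    ring
  · intro P J
    rw [numer3]
    ring

theorem genM_four_mul :
    let P : MvPowerSeries (Fin 2) ℚ := MvPowerSeries.X 0
    let J : MvPowerSeries (Fin 2) ℚ := MvPowerSeries.X 1
    genM 4 * ((1 - J * P) ^ 4 * (1 - P ^ 2) ^ 9) = numer4 P J := by
  intro P J
  refine genM_succ_mul_eq (a := P ^ 6 + P ^ 4 + 4 * P ^ 3 + P ^ 2 + 1)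
    (Q := (1 - J * P) * (1 - P ^ 2) ^ 3)
    (Z := (1 - J * P) ^ 4) genM_three_mul (by simp [P]) (by ring) ?_
    (by simp [P, J, numer4, killVar_X_self, killVar_one_X_zero, map_ofNat (killVar (1 : Fin 2)) 4]) ?_
  · simp only [P, J, map_mul, map_sub, map_pow, map_one, killVar_X_self, killVar_one_X_zero]
    ring
  · intro P J
    rw [numer3, numer4]
    ring

/-! ### The master generating function -/

/-- The series in `P`, `J`, `𝒩` whose coefficient at `𝒩^N` is `F N`. -/
noncomputable def assemble (F : ℕ → MvPowerSeries (Fin 2) ℚ) : MvPowerSeries (Fin 3) ℚ :=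
  fun m => MvPowerSeries.coeff (Finsupp.equivFunOnFinite.symm ![m 0, m 1]) (F (m 2))

theorem coeff_assemble (F : ℕ → MvPowerSeries (Fin 2) ℚ) (m : Fin 3 →₀ ℕ) :
    MvPowerSeries.coeff m (assemble F) =
      MvPowerSeries.coeff (Finsupp.equivFunOnFinite.symm ![m 0, m 1]) (F (m 2)) := rfl

theorem masterM_eq_assemble : masterM = assemble genM := rfl

theorem assemble_add (F G : ℕ → MvPowerSeries (Fin 2) ℚ) :
    assemble (fun N => F N + G N) = assemble F + assemble G := by
  ext m
  simp [coeff_assemble]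

theorem assemble_sub (F G : ℕ → MvPowerSeries (Fin 2) ℚ) :
    assemble (fun N => F N - G N) = assemble F - assemble G := by
  ext m
  simp [coeff_assemble]

theorem assemble_X_zero_mul (F : ℕ → MvPowerSeries (Fin 2) ℚ) :
    assemble (fun N => MvPowerSeries.X 0 * F N) = MvPowerSeries.X 0 * assemble F := by
  ext m
  rw [coeff_X_mul_eq, coeff_assemble, coeff_X_mul_eq]
  refine if_congr Iff.rfl rfl ?_
  rw [coeff_assemble]
  congr 1
  · congr 1
    ext i
    fin_cases i <;> simp
  · simp

theorem assemble_X_one_mul (F : ℕ → MvPowerSeries (Fin 2) ℚ) :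
    assemble (fun N => MvPowerSeries.X 1 * F N) = MvPowerSeries.X 1 * assemble F := by
  ext m
  rw [coeff_X_mul_eq, coeff_assemble, coeff_X_mul_eq]
  refine if_congr Iff.rfl rfl ?_
  rw [coeff_assemble]
  congr 1
  · congr 1
    ext i
    fin_cases i <;> simp
  · simp

theorem assemble_killVar (F : ℕ → MvPowerSeries (Fin 2) ℚ) :
    assemble (fun N => killVar 1 (F N)) = killVar 1 (assemble F) := by
  ext m
  rw [coeff_killVar, coeff_assemble, coeff_killVar]
  rfl

theorem assemble_eq_add (F : ℕ → MvPowerSeries (Fin 2) ℚ) (h : F 0 = 1) :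
    assemble F = 1 + MvPowerSeries.X 2 * assemble fun N => F (N + 1) := by
  classical
  ext m
  rw [map_add, coeff_X_mul_eq, coeff_assemble, MvPowerSeries.coeff_one]
  by_cases h2 : m 2 = 0
  · rw [if_pos h2, h2, h, add_zero, MvPowerSeries.coeff_one]
    refine if_congr ?_ rfl rfl
    rw [Finsupp.ext_iff, Finsupp.ext_iff, Fin.forall_fin_two]
    constructor
    · rintro ⟨h0, h1⟩ i
      fin_cases i
      · exact h0
      · exact h1
      · exact h2
    · exact fun h => ⟨h 0, h 1⟩
  · rw [if_neg h2, if_neg (fun h0 => h2 (by rw [h0]; rfl)), zero_add, coeff_assemble]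
    congr 2
    · ext i
      fin_cases i <;> simp
    · simp
      omega

/-- The recurrence in the number of blocks, summed over all numbers of blocks. -/
theorem masterM_functionalEq :
    let P : MvPowerSeries (Fin 3) ℚ := MvPowerSeries.X 0
    let J : MvPowerSeries (Fin 3) ℚ := MvPowerSeries.X 1
    let n : MvPowerSeries (Fin 3) ℚ := MvPowerSeries.X 2
    (1 - P) * (J - P) * (1 - P * J) * (masterM - 1) +
      P * (1 - P) * (1 + J) * killVar 1 (masterM - 1) = J * n * masterM := by
  intro P J n
  -- the recurrence, expanded into terms to which `assemble` applies one by one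
  have h : ∀ N, MvPowerSeries.X 1 * genM N =
      MvPowerSeries.X 1 * genM (N + 1) - MvPowerSeries.X 0 * genM (N + 1) -
        MvPowerSeries.X 0 * (MvPowerSeries.X 1 * (MvPowerSeries.X 1 * genM (N + 1))) +
        MvPowerSeries.X 0 * (MvPowerSeries.X 0 * (MvPowerSeries.X 1 * genM (N + 1))) -
        MvPowerSeries.X 0 * (MvPowerSeries.X 1 * genM (N + 1)) +
        MvPowerSeries.X 0 * (MvPowerSeries.X 0 * genM (N + 1)) +
        MvPowerSeries.X 0 * (MvPowerSeries.X 0 *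
          (MvPowerSeries.X 1 * (MvPowerSeries.X 1 * genM (N + 1)))) -
        MvPowerSeries.X 0 * (MvPowerSeries.X 0 * (MvPowerSeries.X 0 *
          (MvPowerSeries.X 1 * genM (N + 1)))) +
        MvPowerSeries.X 0 * killVar 1 (genM (N + 1)) -
        MvPowerSeries.X 0 * (MvPowerSeries.X 0 * killVar 1 (genM (N + 1))) +
        MvPowerSeries.X 0 * (MvPowerSeries.X 1 * killVar 1 (genM (N + 1))) -
        MvPowerSeries.X 0 * (MvPowerSeries.X 0 *
          (MvPowerSeries.X 1 * killVar 1 (genM (N + 1)))) := by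
    intro N
    have h1 := genM_succ N
    simp only at h1
    linear_combination -h1
  have h2 := congrArg assemble (funext h)
  simp only [assemble_add, assemble_sub, assemble_X_zero_mul, assemble_X_one_mul,
    assemble_killVar] at h2
  have h3 := assemble_eq_add genM genM_zero
  rw [← masterM_eq_assemble] at h2 h3
  set B := assemble fun N => genM (N + 1) with hB
  have h4 : masterM - 1 = n * B := by
    rw [h3]
    ring
  have hn : killVar 1 n = n := killVar_X_of_ne (by decide)
  rw [h4, map_mul, hn]
  linear_combination -n * h2


/-! ### The closed form of the master generating function -/

/-- The square root of a series `r` with constant term `1` is the binomial series of exponent `1/2`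
at `r - 1`, up to a sign that makes its constant term `1`. -/
theorem exists_isMasterSqrt : ∃ S, IsMasterSqrt S := by
  set r : MvPowerSeries (Fin 3) ℚ :=
    (MvPowerSeries.X 2 - (1 - MvPowerSeries.X 0) ^ 3) *
      (MvPowerSeries.X 2 - (1 - MvPowerSeries.X 0) * (1 + MvPowerSeries.X 0) ^ 2)⁻¹ with hr
  have hr1 : MvPowerSeries.constantCoeff r = 1 := by
    rw [hr, map_mul, MvPowerSeries.constantCoeff_inv]
    simp
  have hsub : PowerSeries.HasSubst (r - 1) := by
    apply PowerSeries.HasSubst.of_constantCoeff_zero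
    rw [map_sub, hr1, map_one, sub_self]
  set S := PowerSeries.subst (r - 1) (PowerSeries.binomialSeries ℚ (1 / 2 : ℚ)) with hS
  have hS2 : S ^ 2 = r := by
    rw [sq, hS, ← PowerSeries.subst_mul hsub, ← PowerSeries.binomialSeries_add,
      show (1 / 2 + 1 / 2 : ℚ) = ((1 : ℕ) : ℚ) by norm_num, PowerSeries.binomialSeries_nat, pow_one,
      PowerSeries.subst_add hsub, PowerSeries.subst_X hsub, ← PowerSeries.coe_substAlgHom hsub,
      map_one]
    ring
  have h1 : MvPowerSeries.constantCoeff S ^ 2 = 1 := by rw [← map_pow, hS2, hr1]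
  rcases mul_self_eq_one_iff.1 ((sq _).symm.trans h1) with h | h
  · exact ⟨S, h, hS2⟩
  · exact ⟨-S, by rw [map_neg, h, neg_neg], by rw [neg_sq]; exact hS2⟩

/-- With `α = (1 - P)(1 + P²) - 𝒩`, `β = P (1 - P)` and `T` the square root of `α² - 4 β²`, the
power series root `Y` of `α Y = β (1 + Y²)` gives the solution `𝒩 (1 - Y) / (T (1 - Y J))` of the
functional equation; at `J = 0` it equals `𝒩 (1 - S) / (2 β)`. -/
theorem two_mul_killVar_masterM {S : MvPowerSeries (Fin 3) ℚ} (hS : IsMasterSqrt S) :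
    let P : MvPowerSeries (Fin 3) ℚ := MvPowerSeries.X 0
    let n : MvPowerSeries (Fin 3) ℚ := MvPowerSeries.X 2
    2 * (P * (1 - P)) * killVar 1 (masterM - 1) = n * (1 - S) := by
  intro P n
  obtain ⟨hS1, hS2⟩ := hS
  set J : MvPowerSeries (Fin 3) ℚ := MvPowerSeries.X 1 with hJ
  change S ^ 2 = (n - (1 - P) ^ 3) * (n - (1 - P) * (1 + P) ^ 2)⁻¹ at hS2
  have hkP : killVar 1 P = P := killVar_X_of_ne (by decide)
  have hkn : killVar 1 n = n := killVar_X_of_ne (by decide)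
  have hkJ : killVar 1 J = 0 := killVar_X_self _
  have hcP : MvPowerSeries.constantCoeff P = 0 := MvPowerSeries.constantCoeff_X _
  have hcn : MvPowerSeries.constantCoeff n = 0 := MvPowerSeries.constantCoeff_X _
  have hcJ : MvPowerSeries.constantCoeff J = 0 := MvPowerSeries.constantCoeff_X _
  set q := (1 - P) * (1 + P) ^ 2 - n with hq
  have hcq : MvPowerSeries.constantCoeff (n - (1 - P) * (1 + P) ^ 2) ≠ 0 := by
    simp [hcP, hcn]
  have hSq : S ^ 2 * q = (1 - P) ^ 3 - n := by
    have h := MvPowerSeries.inv_mul_cancel _ hcq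
    rw [hS2, hq]
    linear_combination (-(n - (1 - P) ^ 3)) * h
  have hq0 : q ≠ 0 := ne_zero_of_constantCoeff_eq_one (by simp [hq, hcP, hcn])
  have hkq : killVar 1 q = q := by
    simp only [hq, map_sub, map_mul, map_pow, map_add, map_one, hkP, hkn]
  -- `S` does not involve `J`, as `-S` has the wrong constant term
  have hkS : killVar 1 S = S := by
    have h1 : (killVar 1 S - S) * ((killVar 1 S + S) * q) = 0 := by
      have h2 := congrArg (killVar 1) hSq
      simp only [map_sub, map_mul, map_pow, map_one, hkP, hkn, hkq] at h2
      linear_combination h2 - hSq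
    have h3 : MvPowerSeries.constantCoeff (killVar 1 S) = 1 := by
      rw [← hS1, ← MvPowerSeries.coeff_zero_eq_constantCoeff_apply, coeff_killVar,
        if_pos Finsupp.zero_apply, MvPowerSeries.coeff_zero_eq_constantCoeff_apply]
    rcases mul_eq_zero.1 h1 with h | h
    · exact sub_eq_zero.1 h
    · exfalso
      have h4 := congrArg MvPowerSeries.constantCoeff ((mul_eq_zero.1 h).resolve_right hq0)
      rw [map_add, h3, hS1, map_zero] at h4
      norm_num at h4
  set α := (1 - P) * (1 + P ^ 2) - n with hα
  set β := P * (1 - P) with hβ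
  set T := S * q with hT
  have hT2 : T ^ 2 = α ^ 2 - 4 * β ^ 2 := by
    rw [hT, hα, hβ]
    linear_combination q * hSq + ((1 - P) ^ 3 - n) * hq
  have hcα : MvPowerSeries.constantCoeff α = 1 := by simp [hα, hcP, hcn]
  have hcT : MvPowerSeries.constantCoeff T = 1 := by simp [hT, hq, hcP, hcn, hS1]
  have hkα : killVar 1 α = α := by
    simp only [hα, map_sub, map_mul, map_pow, map_add, map_one, hkP, hkn]
  have hkT : killVar 1 T = T := by rw [hT, map_mul, hkS, hkq]
  have hcαT : MvPowerSeries.constantCoeff (α + T) ≠ 0 := by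
    rw [map_add, hcα, hcT]
    norm_num
  have hαT0 : α + T ≠ 0 := by
    intro h
    rw [h, map_zero] at hcαT
    exact hcαT rfl
  obtain ⟨Y, hY⟩ : ∃ Y, Y = 2 * β * (α + T)⁻¹ := ⟨_, rfl⟩
  have hY1 : Y * (α + T) = 2 * β := by
    rw [hY, mul_assoc, MvPowerSeries.inv_mul_cancel _ hcαT, mul_one]
  have hcY : MvPowerSeries.constantCoeff Y = 0 := by
    rw [hY, map_mul, map_mul]
    simp [hβ, hcP]
  have hkY : killVar 1 Y = Y := by
    apply mul_right_cancel₀ hαT0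
    have h := congrArg (killVar 1) hY1
    rw [map_mul, map_add, hkα, hkT, map_mul, hβ, map_mul, map_sub, map_one, hkP, map_ofNat] at h
    rw [h, hY1]
  have hY2 : α * Y = β * (1 + Y ^ 2) := by
    apply mul_right_cancel₀ hαT0
    apply mul_right_cancel₀ hαT0
    linear_combination (α * (α + T) - β * (Y * (α + T) + 2 * β)) * hY1 - β * hT2
  have hTY : T = α - 2 * β * Y := by
    apply mul_right_cancel₀ hαT0
    linear_combination 2 * β * hY1 + hT2
  set D := T * (1 - Y * J) with hD
  have hcD : MvPowerSeries.constantCoeff D = 1 := by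
    rw [hD]
    simp [hcT, hcY]
  have hD0 := ne_zero_of_constantCoeff_eq_one hcD
  obtain ⟨R, hR⟩ : ∃ R, R = n * (1 - Y) * D⁻¹ := ⟨_, rfl⟩
  have hRD : R * D = n * (1 - Y) := by
    rw [hR, mul_assoc, MvPowerSeries.inv_mul_cancel _ (constantCoeff_ne_zero_of_eq_one hcD),
      mul_one]
  have hkD : killVar 1 D = T := by
    rw [hD, map_mul, hkT, map_sub, map_mul, hkJ, map_one, mul_zero, sub_zero, mul_one]
  have hkR : killVar 1 R * T = n * (1 - Y) := by
    have h := congrArg (killVar 1) hRD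
    rwa [map_mul, hkD, map_mul, map_sub, map_one, hkn, hkY] at h
  have hfun : α * (J * R) = β * ((1 + J ^ 2) * R - (1 + J) * killVar 1 R) + J * n := by
    apply mul_right_cancel₀ hD0
    have h1 : killVar 1 R * D = n * (1 - Y) * (1 - Y * J) := by
      rw [hD, ← mul_assoc, hkR]
    linear_combination (α * J - β * (1 + J ^ 2)) * hRD + β * (1 + J) * h1 -
      n * J * (1 - J) * hY2 - J * n * (1 - Y * J) * hTY - J * n * hD
  -- `R` and `masterM - 1` solve the same functional equation
  have hM : masterM - 1 = R := by
    rw [← sub_eq_zero]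
    have h1 := masterM_functionalEq
    simp only at h1
    refine eq_zero_of_functionalEq (s := (0 : Fin 3)) (t := 1) (by decide) (α := α) (β := β) ?_
      (dvd_mul_right _ _) ?_
    · rw [MvPowerSeries.isUnit_iff_constantCoeff, hcα]
      exact isUnit_one
    · rw [map_sub (killVar 1) _ R]
      change (1 - P) * (J - P) * (1 - P * J) * (masterM - 1) +
        P * (1 - P) * (1 + J) * killVar 1 (masterM - 1) = J * n * masterM at h1
      change α * (J * (masterM - 1 - R)) = β * ((1 + J ^ 2) * (masterM - 1 - R) -
        (1 + J) * (killVar 1 (masterM - 1) - killVar 1 R))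
      linear_combination h1 - hfun + J * (masterM - 1) * hα +
        ((1 + J) * killVar 1 (masterM - 1) - (1 + J ^ 2) * (masterM - 1)) * hβ
  rw [hM]
  have hT0 : T ≠ 0 := ne_zero_of_constantCoeff_eq_one hcT
  apply mul_right_cancel₀ hT0
  linear_combination 2 * β * hkR - n * hTY + n * S * hT + n * hSq - n * hα + 2 * n * hβ

/-- The master formula, cleared of denominators. -/
theorem masterM_formula {S : MvPowerSeries (Fin 3) ℚ} (hS : IsMasterSqrt S) :
    let P : MvPowerSeries (Fin 3) ℚ := MvPowerSeries.X 0
    let J : MvPowerSeries (Fin 3) ℚ := MvPowerSeries.X 1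
    let n : MvPowerSeries (Fin 3) ℚ := MvPowerSeries.X 2
    2 * (J * n - (1 - P) * (1 - J * P) * (J - P)) * (masterM - 1) =
      n * (1 - J) - n * (1 + J) * S := by
  intro P J n
  have h1 := masterM_functionalEq
  have h2 := two_mul_killVar_masterM hS
  simp only at h1 h2
  linear_combination (1 + J) * h2 - 2 * h1

theorem masterDenom_ne_zero :
    let P : MvPowerSeries (Fin 3) ℚ := MvPowerSeries.X 0
    let J : MvPowerSeries (Fin 3) ℚ := MvPowerSeries.X 1
    let n : MvPowerSeries (Fin 3) ℚ := MvPowerSeries.X 2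
    J * n - (1 - P) * (1 - J * P) * (J - P) ≠ 0 := by
  intro P J n h
  have hkP : killVar 1 P = P := killVar_X_of_ne (by decide)
  have hkJ : killVar 1 J = 0 := killVar_X_self _
  have h1 := congrArg (killVar 1) h
  simp only [map_sub, map_mul, map_one, hkP, hkJ, map_zero] at h1
  have h2 : P * (1 - P) = 0 := by linear_combination h1
  rcases mul_eq_zero.1 h2 with h3 | h3
  · have h4 := congrArg (MvPowerSeries.coeff (Finsupp.single 0 1)) h3
    simp [P] at h4
  · exact ne_zero_of_constantCoeff_eq_one (by simp [P]) h3

/-- The master formula in the field of fractions. -/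
theorem masterM_fraction {S : MvPowerSeries (Fin 3) ℚ} (hS : IsMasterSqrt S) :
    let ι : MvPowerSeries (Fin 3) ℚ →+* MasterField := algebraMap _ _
    let P : MasterField := ι (MvPowerSeries.X 0)
    let J : MasterField := ι (MvPowerSeries.X 1)
    let n : MasterField := ι (MvPowerSeries.X 2)
    J * n - (1 - P) * (1 - J * P) * (J - P) ≠ 0 ∧
    ι masterM =
      1 + 1 / 2 * (n * (1 - J) / (J * n - (1 - P) * (1 - J * P) * (J - P)))
        - 1 / 2 * (n * (1 + J) / (J * n - (1 - P) * (1 - J * P) * (J - P))) * ι S := by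
  intro ι P J n
  have hinj : Function.Injective ι := IsFractionRing.injective _ _
  have h0 : J * n - (1 - P) * (1 - J * P) * (J - P) ≠ 0 := by
    intro h
    refine masterDenom_ne_zero (hinj ?_)
    simpa only [map_sub, map_mul, map_one, map_zero] using h
  refine ⟨h0, ?_⟩
  have h1 := congrArg ι (masterM_formula hS)
  simp only [map_sub, map_mul, map_add, map_one, map_ofNat] at h1
  change 2 * (J * n - (1 - P) * (1 - J * P) * (J - P)) * (ι masterM - 1) =
      n * (1 - J) - n * (1 + J) * ι S at h1
  have h2 : (2 : MasterField) ≠ 0 := by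
    intro h
    have h3 : (2 : MvPowerSeries (Fin 3) ℚ) = 0 := hinj (by rw [map_ofNat, map_zero, h])
    have h4 := congrArg MvPowerSeries.constantCoeff h3
    rw [map_ofNat, map_zero] at h4
    norm_num at h4
  generalize J * n - (1 - P) * (1 - J * P) * (J - P) = D at *
  field_simp
  linear_combination h1


/-! ### Matrix units of `gl(1|n)` -/

theorem _root_.ZMod.eq_zero_or_eq_one : ∀ a : ZMod 2, a = 0 ∨ a = 1 := by decide

theorem isHomog_single {n : ℕ} (i j : Fin (n + 1)) :
    IsHomog (indexDeg i + indexDeg j) (Matrix.single i j (1 : ℂ)) := by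
  intro k l h
  rw [Matrix.single_apply] at h
  obtain ⟨rfl, rfl⟩ := (ite_ne_right_iff.1 h).1
  rfl

theorem isHomog_diagonal {n : ℕ} (d : Fin (n + 1) → ℂ) : IsHomog 0 (Matrix.diagonal d) := by
  intro k l h
  have hkl : k = l := by
    by_contra hkl
    exact h (Matrix.diagonal_apply_ne _ hkl)
  rw [hkl]
  exact CharTwo.add_self_eq_zero _

/-- A family of operators depending linearly on a matrix maps a vector into a subspace if the
operators of the matrix units do. -/
theorem act_mem_of_single {n : ℕ} {X : Type*} [AddCommGroup X] [Module ℂ X]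
    (A : Matrix (Fin (n + 1)) (Fin (n + 1)) ℂ →ₗ[ℂ] Module.End ℂ X) {U : Submodule ℂ X} {x : X}
    (h : ∀ i j, A (Matrix.single i j 1) x ∈ U) (M : Matrix (Fin (n + 1)) (Fin (n + 1)) ℂ) :
    A M x ∈ U := by
  rw [Matrix.matrix_eq_sum_single M]
  simp only [map_sum, LinearMap.sum_apply]
  refine U.sum_mem fun i _ => U.sum_mem fun j _ => ?_
  have h1 : Matrix.single i j (M i j) = M i j • Matrix.single i j (1 : ℂ) := by
    rw [Matrix.smul_single, smul_eq_mul, mul_one]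
  rw [h1, map_smul, LinearMap.smul_apply]
  exact U.smul_mem _ (h i j)

/-! ### Submodules generated by a highest weight vector -/

section LowWord

variable {n : ℕ} {X : Type*} [AddCommGroup X] [Module ℂ X]

/-- `LowWord A x₀ k b x`: the vector `x` arises from `x₀` by applying lowering operators
`e_{ij}`, `i > j`, where `k` is the sum of the differences `i - j` and `b` is the sum of the
degrees of these `e_{ij}`. -/
inductive LowWord (A : Matrix (Fin (n + 1)) (Fin (n + 1)) ℂ →ₗ[ℂ] Module.End ℂ X) (x₀ : X) :
    ℕ → ZMod 2 → X → Prop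
  | base : LowWord A x₀ 0 0 x₀
  | step {k : ℕ} {b : ZMod 2} {x : X} {i j : Fin (n + 1)} (hij : j < i) (h : LowWord A x₀ k b x) :
      LowWord A x₀ (k + (i.val - j.val)) (indexDeg i + indexDeg j + b) (A (Matrix.single i j 1) x)

/-- The span of the vectors that arise from `x₀` by applying lowering operators. -/
def lowSpan (A : Matrix (Fin (n + 1)) (Fin (n + 1)) ℂ →ₗ[ℂ] Module.End ℂ X) (x₀ : X) :
    Submodule ℂ X :=
  Submodule.span ℂ {x | ∃ k b, LowWord A x₀ k b x}

/-- The bracket relations of `gl(1|n)`. -/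
def IsBracketCompatible (A : Matrix (Fin (n + 1)) (Fin (n + 1)) ℂ →ₗ[ℂ] Module.End ℂ X) : Prop :=
  ∀ (a b : ZMod 2) (x y : Matrix (Fin (n + 1)) (Fin (n + 1)) ℂ),
    IsHomog a x → IsHomog b y →
      A (x * y - superSign a b • (y * x)) = A x * A y - superSign a b • (A y * A x)

/-- `x₀` is a vector of weight `Λ` that is killed by the raising operators. -/
def IsHighest (A : Matrix (Fin (n + 1)) (Fin (n + 1)) ℂ →ₗ[ℂ] Module.End ℂ X)
    (Λ : Fin (n + 1) → ℂ) (x₀ : X) : Prop :=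
  (∀ i j, i < j → A (Matrix.single i j 1) x₀ = 0) ∧ ∀ i, A (Matrix.single i i 1) x₀ = Λ i • x₀

/-- The diagonal matrix whose eigenvalues measure the level of a weight below the highest one. -/
def levelMatrix (n : ℕ) : Matrix (Fin (n + 1)) (Fin (n + 1)) ℂ :=
  Matrix.diagonal fun i => -(i.val : ℂ)

variable {A : Matrix (Fin (n + 1)) (Fin (n + 1)) ℂ →ₗ[ℂ] Module.End ℂ X} {Λ : Fin (n + 1) → ℂ}
  {x₀ : X}

theorem LowWord.mem_lowSpan {k : ℕ} {b : ZMod 2} {x : X} (h : LowWord A x₀ k b x) :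
    x ∈ lowSpan A x₀ :=
  Submodule.subset_span ⟨k, b, h⟩

/-- The span of the descendants of a highest weight vector is invariant. -/
theorem act_mem_lowSpan (hA : IsBracketCompatible A) (h₀ : IsHighest A Λ x₀)
    (M : Matrix (Fin (n + 1)) (Fin (n + 1)) ℂ) {x : X} (hx : x ∈ lowSpan A x₀) :
    A M x ∈ lowSpan A x₀ := by
  -- lowering operators map the span into itself by construction
  have hlow : ∀ i j : Fin (n + 1), j < i → ∀ x ∈ lowSpan A x₀,
      A (Matrix.single i j 1) x ∈ lowSpan A x₀ := by
    intro i j hij x hx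
    have h : lowSpan A x₀ ≤ (lowSpan A x₀).comap (A (Matrix.single i j 1)) := by
      refine Submodule.span_le.2 ?_
      rintro x ⟨k, b, hw⟩
      exact (hw.step hij).mem_lowSpan
    exact h hx
  have hword : ∀ k b x, LowWord A x₀ k b x → ∀ M, A M x ∈ lowSpan A x₀ := by
    intro k b x hw
    induction hw with
    | base =>
      refine act_mem_of_single A fun i j => ?_
      rcases lt_trichotomy i j with h | rfl | h
      · rw [h₀.1 i j h]
        exact Submodule.zero_mem _
      · rw [h₀.2 i]
        exact Submodule.smul_mem _ _ LowWord.base.mem_lowSpan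
      · exact (LowWord.base.step h).mem_lowSpan
    | @step k b x i j hij hw ih =>
      refine act_mem_of_single A fun a c => ?_
      -- move `e_{ac}` past the last lowering operator `e_{ij}`
      have h := LinearMap.congr_fun
        (hA _ _ _ _ (isHomog_single a c) (isHomog_single i j)) x
      rw [LinearMap.sub_apply, LinearMap.smul_apply, Module.End.mul_apply, Module.End.mul_apply,
        eq_sub_iff_add_eq] at h
      rw [← h]
      exact Submodule.add_mem _ (ih _) (Submodule.smul_mem _ _ (hlow i j hij _ (ih _)))
  have h : lowSpan A x₀ ≤ (lowSpan A x₀).comap (A M) := by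
    refine Submodule.span_le.2 ?_
    rintro x ⟨k, b, hw⟩
    exact hword k b x hw M
  exact h hx

/-- A lowering operator `e_{ij}` lowers the eigenvalue of the level matrix by `i - j`. -/
theorem LowWord.act_levelMatrix (hA : IsBracketCompatible A) {c : ℂ}
    (h₀ : A (levelMatrix n) x₀ = c • x₀) {k : ℕ} {b : ZMod 2} {x : X} (h : LowWord A x₀ k b x) :
    A (levelMatrix n) x = (c - k) • x := by
  induction h with
  | base => simpa using h₀
  | @step k b x i j hij hw ih =>
    have h := LinearMap.congr_fun
      (hA _ _ _ _ (isHomog_diagonal fun i => -(i.val : ℂ)) (isHomog_single i j)) x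
    have h1 : superSign 0 (indexDeg i + indexDeg j) = 1 := by
      rw [superSign, if_neg fun h => zero_ne_one h.1]
    have h2 : levelMatrix n * Matrix.single i j 1 - Matrix.single i j 1 * levelMatrix n =
        ((j.val : ℂ) - i.val) • Matrix.single i j 1 := by
      ext a b
      rw [levelMatrix, Matrix.sub_apply, Matrix.diagonal_mul, Matrix.mul_diagonal,
        Matrix.smul_apply, Matrix.single_apply]
      split_ifs with h
      · rw [h.1, h.2, smul_eq_mul]
        ring
      · simp
    rw [h1, one_smul, one_smul, ← levelMatrix, h2, LinearMap.sub_apply, Module.End.mul_apply,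
      Module.End.mul_apply, ih, map_smul, LinearMap.smul_apply, map_smul, eq_sub_iff_add_eq] at h
    rw [← h, ← add_smul, Nat.cast_add, Nat.cast_sub hij.le]
    congr 1
    ring

/-- The part of `lowSpan A x₀` on the level of `x₀` is spanned by `x₀`. -/
theorem exists_smul_eq_of_mem_lowSpan (hA : IsBracketCompatible A) {c : ℂ}
    (h₀ : A (levelMatrix n) x₀ = c • x₀) {x : X} (hx : x ∈ lowSpan A x₀)
    (hc : A (levelMatrix n) x = c • x) : ∃ a : ℂ, x = a • x₀ := by
  set D := A (levelMatrix n)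
  have h : lowSpan A x₀ ≤ (ℂ ∙ x₀) ⊔ ⨆ μ, ⨆ (_ : μ ≠ c), D.eigenspace μ := by
    refine Submodule.span_le.2 ?_
    rintro x ⟨k, b, hw⟩
    have hk := Module.End.mem_eigenspace_iff.2 (hw.act_levelMatrix hA h₀)
    cases hw with
    | base => exact Submodule.mem_sup_left (Submodule.mem_span_singleton_self _)
    | @step k b x i j hij hw =>
      refine Submodule.mem_sup_right (Submodule.mem_iSup_of_mem _ (Submodule.mem_iSup_of_mem ?_ hk))
      have : (k + (i.val - j.val) : ℕ) ≠ 0 := by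
        have : j.val < i.val := hij
        omega
      intro h
      rw [sub_eq_self] at h
      exact this (by exact_mod_cast h)
  obtain ⟨y, hy, z, hz, hyz⟩ := Submodule.mem_sup.1 (h hx)
  obtain ⟨a, rfl⟩ := Submodule.mem_span_singleton.1 hy
  refine ⟨a, ?_⟩
  have hzc : z ∈ D.eigenspace c := by
    rw [Module.End.mem_eigenspace_iff, ← sub_eq_iff_eq_add'.2 hyz.symm, map_sub, hc, map_smul, h₀,
      smul_sub, smul_comm]
  have hz0 : z = 0 := Submodule.disjoint_def.1 (D.eigenspaces_iSupIndep c) z hzc hz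
  rw [← hyz, hz0, add_zero]

end LowWord

/-! ### Uniqueness of the simple module with a given highest weight -/

namespace GLSuperRep

variable {n : ℕ} {W : Type*} [AddCommGroup W] [Module ℂ W] (ρ : GLSuperRep n W)

theorem isCompl_gr : IsCompl (ρ.gr 0) (ρ.gr 1) :=
  (DirectSum.isInternal_submodule_iff_isCompl ρ.gr zero_ne_one (by
    ext i
    simpa using ZMod.eq_zero_or_eq_one i)).1 ρ.isInternal

theorem isCompl_gr_add (b : ZMod 2) : IsCompl (ρ.gr (0 + b)) (ρ.gr (1 + b)) := by
  fin_cases b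
  · exact ρ.isCompl_gr
  · exact ρ.isCompl_gr.symm

theorem eq_zero_of_add_eq_zero {b : ZMod 2} {x y : W} (hx : x ∈ ρ.gr (0 + b))
    (hy : y ∈ ρ.gr (1 + b)) (h : x + y = 0) : x = 0 ∧ y = 0 := by
  have h0 : x = 0 := by
    refine Submodule.disjoint_def.1 (ρ.isCompl_gr_add b).disjoint x hx ?_
    rw [eq_neg_of_add_eq_zero_left h]
    exact Submodule.neg_mem _ hy
  exact ⟨h0, by rwa [h0, zero_add] at h⟩

variable {ρ}

/-- A homogeneous component of a highest weight vector is a highest weight vector. -/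
theorem HasHighestWeight.exists_homogeneous {Λ : Fin (n + 1) → ℂ} (h : ρ.HasHighestWeight Λ) :
    ∃ b, ∃ v ∈ ρ.gr b, v ≠ 0 ∧ IsHighest ρ.act Λ v := by
  obtain ⟨v, hv, h1, h2⟩ := h
  obtain ⟨x, hx, y, hy, rfl⟩ := Submodule.mem_sup.1
    (ρ.isCompl_gr.sup_eq_top ▸ Submodule.mem_top : v ∈ ρ.gr 0 ⊔ ρ.gr 1)
  have h1' : ∀ i j, i < j →
      ρ.act (Matrix.single i j 1) x = 0 ∧ ρ.act (Matrix.single i j 1) y = 0 := by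
    intro i j hij
    refine ρ.eq_zero_of_add_eq_zero (b := indexDeg i + indexDeg j) ?_ ?_
      (by rw [← map_add, h1 i j hij])
    · rw [add_comm]
      exact ρ.act_mem _ _ _ (isHomog_single i j) _ hx
    · rw [add_comm]
      exact ρ.act_mem _ _ _ (isHomog_single i j) _ hy
  have h2' : ∀ i, ρ.act (Matrix.single i i 1) x - Λ i • x = 0 ∧
      ρ.act (Matrix.single i i 1) y - Λ i • y = 0 := by
    intro i
    have hi : indexDeg i + indexDeg i = 0 := CharTwo.add_self_eq_zero _
    have hm : ∀ b, ∀ w ∈ ρ.gr b, ρ.act (Matrix.single i i 1) w - Λ i • w ∈ ρ.gr (b + 0) := by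
      intro b w hw
      have h3 := ρ.act_mem _ _ _ (isHomog_single i i) _ hw
      rw [hi, zero_add] at h3
      rw [add_zero]
      exact Submodule.sub_mem _ h3 (Submodule.smul_mem _ _ hw)
    refine ρ.eq_zero_of_add_eq_zero (hm 0 x hx) (hm 1 y hy) ?_
    have h4 := h2 i
    rw [map_add, smul_add] at h4
    rw [sub_add_sub_comm, h4, sub_self]
  by_cases hx0 : x = 0
  · refine ⟨1, y, hy, fun h => hv (by rw [hx0, h, add_zero]), fun i j hij => (h1' i j hij).2,
      fun i => sub_eq_zero.1 (h2' i).2⟩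
  · exact ⟨0, x, hx, hx0, fun i j hij => (h1' i j hij).1, fun i => sub_eq_zero.1 (h2' i).1⟩

/-- Simplicity, with the grading shifted by `b`. -/
theorem IsSimple.eq_bot_or_eq_top (h : ρ.IsSimple) (b : ZMod 2) {U : Submodule ℂ W}
    (hg : U ≤ (U ⊓ ρ.gr (0 + b)) ⊔ (U ⊓ ρ.gr (1 + b))) (hU : ∀ x, ∀ w ∈ U, ρ.act x w ∈ U) :
    U = ⊥ ∨ U = ⊤ := by
  refine h.2 U ?_ hU
  fin_cases b
  · exact hg
  · rw [sup_comm]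
    exact hg

/-! In this section `X` is acted on by `A`, and `φ`, `ψ` are equivariant maps to `W`, `W'`. -/

section Descendants

variable {X W' : Type*} [AddCommGroup X] [Module ℂ X] [AddCommGroup W'] [Module ℂ W']
  {ρ' : GLSuperRep n W'} {A : Matrix (Fin (n + 1)) (Fin (n + 1)) ℂ →ₗ[ℂ] Module.End ℂ X}
  {Λ : Fin (n + 1) → ℂ} {x₀ : X} {φ : X →ₗ[ℂ] W} {ψ : X →ₗ[ℂ] W'} {b b' : ZMod 2}

theorem map_lowWord_mem (hφ : ∀ M x, φ (A M x) = ρ.act M (φ x)) (hb : φ x₀ ∈ ρ.gr b) {k : ℕ}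
    {c : ZMod 2} {x : X} (h : LowWord A x₀ k c x) : φ x ∈ ρ.gr (c + b) := by
  induction h with
  | base => rwa [zero_add]
  | @step k c x i j hij hw ih =>
    rw [hφ, add_assoc]
    exact ρ.act_mem _ _ _ (isHomog_single i j) _ ih

/-- The descendants of a homogeneous vector span a graded subspace. -/
theorem exists_homogeneous_add (hφ : ∀ M x, φ (A M x) = ρ.act M (φ x)) (hb : φ x₀ ∈ ρ.gr b)
    (hψ : ∀ M x, ψ (A M x) = ρ'.act M (ψ x)) (hb' : ψ x₀ ∈ ρ'.gr b') {x : X}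
    (hx : x ∈ lowSpan A x₀) : ∃ y ∈ lowSpan A x₀, ∃ z ∈ lowSpan A x₀, y + z = x ∧
      φ y ∈ ρ.gr (0 + b) ∧ φ z ∈ ρ.gr (1 + b) ∧ ψ y ∈ ρ'.gr (0 + b') ∧ ψ z ∈ ρ'.gr (1 + b') := by
  set G : ZMod 2 → Submodule ℂ X := fun c =>
    lowSpan A x₀ ⊓ ((ρ.gr (c + b)).comap φ ⊓ (ρ'.gr (c + b')).comap ψ)
  have h : lowSpan A x₀ ≤ G 0 ⊔ G 1 := by
    refine Submodule.span_le.2 ?_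
    rintro x ⟨k, c, hw⟩
    have hx : x ∈ G c :=
      ⟨hw.mem_lowSpan, map_lowWord_mem hφ hb hw, map_lowWord_mem hψ hb' hw⟩
    obtain rfl | rfl := ZMod.eq_zero_or_eq_one c
    · exact Submodule.mem_sup_left hx
    · exact Submodule.mem_sup_right hx
  obtain ⟨y, ⟨hy, hy1, hy2⟩, z, ⟨hz, hz1, hz2⟩, hyz⟩ := Submodule.mem_sup.1 (h hx)
  exact ⟨y, hy, z, hz, hyz, hy1, hz1, hy2, hz2⟩

/-- The descendants of `x₀` project onto a simple module in which the image of `x₀` is nonzero. -/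
theorem IsSimple.map_lowSpan_eq_top (hs : ρ.IsSimple) (hA : IsBracketCompatible A)
    (h₀ : IsHighest A Λ x₀) (hφ : ∀ M x, φ (A M x) = ρ.act M (φ x)) (hb : φ x₀ ∈ ρ.gr b)
    (hx₀ : φ x₀ ≠ 0) : (lowSpan A x₀).map φ = ⊤ := by
  refine (hs.eq_bot_or_eq_top b ?_ ?_).resolve_left fun h => hx₀ ?_
  · rintro _ ⟨x, hx, rfl⟩
    obtain ⟨y, hy, z, hz, rfl, hy1, hz1, -, -⟩ := exists_homogeneous_add hφ hb hφ hb hx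
    rw [map_add]
    exact Submodule.add_mem_sup ⟨⟨y, hy, rfl⟩, hy1⟩ ⟨⟨z, hz, rfl⟩, hz1⟩
  · rintro M _ ⟨x, hx, rfl⟩
    exact ⟨A M x, act_mem_lowSpan hA h₀ M hx, hφ M x⟩
  · exact (Submodule.mem_bot ℂ).1 (h ▸ ⟨x₀, LowWord.base.mem_lowSpan, rfl⟩)

/-- If `W` is simple, the descendants of `x₀` that are killed by `ψ` are killed by `φ`: otherwise they
would project onto `W`, and one of them would be a vector on the level of `x₀` that is not a
multiple of `x₀`. -/
theorem IsSimple.eq_zero_of_mem_lowSpan (hs : ρ.IsSimple) (hA : IsBracketCompatible A)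
    (h₀ : IsHighest A Λ x₀) (hφ : ∀ M x, φ (A M x) = ρ.act M (φ x)) (hb : φ x₀ ∈ ρ.gr b)
    (hψ : ∀ M x, ψ (A M x) = ρ'.act M (ψ x)) (hb' : ψ x₀ ∈ ρ'.gr b')
    (hinj : ∀ x, φ x = 0 → ψ x = 0 → x = 0) (hφ₀ : φ x₀ ≠ 0) (hψ₀ : ψ x₀ ≠ 0) {x : X}
    (hx : x ∈ lowSpan A x₀) (hx' : ψ x = 0) : φ x = 0 := by
  have h : (lowSpan A x₀ ⊓ LinearMap.ker ψ).map φ = ⊥ := by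
    refine (hs.eq_bot_or_eq_top b ?_ ?_).resolve_right fun h => ?_
    · rintro _ ⟨x, ⟨hx, hx'⟩, rfl⟩
      obtain ⟨y, hy, z, hz, rfl, hy1, hz1, hy2, hz2⟩ := exists_homogeneous_add hφ hb hψ hb' hx
      have h2 := ρ'.eq_zero_of_add_eq_zero hy2 hz2 (by
        rw [← map_add]
        exact hx')
      rw [map_add]
      exact Submodule.add_mem_sup ⟨⟨y, ⟨hy, h2.1⟩, rfl⟩, hy1⟩ ⟨⟨z, ⟨hz, h2.2⟩, rfl⟩, hz1⟩
    · rintro M _ ⟨x, ⟨hx, hx'⟩, rfl⟩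
      refine ⟨A M x, ⟨act_mem_lowSpan hA h₀ M hx, ?_⟩, hφ M x⟩
      rw [SetLike.mem_coe, LinearMap.mem_ker, hψ, LinearMap.mem_ker.1 hx', map_zero]
    -- otherwise some descendant `u` has `φ u = φ x₀` and `ψ u = 0`; it is on the level of `x₀`
    · obtain ⟨u, ⟨hu, hu'⟩, hux⟩ : φ x₀ ∈ (lowSpan A x₀ ⊓ LinearMap.ker ψ).map φ :=
        h ▸ Submodule.mem_top
      have hD : A (levelMatrix n) x₀ = (∑ i, -(i.val : ℂ) * Λ i) • x₀ := by
        have h1 : levelMatrix n = ∑ i, (-(i.val : ℂ)) • Matrix.single i i (1 : ℂ) := by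
          simp only [levelMatrix, Matrix.smul_single, smul_eq_mul, mul_one]
          exact (Matrix.sum_single_eq_diagonal _).symm
        rw [h1]
        simp only [map_sum, map_smul, LinearMap.sum_apply, LinearMap.smul_apply, h₀.2, smul_smul,
          Finset.sum_smul]
      have hDu : A (levelMatrix n) u = (∑ i, -(i.val : ℂ) * Λ i) • u := by
        refine sub_eq_zero.1 (hinj _ ?_ ?_)
        · rw [map_sub, hφ, map_smul, hux, ← hφ, hD, map_smul, sub_self]
        · rw [map_sub, hψ, map_smul, LinearMap.mem_ker.1 hu', map_zero, smul_zero, sub_self]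
      obtain ⟨a, rfl⟩ := exists_smul_eq_of_mem_lowSpan hA hD hu hDu
      have h1 := LinearMap.mem_ker.1 hu'
      rw [map_smul, smul_eq_zero] at h1
      rw [h1.resolve_right hψ₀, zero_smul, map_zero] at hux
      exact hφ₀ hux.symm
  exact (Submodule.mem_bot ℂ).1 (h ▸ ⟨x, ⟨hx, hx'⟩, rfl⟩)

end Descendants

/-- Two simple modules with the same highest weight are isomorphic: the descendants of the pair of
highest weight vectors form the graph of an isomorphism. The isomorphism may reverse the
parity. -/
theorem IsSimple.exists_equiv {W' : Type*} [AddCommGroup W'] [Module ℂ W'] {ρ' : GLSuperRep n W'}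
    {Λ : Fin (n + 1) → ℂ} (hs : ρ.IsSimple) (hs' : ρ'.IsSimple) (hw : ρ.HasHighestWeight Λ)
    (hw' : ρ'.HasHighestWeight Λ) :
    ∃ Φ : W ≃ₗ[ℂ] W', ∀ M w, Φ (ρ.act M w) = ρ'.act M (Φ w) := by
  obtain ⟨b, v, hv, hv0, hvh⟩ := hw.exists_homogeneous
  obtain ⟨b', v', hv', hv0', hvh'⟩ := hw'.exists_homogeneous
  -- `gl(1|n)` acts on the product componentwise
  let A : Matrix (Fin (n + 1)) (Fin (n + 1)) ℂ →ₗ[ℂ] Module.End ℂ (W × W') :=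
    { toFun := fun M => (ρ.act M).prodMap (ρ'.act M)
      map_add' := fun M M' => by
        rw [map_add, map_add]
        rfl
      map_smul' := fun c M => by
        rw [map_smul, map_smul]
        rfl }
  have hA : IsBracketCompatible A := by
    intro a c x y hx hy
    refine LinearMap.ext fun w => Prod.ext ?_ ?_
    · exact LinearMap.congr_fun (ρ.act_bracket a c x y hx hy) w.1
    · exact LinearMap.congr_fun (ρ'.act_bracket a c x y hx hy) w.2
  have h₀ : IsHighest A Λ (v, v') :=
    ⟨fun i j hij => Prod.ext (hvh.1 i j hij) (hvh'.1 i j hij),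
      fun i => Prod.ext (hvh.2 i) (hvh'.2 i)⟩
  have hφ : ∀ M x, LinearMap.fst ℂ W W' (A M x) = ρ.act M (LinearMap.fst ℂ W W' x) :=
    fun _ _ => rfl
  have hψ : ∀ M x, LinearMap.snd ℂ W W' (A M x) = ρ'.act M (LinearMap.snd ℂ W W' x) :=
    fun _ _ => rfl
  set U := lowSpan A (v, v')
  let f : U →ₗ[ℂ] W := LinearMap.fst ℂ W W' ∘ₗ U.subtype
  let g : U →ₗ[ℂ] W' := LinearMap.snd ℂ W W' ∘ₗ U.subtype
  have hf : Function.Bijective f := by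
    constructor
    · refine (injective_iff_map_eq_zero f).2 fun u hu => Subtype.ext (Prod.ext hu ?_)
      exact hs'.eq_zero_of_mem_lowSpan hA h₀ hψ hv' hφ hv (fun x h1 h2 => Prod.ext h2 h1) hv0' hv0
        u.2 hu
    · intro w
      obtain ⟨u, hu, huw⟩ : w ∈ U.map (LinearMap.fst ℂ W W') :=
        hs.map_lowSpan_eq_top hA h₀ hφ hv hv0 ▸ Submodule.mem_top
      exact ⟨⟨u, hu⟩, huw⟩
  have hg : Function.Bijective g := by
    constructor
    · refine (injective_iff_map_eq_zero g).2 fun u hu => Subtype.ext (Prod.ext ?_ hu)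
      exact hs.eq_zero_of_mem_lowSpan hA h₀ hφ hv hψ hv' (fun x h1 h2 => Prod.ext h1 h2) hv0 hv0'
        u.2 hu
    · intro w
      obtain ⟨u, hu, huw⟩ : w ∈ U.map (LinearMap.snd ℂ W W') :=
        hs'.map_lowSpan_eq_top hA h₀ hψ hv' hv0' ▸ Submodule.mem_top
      exact ⟨⟨u, hu⟩, huw⟩
  refine ⟨(LinearEquiv.ofBijective f hf).symm.trans (LinearEquiv.ofBijective g hg), fun M w => ?_⟩
  obtain ⟨u, rfl⟩ := (LinearEquiv.ofBijective f hf).surjective w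
  have h1 : ρ.act M (LinearEquiv.ofBijective f hf u) =
      LinearEquiv.ofBijective f hf ⟨A M u, act_mem_lowSpan hA h₀ M u.2⟩ := rfl
  rw [h1, LinearEquiv.trans_apply, LinearEquiv.symm_apply_apply, LinearEquiv.trans_apply,
    LinearEquiv.symm_apply_apply]
  rfl

end GLSuperRep


/-! ### Operators on polynomials -/

section Operators

variable {n : ℕ}

theorem linDer_zero : linDer (0 : Matrix (Fin n) (Fin n) ℂ) = 0 := by
  rw [← zero_smul ℂ (0 : Matrix (Fin n) (Fin n) ℂ), linDer_smul, zero_smul]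

/-- The constant vector field `∑ᵢ rᵢ ∂ᵢ`. -/
noncomputable def rowDer (r : Fin n → ℂ) :
    Derivation ℂ (MvPolynomial (Fin n) ℂ) (MvPolynomial (Fin n) ℂ) :=
  ∑ i, r i • pderiv i

/-- The linear form `∑ᵢ sᵢ Xᵢ`. -/
noncomputable def colPoly (s : Fin n → ℂ) : MvPolynomial (Fin n) ℂ := ∑ i, C (s i) * X i

theorem rowDer_apply (r : Fin n → ℂ) (f : MvPolynomial (Fin n) ℂ) :
    rowDer r f = ∑ i, C (r i) * pderiv i f := by
  rw [rowDer, ← Derivation.coeFnAddMonoidHom_apply, map_sum, Finset.sum_apply]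
  exact Finset.sum_congr rfl fun i _ => by
    rw [Derivation.coeFnAddMonoidHom_apply, Derivation.smul_apply, smul_eq_C_mul]

theorem rowDer_X (r : Fin n → ℂ) (i : Fin n) : rowDer r (X i) = C (r i) := by
  rw [rowDer_apply, Finset.sum_eq_single i]
  · rw [pderiv_X_self, mul_one]
  · intro k _ hk
    rw [pderiv_X_of_ne hk.symm, mul_zero]
  · exact fun h => absurd (Finset.mem_univ i) h

theorem rowDer_add (r r' : Fin n → ℂ) : rowDer (r + r') = rowDer r + rowDer r' := by
  refine derivation_ext fun i => ?_
  rw [Derivation.add_apply, rowDer_X, rowDer_X, rowDer_X, Pi.add_apply, C_add]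

theorem rowDer_smul (c : ℂ) (r : Fin n → ℂ) : rowDer (c • r) = c • rowDer r := by
  refine derivation_ext fun i => ?_
  rw [Derivation.smul_apply, rowDer_X, rowDer_X, Pi.smul_apply, smul_eq_mul, C_mul, smul_eq_C_mul]

theorem rowDer_zero : rowDer (0 : Fin n → ℂ) = 0 := by
  rw [← zero_smul ℂ (0 : Fin n → ℂ), rowDer_smul, zero_smul]

theorem colPoly_add (s s' : Fin n → ℂ) : colPoly (s + s') = colPoly s + colPoly s' := by
  simp only [colPoly, Pi.add_apply, C_add, add_mul, Finset.sum_add_distrib]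

theorem colPoly_smul (c : ℂ) (s : Fin n → ℂ) : colPoly (c • s) = C c * colPoly s := by
  simp only [colPoly, Pi.smul_apply, smul_eq_mul, C_mul, Finset.mul_sum, mul_assoc]

theorem colPoly_zero : colPoly (0 : Fin n → ℂ) = 0 := by
  simp [colPoly]

theorem colPoly_single (i : Fin n) : colPoly (Pi.single i 1) = X i := by
  rw [colPoly, Finset.sum_eq_single i]
  · simp
  · intro k _ hk
    simp [hk]
  · exact fun h => absurd (Finset.mem_univ i) h

theorem rowDer_single (i : Fin n) : rowDer (Pi.single i 1) = pderiv i := by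
  refine derivation_ext fun k => ?_
  rw [rowDer_X, pderiv_X, Pi.single_apply, Pi.single_apply]
  simp only [apply_ite C, C_1, C_0]

theorem isHomogeneous_colPoly (s : Fin n → ℂ) : (colPoly s).IsHomogeneous 1 :=
  IsHomogeneous.sum _ _ _ fun k _ => by
    simpa using (isHomogeneous_C (Fin n) (s k)).mul (isHomogeneous_X ℂ k)

theorem isHomogeneous_rowDer (r : Fin n → ℂ) {f : MvPolynomial (Fin n) ℂ} {q : ℕ}
    (hf : f.IsHomogeneous (q + 1)) : (rowDer r f).IsHomogeneous q := by
  rw [rowDer_apply]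
  refine IsHomogeneous.sum _ _ _ fun i _ => ?_
  simpa using (isHomogeneous_C (Fin n) (r i)).mul (hf.pderiv (i := i))

theorem linDer_colPoly (B : Matrix (Fin n) (Fin n) ℂ) (s : Fin n → ℂ) :
    linDer B (colPoly s) = colPoly (B.mulVec s) := by
  have h : ∀ i, linDer B (C (s i) * X i) = ∑ k, C (B k i * s i) * X k := fun i => by
    rw [C_mul', Derivation.map_smul, linDer_X, smul_eq_C_mul, Finset.mul_sum]
    exact Finset.sum_congr rfl fun k _ => by rw [C_mul]; ring
  rw [colPoly, map_sum, Finset.sum_congr rfl fun i _ => h i, Finset.sum_comm]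
  exact Finset.sum_congr rfl fun k _ => by rw [Matrix.mulVec, dotProduct, map_sum, Finset.sum_mul]

theorem rowDer_colPoly (r s : Fin n → ℂ) : rowDer r (colPoly s) = C (r ⬝ᵥ s) := by
  rw [colPoly, map_sum, dotProduct, map_sum]
  refine Finset.sum_congr rfl fun i _ => ?_
  rw [C_mul', Derivation.map_smul, rowDer_X, smul_eq_C_mul, ← C_mul, mul_comm]

theorem linDer_vecMulVec (s r : Fin n → ℂ) (f : MvPolynomial (Fin n) ℂ) :
    linDer (Matrix.vecMulVec s r) f = colPoly s * rowDer r f := by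
  rw [linDer_eq_sum, rowDer_apply, Finset.mul_sum]
  refine Finset.sum_congr rfl fun i _ => ?_
  rw [← mul_assoc]
  congr 1
  rw [colPoly, Finset.sum_mul]
  refine Finset.sum_congr rfl fun k _ => ?_
  rw [Matrix.vecMulVec_apply, C_mul]
  ring

theorem linDer_single (i j : Fin n) (f : MvPolynomial (Fin n) ℂ) :
    linDer (Matrix.single i j 1) f = X i * pderiv j f := by
  rw [Matrix.single_eq_single_vecMulVec_single, linDer_vecMulVec, colPoly_single, rowDer_single]

theorem rowDer_linDer (r : Fin n → ℂ) (B : Matrix (Fin n) (Fin n) ℂ) (f : MvPolynomial (Fin n) ℂ) :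
    rowDer r (linDer B f) = linDer B (rowDer r f) + rowDer (Matrix.vecMul r B) f := by
  have h : ⁅rowDer r, linDer B⁆ = rowDer (Matrix.vecMul r B) := by
    refine derivation_ext fun i => ?_
    have h1 : linDer B (C (r i)) = 0 := (linDer B).map_algebraMap _
    rw [Derivation.commutator_apply, rowDer_X, rowDer_X, h1, sub_zero, linDer_X]
    exact rowDer_colPoly r fun k => B k i
  rw [← h, Derivation.commutator_apply]
  ring

/-- The commutator of derivations, solved for the derivation of `A B`. -/
theorem linDer_mul_sub (A B : Matrix (Fin n) (Fin n) ℂ) (f : MvPolynomial (Fin n) ℂ) :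
    linDer (A * B) f = linDer A (linDer B f) - linDer B (linDer A f) + linDer (B * A) f := by
  rw [← sub_eq_iff_eq_add, ← Derivation.commutator_apply, ← linDer_lie, Ring.lie_def,
    sub_eq_add_neg, sub_eq_add_neg (A * B), ← neg_one_smul ℂ (B * A), linDer_add, linDer_smul,
    Derivation.add_apply, Derivation.smul_apply, neg_one_smul]

end Operators

/-! ### The module `V(p)` -/

section Model

variable {n : ℕ}

/-- The block of a matrix of `gl(1|n)` that belongs to the odd indices. -/
def blk (x : Matrix (Fin (n + 1)) (Fin (n + 1)) ℂ) : Matrix (Fin n) (Fin n) ℂ :=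
  x.submatrix Fin.succ Fin.succ

/-- The odd part of the zeroth row. -/
def row (x : Matrix (Fin (n + 1)) (Fin (n + 1)) ℂ) : Fin n → ℂ := fun i => x 0 i.succ

/-- The odd part of the zeroth column. -/
def col (x : Matrix (Fin (n + 1)) (Fin (n + 1)) ℂ) : Fin n → ℂ := fun i => x i.succ 0

/-- The action of `gl(1|n)` on `ℂ[X₁, …, Xₙ] ⊗ Λ[θ]`, where `(f, g)` stands for `f + θ g`:
`e_{ij}` with `i, j ≥ 1` acts by `Xᵢ ∂ⱼ`, `e_{i0}` by `Xᵢ ∂_θ`, `e_{0i}` by `θ ∂ᵢ` and `e_{00}`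
by `θ ∂_θ`. The total degree is preserved. -/
noncomputable def superAct (n q : ℕ) :
    Matrix (Fin (n + 1)) (Fin (n + 1)) ℂ →ₗ[ℂ] Module.End ℂ (SymPow n (q + 1) × SymPow n q) where
  toFun x :=
    { toFun := fun w =>
        (⟨linDer (blk x) w.1.1 + colPoly (col x) * w.2.1,
          (linDer_mem _ w.1.2).add (by
            rw [mul_comm]
            exact IsHomogeneous.mul w.2.2 (isHomogeneous_colPoly (col x)))⟩,
        ⟨rowDer (row x) w.1.1 + C (x 0 0) * w.2.1 + linDer (blk x) w.2.1,
          ((isHomogeneous_rowDer _ w.1.2).add (by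
            have h := (isHomogeneous_C (Fin n) (x 0 0)).mul w.2.2
            rwa [zero_add] at h)).add (linDer_mem _ w.2.2)⟩)
      map_add' := fun w w' => Prod.ext
        (Subtype.ext (by simp only [Prod.fst_add, Prod.snd_add, Submodule.coe_add, map_add]; ring))
        (Subtype.ext (by simp only [Prod.fst_add, Prod.snd_add, Submodule.coe_add, map_add]; ring))
      map_smul' := fun c w => Prod.ext
        (Subtype.ext (by
          simp only [Prod.smul_fst, Prod.smul_snd, Submodule.coe_smul, Derivation.map_smul,
            RingHom.id_apply, smul_add, mul_smul_comm]))
        (Subtype.ext (by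
          simp only [Prod.smul_fst, Prod.smul_snd, Submodule.coe_smul, Derivation.map_smul,
            RingHom.id_apply, smul_add, mul_smul_comm])) }
  map_add' x y := by
    have h1 : blk (x + y) = blk x + blk y := rfl
    have h2 : row (x + y) = row x + row y := rfl
    have h3 : col (x + y) = col x + col y := rfl
    refine LinearMap.ext fun w => Prod.ext (Subtype.ext ?_) (Subtype.ext ?_)
    · simp only [LinearMap.add_apply, LinearMap.coe_mk, AddHom.coe_mk, Prod.fst_add,
        Submodule.coe_add, h1, h3, linDer_add, Derivation.add_apply, colPoly_add]
      ring
    · simp only [LinearMap.add_apply, LinearMap.coe_mk, AddHom.coe_mk, Prod.snd_add,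
        Submodule.coe_add, h1, h2, linDer_add, Derivation.add_apply, rowDer_add, Matrix.add_apply,
        C_add]
      ring
  map_smul' c x := by
    have h1 : blk (c • x) = c • blk x := rfl
    have h2 : row (c • x) = c • row x := rfl
    have h3 : col (c • x) = c • col x := rfl
    refine LinearMap.ext fun w => Prod.ext (Subtype.ext ?_) (Subtype.ext ?_)
    · simp only [LinearMap.smul_apply, LinearMap.coe_mk, AddHom.coe_mk, Prod.smul_fst,
        Submodule.coe_smul, h1, h3, linDer_smul, Derivation.smul_apply, colPoly_smul,
        RingHom.id_apply, smul_eq_C_mul]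
      ring
    · simp only [LinearMap.smul_apply, LinearMap.coe_mk, AddHom.coe_mk, Prod.smul_snd,
        Submodule.coe_smul, h1, h2, linDer_smul, Derivation.smul_apply, rowDer_smul,
        RingHom.id_apply, smul_eq_C_mul, Matrix.smul_apply, smul_eq_mul, C_mul]
      ring

variable {q : ℕ}

theorem coe_superAct_fst (x : Matrix (Fin (n + 1)) (Fin (n + 1)) ℂ)
    (w : SymPow n (q + 1) × SymPow n q) : ((superAct n q x w).1 : MvPolynomial (Fin n) ℂ) =
      linDer (blk x) w.1.1 + colPoly (col x) * w.2.1 := rfl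

theorem coe_superAct_snd (x : Matrix (Fin (n + 1)) (Fin (n + 1)) ℂ)
    (w : SymPow n (q + 1) × SymPow n q) : ((superAct n q x w).2 : MvPolynomial (Fin n) ℂ) =
      rowDer (row x) w.1.1 + C (x 0 0) * w.2.1 + linDer (blk x) w.2.1 := rfl

theorem blk_mul (x y : Matrix (Fin (n + 1)) (Fin (n + 1)) ℂ) :
    blk (x * y) = Matrix.vecMulVec (col x) (row y) + blk x * blk y := by
  ext i j
  simp [blk, col, row, Matrix.mul_apply, Fin.sum_univ_succ, Matrix.vecMulVec_apply]

theorem row_mul (x y : Matrix (Fin (n + 1)) (Fin (n + 1)) ℂ) :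
    row (x * y) = x 0 0 • row y + Matrix.vecMul (row x) (blk y) := by
  ext i
  simp [blk, row, Matrix.mul_apply, Fin.sum_univ_succ, Matrix.vecMul, dotProduct]

theorem col_mul (x y : Matrix (Fin (n + 1)) (Fin (n + 1)) ℂ) :
    col (x * y) = y 0 0 • col x + (blk x).mulVec (col y) := by
  ext i
  simp [blk, col, Matrix.mul_apply, Fin.sum_univ_succ, Matrix.mulVec, dotProduct, mul_comm]

theorem mul_zero_zero (x y : Matrix (Fin (n + 1)) (Fin (n + 1)) ℂ) :
    (x * y) 0 0 = x 0 0 * y 0 0 + row x ⬝ᵥ col y := by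
  simp [row, col, Matrix.mul_apply, Fin.sum_univ_succ, dotProduct]

theorem IsHomog.row_col {x : Matrix (Fin (n + 1)) (Fin (n + 1)) ℂ} (h : IsHomog 0 x) :
    row x = 0 ∧ col x = 0 := by
  constructor <;> ext i <;> by_contra h0
  · exact absurd (h 0 i.succ h0) (by simp [indexDeg])
  · exact absurd (h i.succ 0 h0) (by simp [indexDeg])

theorem IsHomog.blk_zero {x : Matrix (Fin (n + 1)) (Fin (n + 1)) ℂ} (h : IsHomog 1 x) :
    blk x = 0 ∧ x 0 0 = 0 := by
  constructor
  · ext i j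
    by_contra h0
    refine absurd (h i.succ j.succ h0) ?_
    simp only [indexDeg, Fin.succ_ne_zero, if_false]
    decide
  · by_contra h0
    exact absurd (h 0 0 h0) (by simp [indexDeg])

theorem superAct_bracket : IsBracketCompatible (superAct n q) := by
  intro a b x y hx hy
  have hC : ∀ (B : Matrix (Fin n) (Fin n) ℂ) (c : ℂ) (f : MvPolynomial (Fin n) ℂ),
      linDer B (C c * f) = C c * linDer B f := fun B c f => by
    rw [← smul_eq_C_mul, Derivation.map_smul, smul_eq_C_mul]
  have hL : ∀ (D : Derivation ℂ (MvPolynomial (Fin n) ℂ) (MvPolynomial (Fin n) ℂ))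
      (f g : MvPolynomial (Fin n) ℂ), D (f * g) = D f * g + f * D g := fun D f g => by
    rw [Derivation.leibniz, smul_eq_mul, smul_eq_mul]
    ring
  refine LinearMap.ext fun w => Prod.ext (Subtype.ext ?_) (Subtype.ext ?_)
  -- each component splits into four cases according to the degrees of `x` and `y`
  all_goals
    simp only [map_sub, map_smul, LinearMap.sub_apply, LinearMap.smul_apply, Module.End.mul_apply,
      Prod.fst_sub, Prod.smul_fst, Prod.snd_sub, Prod.smul_snd, Submodule.coe_sub,
      Submodule.coe_smul, coe_superAct_fst, coe_superAct_snd, blk_mul, row_mul, col_mul,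
      mul_zero_zero]
    obtain rfl | rfl := ZMod.eq_zero_or_eq_one a <;> obtain rfl | rfl := ZMod.eq_zero_or_eq_one b
  · obtain ⟨h1, h2⟩ := hx.row_col
    obtain ⟨h3, h4⟩ := hy.row_col
    simp [h1, h2, h3, h4, superSign, linDer_mul_sub (blk x) (blk y), colPoly_zero]
  · obtain ⟨h1, h2⟩ := hx.row_col
    obtain ⟨h3, h4⟩ := hy.blk_zero
    simp [h1, h2, h3, h4, superSign, colPoly_zero, rowDer_zero, linDer_zero, colPoly_smul, hL,
      linDer_colPoly]
    ring
  · obtain ⟨h1, h2⟩ := hx.blk_zero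
    obtain ⟨h3, h4⟩ := hy.row_col
    simp [h1, h2, h3, h4, superSign, colPoly_zero, rowDer_zero, linDer_zero, colPoly_smul, hL,
      linDer_colPoly]
    ring
  · obtain ⟨h1, h2⟩ := hx.blk_zero
    obtain ⟨h3, h4⟩ := hy.blk_zero
    simp [h1, h2, h3, h4, superSign, colPoly_zero, linDer_zero, linDer_vecMulVec]
  · obtain ⟨h1, h2⟩ := hx.row_col
    obtain ⟨h3, h4⟩ := hy.row_col
    simp [h1, h2, h3, h4, superSign, linDer_mul_sub (blk x) (blk y), rowDer_zero, hC]
    ring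
  · obtain ⟨h1, h2⟩ := hx.row_col
    obtain ⟨h3, h4⟩ := hy.blk_zero
    simp [h1, h2, h3, h4, superSign, rowDer_zero, colPoly_zero, linDer_zero, rowDer_smul, rowDer_linDer,
      smul_eq_C_mul]
    ring
  · obtain ⟨h1, h2⟩ := hx.blk_zero
    obtain ⟨h3, h4⟩ := hy.row_col
    simp [h1, h2, h3, h4, superSign, rowDer_zero, colPoly_zero, linDer_zero, rowDer_smul, rowDer_linDer,
      smul_eq_C_mul]
    ring
  · obtain ⟨h1, h2⟩ := hx.blk_zero
    obtain ⟨h3, h4⟩ := hy.blk_zero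
    simp [h1, h2, h3, h4, superSign, rowDer_zero, linDer_zero, linDer_vecMulVec, hL, rowDer_colPoly]
    ring

/-- The representation `superAct`; the polynomials without `θ` are even. -/
noncomputable def superRep (n q : ℕ) : GLSuperRep n (SymPow n (q + 1) × SymPow n q) where
  act := superAct n q
  gr b := if b = 0 then LinearMap.ker (LinearMap.snd ℂ _ _) else LinearMap.ker (LinearMap.fst ℂ _ _)
  isInternal := by
    refine (DirectSum.isInternal_submodule_iff_isCompl _ zero_ne_one (by
      ext i
      simpa using ZMod.eq_zero_or_eq_one i)).2 ?_
    rw [if_pos rfl, if_neg one_ne_zero, LinearMap.ker_snd, LinearMap.ker_fst]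
    exact LinearMap.isCompl_range_inl_inr
  act_mem a b x hx w hw := by
    obtain rfl | rfl := ZMod.eq_zero_or_eq_one a <;> obtain rfl | rfl := ZMod.eq_zero_or_eq_one b
    · obtain ⟨h1, h2⟩ := hx.row_col
      have h : w.2 = 0 := hw
      exact Subtype.ext (by simp [coe_superAct_snd, h, h1, rowDer_zero])
    · obtain ⟨h1, h2⟩ := hx.row_col
      have h : w.1 = 0 := hw
      exact Subtype.ext (by simp [coe_superAct_fst, h, h2, colPoly_zero])
    · obtain ⟨h1, h2⟩ := hx.blk_zero
      have h : w.2 = 0 := hw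
      exact Subtype.ext (by simp [coe_superAct_fst, h, h1, linDer_zero])
    · obtain ⟨h1, h2⟩ := hx.blk_zero
      have h : w.1 = 0 := hw
      exact Subtype.ext (by simp [coe_superAct_snd, h, h1, h2, linDer_zero])
  act_bracket := superAct_bracket

theorem superAct_glEmb (A : Matrix (Fin n) (Fin n) ℂ) (w : SymPow n (q + 1) × SymPow n q) :
    superAct n q (glEmb A) w = (symLie n (q + 1) A w.1, symLie n q A w.2) := by
  have h1 : blk (glEmb A) = A := rfl
  have h2 : row (glEmb A) = 0 := rfl
  have h3 : col (glEmb A) = 0 := by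
    ext i
    exact glEmb_zero_right A _
  refine Prod.ext (Subtype.ext ?_) (Subtype.ext ?_)
  · simp [coe_superAct_fst, h1, h3, colPoly_zero, coe_symLie]
  · simp [coe_superAct_snd, h1, h2, rowDer_zero, coe_symLie]

theorem superAct_single_zero_zero (w : SymPow n (q + 1) × SymPow n q) :
    superAct n q (Matrix.single 0 0 1) w = (0, w.2) := by
  have h1 : blk (Matrix.single 0 0 (1 : ℂ)) = (0 : Matrix (Fin n) (Fin n) ℂ) := by
    ext i j
    rw [blk, Matrix.submatrix_apply, Matrix.single_apply]
    exact if_neg fun h => Fin.succ_ne_zero i h.1.symm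
  have h2 : row (Matrix.single 0 0 (1 : ℂ)) = (0 : Fin n → ℂ) := by
    ext i
    exact Matrix.single_apply_of_ne _ _ _ _ _ fun h => Fin.succ_ne_zero _ h.2.symm
  have h3 : col (Matrix.single 0 0 (1 : ℂ)) = (0 : Fin n → ℂ) := by
    ext i
    exact Matrix.single_apply_of_ne _ _ _ _ _ fun h => Fin.succ_ne_zero _ h.1.symm
  refine Prod.ext (Subtype.ext ?_) (Subtype.ext ?_)
  · simp [coe_superAct_fst, h1, h3, colPoly_zero, linDer_zero]
  · simp [coe_superAct_snd, h1, h2, rowDer_zero, linDer_zero]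

theorem superAct_single_succ_zero (i : Fin n) (w : SymPow n (q + 1) × SymPow n q) :
    ((superAct n q (Matrix.single i.succ 0 1) w).1 : MvPolynomial (Fin n) ℂ) = X i * w.2.1 ∧
      (superAct n q (Matrix.single i.succ 0 1) w).2 = 0 := by
  have h1 : blk (Matrix.single i.succ 0 (1 : ℂ)) = 0 := by
    ext k j
    exact Matrix.single_apply_of_ne _ _ _ _ _ fun h => Fin.succ_ne_zero _ h.2.symm
  have h2 : row (Matrix.single i.succ 0 (1 : ℂ)) = 0 := by
    ext k
    exact Matrix.single_apply_of_ne _ _ _ _ _ fun h => Fin.succ_ne_zero _ h.2.symm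
  have h3 : col (Matrix.single i.succ 0 (1 : ℂ)) = Pi.single i 1 := by
    ext k
    simp [col, Matrix.single_apply, Pi.single_apply, eq_comm]
  refine ⟨?_, Subtype.ext ?_⟩
  · simp [coe_superAct_fst, h1, h3, colPoly_single, linDer_zero]
  · simp [coe_superAct_snd, h1, h2, rowDer_zero, linDer_zero]

theorem superAct_single_zero_succ (i : Fin n) (w : SymPow n (q + 1) × SymPow n q) :
    (superAct n q (Matrix.single 0 i.succ 1) w).1 = 0 ∧
      ((superAct n q (Matrix.single 0 i.succ 1) w).2 : MvPolynomial (Fin n) ℂ) =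
        pderiv i w.1.1 := by
  have h1 : blk (Matrix.single 0 i.succ (1 : ℂ)) = 0 := by
    ext k j
    rw [blk, Matrix.submatrix_apply, Matrix.single_apply]
    exact if_neg fun h => Fin.succ_ne_zero k h.1.symm
  have h2 : row (Matrix.single 0 i.succ (1 : ℂ)) = Pi.single i 1 := by
    ext k
    simp [row, Matrix.single_apply, Pi.single_apply, eq_comm]
  have h3 : col (Matrix.single 0 i.succ (1 : ℂ)) = 0 := by
    ext k
    exact Matrix.single_apply_of_ne _ _ _ _ _ fun h => Fin.succ_ne_zero _ h.1.symm
  refine ⟨Subtype.ext ?_, ?_⟩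
  · simp [coe_superAct_fst, h1, h3, colPoly_zero, linDer_zero]
  · simp [coe_superAct_snd, h1, h2, rowDer_single, linDer_zero]

theorem glEmb_single (i j : Fin n) :
    glEmb (Matrix.single i j 1) = Matrix.single i.succ j.succ (1 : ℂ) := by
  ext k l
  refine Fin.cases ?_ (fun k => ?_) k <;> refine Fin.cases ?_ (fun l => ?_) l <;>
    simp [Matrix.single_apply]

end Model


/-! ### Simplicity of the polynomial model -/

section Simplicity

variable {n q : ℕ}

theorem coeff_linDer_diagonal_single (i : Fin n) (f : MvPolynomial (Fin n) ℂ) (d : Fin n →₀ ℕ) :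
    coeff d (linDer (Matrix.diagonal (Pi.single i 1)) f) = d i * coeff d f := by
  induction f using MvPolynomial.induction_on' with
  | monomial e c =>
    rw [linDer_diagonal_monomial]
    simp only [coeff_smul, coeff_monomial, smul_eq_mul]
    split_ifs with h
    · subst h
      simp [Pi.single_apply]
    · simp
  | add f g hf hg => rw [map_add, coeff_add, hf, hg, coeff_add, mul_add]

/-- A subspace that is invariant under the diagonal matrices contains, with a nonzero polynomial,
one of its monomials. -/
theorem exists_monomial_mem (S : Submodule ℂ (MvPolynomial (Fin n) ℂ))
    (hS : ∀ A, ∀ f ∈ S, linDer A f ∈ S) (k : ℕ) :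
    ∀ f ∈ S, f ≠ 0 → f.support.card ≤ k → ∃ d ∈ f.support, monomial d 1 ∈ S := by
  induction k with
  | zero =>
    intro f _ h0 hk
    exact absurd (support_eq_empty.1 (Finset.card_eq_zero.1 (Nat.le_zero.1 hk))) h0
  | succ k ih =>
    intro f hf h0 hk
    obtain ⟨d, hd⟩ := Finset.nonempty_iff_ne_empty.2 fun h => h0 (support_eq_empty.1 h)
    by_cases hd' : ∃ d' ∈ f.support, d' ≠ d
    · obtain ⟨d', hd', hne⟩ := hd'
      obtain ⟨i, hi⟩ := DFunLike.ne_iff.1 hne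
      -- `Xᵢ ∂ᵢ - dᵢ` kills the monomial `d` but not the monomial `d'`
      set g := linDer (Matrix.diagonal (Pi.single i 1)) f - (d i : ℂ) • f with hg
      have hc : ∀ e, coeff e g = ((e i : ℂ) - d i) * coeff e f := fun e => by
        rw [hg, coeff_sub, coeff_linDer_diagonal_single, coeff_smul, smul_eq_mul, sub_mul]
      have hsub : g.support ⊂ f.support := by
        refine Finset.ssubset_iff_subset_ne.2 ⟨fun e he => ?_, fun h => ?_⟩
        · rw [mem_support_iff, hc] at he
          exact mem_support_iff.2 (right_ne_zero_of_mul he)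
        · rw [← h, mem_support_iff, hc, sub_self, zero_mul] at hd
          exact hd rfl
      have hg0 : g ≠ 0 := by
        intro h
        have h1 := hc d'
        rw [h, coeff_zero, eq_comm, mul_eq_zero, sub_eq_zero, Nat.cast_inj] at h1
        exact h1.elim hi (mem_support_iff.1 hd')
      obtain ⟨e, he, heS⟩ := ih g (S.sub_mem (hS _ _ hf) (S.smul_mem _ hf)) hg0
        (Nat.le_of_lt_succ ((Finset.card_lt_card hsub).trans_le hk))
      exact ⟨e, hsub.1 he, heS⟩
    · push Not at hd'
      refine ⟨d, hd, ?_⟩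
      have h1 : f = coeff d f • monomial d 1 := by
        ext e
        rw [coeff_smul, coeff_monomial, smul_eq_mul]
        split_ifs with h
        · rw [h, mul_one]
        · rw [mul_zero]
          by_contra h2
          exact h (hd' e (mem_support_iff.2 h2)).symm
      have h2 : monomial d (1 : ℂ) = (coeff d f)⁻¹ • f := by
        conv_rhs => rw [h1]
        rw [coeff_smul, coeff_monomial, if_pos rfl, smul_smul, smul_eq_mul, mul_one,
          inv_mul_cancel₀ (mem_support_iff.1 hd), one_smul]
      rw [h2]
      exact S.smul_mem _ hf

theorem pderiv_monomial_add_single (d : Fin n →₀ ℕ) (j : Fin n) :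
    pderiv j (monomial (d + Finsupp.single j 1) (1 : ℂ)) = ((d j : ℂ) + 1) • monomial d 1 := by
  rw [pderiv_monomial, add_tsub_cancel_right, smul_monomial]
  simp

/-- The operators `Xᵢ ∂ⱼ` connect any two monomials of the same degree; `c` is a common factor. -/
theorem monomial_mem_of_monomial_mem (S : Submodule ℂ (MvPolynomial (Fin n) ℂ))
    (hS : ∀ A, ∀ f ∈ S, linDer A f ∈ S) (p : ℕ) : ∀ c d d' : Fin n →₀ ℕ, d.degree = p →
      d'.degree = p → monomial (c + d) (1 : ℂ) ∈ S → monomial (c + d') (1 : ℂ) ∈ S := by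
  have hsplit : ∀ (p : ℕ) (d : Fin n →₀ ℕ), d.degree = p + 1 →
      ∃ j r, d = r + Finsupp.single j 1 ∧ r.degree = p := by
    intro p d hd
    have h0 : d ≠ 0 := by
      rintro rfl
      simp at hd
    obtain ⟨j, hj⟩ := Finsupp.ne_iff.1 h0
    have hle : Finsupp.single j 1 ≤ d :=
      Finsupp.single_le_iff.2 (Nat.one_le_iff_ne_zero.2 hj)
    refine ⟨j, d - Finsupp.single j 1, (tsub_add_cancel_of_le hle).symm, ?_⟩
    rw [← tsub_add_cancel_of_le hle, map_add, Finsupp.degree_single] at hd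
    exact Nat.succ_injective hd
  induction p with
  | zero =>
    intro c d d' hd hd' h
    rwa [(Finsupp.degree_eq_zero_iff _).1 hd', ← (Finsupp.degree_eq_zero_iff _).1 hd]
  | succ p ih =>
    intro c d d' hd hd' h
    obtain ⟨j, r, rfl, hr⟩ := hsplit p d hd
    obtain ⟨i, r', rfl, hr'⟩ := hsplit p d' hd'
    rw [← add_assoc, add_right_comm]
    refine ih (c + Finsupp.single i 1) r r' hr hr' ?_
    have h1 := hS (Matrix.single i j 1) _ h
    rw [linDer_single, ← add_assoc, pderiv_monomial_add_single, mul_smul_comm, mul_comm,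
      ← pow_one (X i : MvPolynomial (Fin n) ℂ), X_pow_eq_monomial, monomial_mul, mul_one] at h1
    rw [add_right_comm]
    have h2 : (((c + r) j : ℂ) + 1) ≠ 0 := Nat.cast_add_one_ne_zero _
    exact (S.smul_mem_iff h2).1 h1

/-- `Sym^p(ℂⁿ)` is an irreducible module of `gl(n)`. -/
theorem symLie_irreducible {p : ℕ} {S : Submodule ℂ (SymPow n p)}
    (hS : ∀ A, ∀ f ∈ S, symLie n p A f ∈ S) {f : SymPow n p} (hf : f ∈ S) (h0 : f ≠ 0) :
    S = ⊤ := by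
  set S' := S.map (homogeneousSubmodule (Fin n) ℂ p).subtype with hS'
  have h1 : ∀ A, ∀ f ∈ S', linDer A f ∈ S' := by
    rintro A _ ⟨f, hf, rfl⟩
    exact ⟨symLie n p A f, hS A f hf, rfl⟩
  obtain ⟨d, hd, hdS⟩ := exists_monomial_mem S' h1 _ f.1 ⟨f, hf, rfl⟩
    (fun h => h0 (Subtype.ext h)) le_rfl
  have hdp : d.degree = p := by
    by_contra h
    exact mem_support_iff.1 hd (IsHomogeneous.coeff_eq_zero f.2 h)
  rw [eq_top_iff, ← (monoBasis n p).span_eq, Submodule.span_le]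
  rintro _ ⟨e, rfl⟩
  obtain ⟨g, hg, hge⟩ : monomial e.1 (1 : ℂ) ∈ S' := by
    have h := monomial_mem_of_monomial_mem S' h1 p 0 d e.1 hdp e.2
    rw [zero_add, zero_add] at h
    exact h hdS
  have h2 : g = monoBasis n p e := Subtype.ext (hge.trans (coe_monoBasis e).symm)
  exact h2 ▸ hg

/-- An invariant graded subspace contains some `f ≠ 0` without `θ`, because `Xᵢ ∂_θ` is injective on
the multiples of `θ`; hence it contains `Sym^{q+1}`, and with it `θ Sym^q` by the operators
`θ ∂ᵢ`. -/
theorem superRep_isSimple (hn : 0 < n) : (superRep n q).IsSimple := by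
  set i₀ : Fin n := ⟨0, hn⟩
  constructor
  · have hX : (X i₀ ^ q : MvPolynomial (Fin n) ℂ) ∈ homogeneousSubmodule (Fin n) ℂ q := by
      rw [mem_homogeneousSubmodule]
      simpa using (isHomogeneous_X ℂ i₀).pow q
    refine ⟨⟨(0, ⟨_, hX⟩), 0, fun h => ?_⟩⟩
    exact pow_ne_zero q (X_ne_zero i₀) (congrArg (fun w => (w.2 : MvPolynomial (Fin n) ℂ)) h)
  intro U hg hU
  change ∀ x, ∀ w ∈ U, superAct n q x w ∈ U at hU
  rw [or_iff_not_imp_left]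
  intro hbot
  obtain ⟨u, hu, hu0⟩ := Submodule.exists_mem_ne_zero_of_ne_bot hbot
  obtain ⟨f, hf, hf0⟩ : ∃ f : SymPow n (q + 1), (f, 0) ∈ U ∧ f ≠ 0 := by
    obtain ⟨y, ⟨hy, hy'⟩, z, ⟨hz, hz'⟩, rfl⟩ := Submodule.mem_sup.1 (hg hu)
    have hy2 : y.2 = 0 := hy'
    have hz1 : z.1 = 0 := hz'
    by_cases hy1 : y.1 = 0
    · have hz2 : z.2 ≠ 0 := by
        intro hz2
        refine hu0 (Prod.ext ?_ ?_)
        · rw [Prod.fst_add, hy1, hz1, add_zero, Prod.fst_zero]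
        · rw [Prod.snd_add, hy2, hz2, add_zero, Prod.snd_zero]
      obtain ⟨h1, h2⟩ := superAct_single_succ_zero i₀ z
      refine ⟨(superAct n q (Matrix.single i₀.succ 0 1) z).1, ?_, fun h => ?_⟩
      · rw [← h2]
        exact hU _ _ hz
      · rw [h, Submodule.coe_zero, eq_comm, mul_eq_zero] at h1
        exact h1.elim (X_ne_zero i₀) fun h => hz2 (Subtype.ext h)
    · refine ⟨y.1, ?_, hy1⟩
      rw [← hy2]
      exact hy
  have h1 : ∀ f : SymPow n (q + 1), (f, 0) ∈ U := by
    have h : U.comap (LinearMap.inl ℂ _ _) = ⊤ := by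
      refine symLie_irreducible (fun A f hf => ?_) hf hf0
      have h := hU (glEmb A) _ hf
      rw [superAct_glEmb] at h
      simpa using h
    intro f
    exact (h ▸ Submodule.mem_top : f ∈ U.comap (LinearMap.inl ℂ _ _))
  have h2 : ∀ g : SymPow n q, (0, g) ∈ U := by
    have h : U.comap (LinearMap.inr ℂ _ _) = ⊤ := by
      rw [eq_top_iff, ← (monoBasis n q).span_eq, Submodule.span_le]
      rintro _ ⟨d, rfl⟩
      have hd : (d.1 + Finsupp.single i₀ 1).degree = q + 1 := by
        rw [map_add, d.2, Finsupp.degree_single]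
      have h3 := superAct_single_zero_succ i₀ (monoBasis n (q + 1) ⟨_, hd⟩, (0 : SymPow n q))
      have h4 := hU (Matrix.single 0 i₀.succ 1) _ (h1 (monoBasis n (q + 1) ⟨_, hd⟩))
      have h5 : superAct n q (Matrix.single 0 i₀.succ 1) (monoBasis n (q + 1) ⟨_, hd⟩, 0) =
          ((d.1 i₀ : ℂ) + 1) • (0, monoBasis n q d) := by
        refine Prod.ext ?_ (Subtype.ext ?_)
        · rw [h3.1, Prod.smul_fst, smul_zero]
        · rw [h3.2, Prod.smul_snd, Submodule.coe_smul, coe_monoBasis, coe_monoBasis,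
            pderiv_monomial_add_single]
      rw [h5] at h4
      have h6 : ((d.1 i₀ : ℂ) + 1) ≠ 0 := Nat.cast_add_one_ne_zero _
      exact (U.smul_mem_iff h6).1 h4
    intro g
    exact (h ▸ Submodule.mem_top : g ∈ U.comap (LinearMap.inr ℂ _ _))
  rw [eq_top_iff]
  rintro ⟨f, g⟩ -
  have h := U.add_mem (h1 f) (h2 g)
  rwa [Prod.mk_add_mk, add_zero, zero_add] at h

/-- The model is the module `V(q + 1)`: the vector `θ X₁^q` is a highest weight vector. -/
theorem superRep_isV (hn : 0 < n) : (superRep n q).IsV (q + 1) := by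
  refine ⟨inferInstance, superRep_isSimple hn, ?_⟩
  set i₀ : Fin n := ⟨0, hn⟩ with hi₀
  have hX : (X i₀ ^ q : MvPolynomial (Fin n) ℂ) ∈ homogeneousSubmodule (Fin n) ℂ q := by
    rw [mem_homogeneousSubmodule]
    simpa using (isHomogeneous_X ℂ i₀).pow q
  set m : SymPow n q := ⟨X i₀ ^ q, hX⟩ with hm
  have hder : ∀ k l : Fin n, l ≠ i₀ → symLie n q (Matrix.single k l 1) m = 0 := by
    intro k l hl
    refine Subtype.ext ?_
    rw [coe_symLie, linDer_single, hm, pderiv_pow, pderiv_X_of_ne hl.symm, mul_zero, mul_zero]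
    rfl
  have hder₀ : symLie n q (Matrix.single i₀ i₀ 1) m = (q : ℂ) • m := by
    refine Subtype.ext ?_
    rw [coe_symLie, linDer_single, Submodule.coe_smul, hm, pderiv_pow, pderiv_X_self, mul_one,
      smul_eq_C_mul, map_natCast]
    rcases q with _ | q
    · simp
    · rw [Nat.add_sub_cancel]
      ring
  refine ⟨(0, m), fun h => ?_, fun i j => ?_, fun i => ?_⟩
  · exact pow_ne_zero q (X_ne_zero i₀) (congrArg (fun w => (w.2 : MvPolynomial (Fin n) ℂ)) h)
  · change i < j → superAct n q (Matrix.single i j 1) (0, m) = 0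
    refine Fin.cases ?_ (fun k => ?_) i <;> refine Fin.cases ?_ (fun l => ?_) j <;> intro hij
    · exact absurd hij (lt_irrefl _)
    · obtain ⟨h1, h2⟩ := superAct_single_zero_succ l ((0 : SymPow n (q + 1)), m)
      exact Prod.ext h1 (Subtype.ext (h2.trans (map_zero _)))
    · exact absurd hij (Fin.not_lt_zero _)
    · have hl : l ≠ i₀ := by
        rintro rfl
        exact absurd (Fin.succ_lt_succ_iff.1 hij) (Nat.not_lt_zero _)
      rw [← glEmb_single, superAct_glEmb, hder k l hl, map_zero]
      rfl
  · change superAct n q (Matrix.single i i 1) (0, m) = _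
    refine Fin.cases ?_ (fun k => ?_) i
    · rw [superAct_single_zero_zero]
      simp
    · rw [← glEmb_single, superAct_glEmb, map_zero]
      by_cases hk : k = i₀
      · rw [hk, hder₀]
        simp [hi₀]
      · have hk' : k.val ≠ 0 := fun h => hk (Fin.ext h)
        rw [hder k k hk]
        simp [hk']

end Simplicity


/-! ### The modules `V(p)` of `gl(1|3N)` -/

theorem coeff_genG (p j N : ℕ) :
    MvPowerSeries.coeff (Finsupp.single 0 (p + 1) + Finsupp.single 1 j) (genG N) =
      mult (p + 1) j N + mult p j N := by
  have h0 : ∀ p : ℕ, (Finsupp.single (0 : Fin 2) p + Finsupp.single 1 j : Fin 2 →₀ ℕ) 0 = p := by simp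
  have h1 : ∀ p : ℕ, (Finsupp.single (0 : Fin 2) p + Finsupp.single 1 j : Fin 2 →₀ ℕ) 1 = j := by simp
  have hc : ∀ p, MvPowerSeries.coeff (Finsupp.single 0 p + Finsupp.single 1 j) (genM N) =
      mult p j N := fun p => by
    change (mult _ _ N : ℚ) = _
    rw [h0, h1]
  have h2 : (Finsupp.single (0 : Fin 2) (p + 1) + Finsupp.single 1 j) - Finsupp.single 0 1 =
      Finsupp.single 0 p + Finsupp.single 1 j := by
    rw [Finsupp.single_add, add_right_comm, add_tsub_cancel_right]
  rw [genG, add_mul, one_mul, map_add, hc, coeff_X_mul_eq, h0, if_neg (Nat.succ_ne_zero p), h2, hc]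

theorem exists_isV {N : ℕ} (hN : 1 ≤ N) (q : ℕ) :
    ∃ (W : Type) (_ : AddCommGroup W) (_ : Module ℂ W) (ρ : GLSuperRep (N * 3) W),
      ρ.IsV (q + 1) :=
  ⟨_, _, _, superRep (N * 3) q, superRep_isV (by omega)⟩

section Restriction

variable {W : Type*} [AddCommGroup W] [Module ℂ W]

/-- Every module `V(p)` is isomorphic to the polynomial model. -/
theorem GLSuperRep.IsV.exists_equiv {n q : ℕ} (hn : 0 < n) {ρ : GLSuperRep n W}
    (h : ρ.IsV (q + 1)) : ∃ Φ : W ≃ₗ[ℂ] SymPow n (q + 1) × SymPow n q,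
      (∀ w, Φ (ρ.act (Matrix.single 0 0 1) w) = (0, (Φ w).2)) ∧
      ∀ A w, Φ (ρ.toGl A w) = (symLie n (q + 1) A (Φ w).1, symLie n q A (Φ w).2) := by
  have hV := superRep_isV (q := q) hn
  obtain ⟨Φ, hΦ⟩ := h.2.1.exists_equiv hV.2.1 h.2.2 hV.2.2
  refine ⟨Φ, fun w => ?_, fun A w => ?_⟩
  · rw [hΦ]
    exact superAct_single_zero_zero _
  · change Φ (ρ.act (glEmb A) w) = _
    rw [hΦ]
    exact superAct_glEmb A _

variable {N q : ℕ} {σ : so3 →ₗ⁅ℂ⁆ Module.End ℂ W}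
  {Φ : W ≃ₗ[ℂ] SymPow (N * 3) (q + 1) × SymPow (N * 3) q}

/-- The weight basis of a module isomorphic to `V^{q+1} ⊕ V^{q}`. -/
noncomputable def sumBasis (Φ : W ≃ₗ[ℂ] SymPow (N * 3) (q + 1) × SymPow (N * 3) q) :
    Module.Basis (Expo (N * 3) (q + 1) ⊕ Expo (N * 3) q) ℂ W :=
  ((wtBasis N (q + 1)).prod (wtBasis N q)).map Φ.symm

/-- The weights of the elements of `sumBasis`. -/
def sumWt : Expo (N * 3) (q + 1) ⊕ Expo (N * 3) q → ℤ := Sum.elim expoWt expoWt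

theorem spinH_sumBasis (hΦ : ∀ A w, Φ (σ A w) = (symSo3 N (q + 1) A (Φ w).1, symSo3 N q A (Φ w).2))
    (i : Expo (N * 3) (q + 1) ⊕ Expo (N * 3) q) :
    σ spinH (sumBasis Φ i) = (sumWt i : ℂ) • sumBasis Φ i := by
  apply Φ.injective
  rw [hΦ, map_smul, sumBasis, Module.Basis.map_apply, LinearEquiv.apply_symm_apply]
  rcases i with d | d
  · rw [Module.Basis.prod_apply_inl_fst, Module.Basis.prod_apply_inl_snd, symSo3_spinH_wtBasis,
      map_zero]
    refine Prod.ext ?_ ?_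
    · rw [Prod.smul_fst, Module.Basis.prod_apply_inl_fst]
      rfl
    · rw [Prod.smul_snd, Module.Basis.prod_apply_inl_snd, smul_zero]
  · rw [Module.Basis.prod_apply_inr_fst, Module.Basis.prod_apply_inr_snd, symSo3_spinH_wtBasis,
      map_zero]
    refine Prod.ext ?_ ?_
    · rw [Prod.smul_fst, Module.Basis.prod_apply_inr_fst, smul_zero]
    · rw [Prod.smul_snd, Module.Basis.prod_apply_inr_snd]
      rfl

theorem card_sumWt (m : ℤ) :
    (Finset.univ.filter fun i : Expo (N * 3) (q + 1) ⊕ Expo (N * 3) q => sumWt i = m).card =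
      wtMult (q + 1) m N + wtMult q m N := by
  rw [wtMult, wtMult, Finset.card_filter, Finset.card_filter, Finset.card_filter,
    Fintype.sum_sum_type]
  rfl

/-- The weights of `V^{q+1} ⊕ V^{q}` are those of the two summands, so the multiplicities add. -/
theorem lieMult_eq_coeff_genG
    (hΦ : ∀ A w, Φ (σ A w) = (symSo3 N (q + 1) A (Φ w).1, symSo3 N q A (Φ w).2)) (j : ℕ) :
    (lieMult j σ : ℚ) =
      MvPowerSeries.coeff (Finsupp.single 0 (q + 1) + Finsupp.single 1 j) (genG N) := by
  have h := lieMult_add_card σ (sumBasis Φ) sumWt (spinH_sumBasis hΦ) j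
  rw [card_sumWt, card_sumWt] at h
  have h1 := mult_add_wtMult (q + 1) j N
  have h2 := mult_add_wtMult q j N
  rw [coeff_genG, ← Nat.cast_add, Nat.cast_inj]
  omega

theorem exists_decomposition_sum
    (hΦ : ∀ A w, Φ (σ A w) = (symSo3 N (q + 1) A (Φ w).1, symSo3 N q A (Φ w).2)) :
    ∃ Ψ : W ≃ₗ[ℂ] ((j : Fin (q + 1 + 1)) → Fin (lieMult (j : ℕ) σ) → harmonics (j : ℕ)),
      ∀ (A : so3) w j i, Ψ (σ A w) j i = spinLie j A (Ψ w j i) := by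
  refine exists_decomposition σ (sumBasis Φ) sumWt (spinH_sumBasis hΦ) (fun m => ?_) (q + 1) ?_
  · rw [card_sumWt, card_sumWt, wtMult_neg, wtMult_neg]
  · rintro (d | d)
    · exact natAbs_expoWt_le d
    · exact (natAbs_expoWt_le d).trans (Nat.le_succ q)

end Restriction

/-! ### The quotient form of the generating functions -/

theorem genM_genG_formulas :
    let P : MvPowerSeries (Fin 2) ℚ := MvPowerSeries.X 0
    let J : MvPowerSeries (Fin 2) ℚ := MvPowerSeries.X 1
    genM 1 = ((1 - J * P) * (1 - P ^ 2))⁻¹ ∧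
    genM 2 = (1 + J * P ^ 2) * ((1 - J * P) ^ 2 * (1 - P ^ 2) ^ 3)⁻¹ ∧
    genM 3 = numer3 P J * ((1 - J * P) ^ 3 * (1 - P ^ 2) ^ 6)⁻¹ ∧
    genM 4 = numer4 P J * ((1 - J * P) ^ 4 * (1 - P ^ 2) ^ 9)⁻¹ ∧
    genG 1 = ((1 - J * P) * (1 - P))⁻¹ ∧
    genG 2 = (1 + P) * (1 + P ^ 2 * J) * ((1 - P ^ 2) ^ 3 * (1 - P * J) ^ 2)⁻¹ := by
  intro P J
  have hP : MvPowerSeries.constantCoeff P = 0 := MvPowerSeries.constantCoeff_X _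
  have hJ : MvPowerSeries.constantCoeff J = 0 := MvPowerSeries.constantCoeff_X _
  refine ⟨?_, ?_, ?_, ?_, ?_, ?_⟩
  · rw [MvPowerSeries.eq_inv_iff_mul_eq_one (by simp [hP, hJ])]
    exact genM_one_mul
  · rw [MvPowerSeries.eq_mul_inv_iff_mul_eq (by simp [hP, hJ])]
    exact genM_two_mul
  · rw [MvPowerSeries.eq_mul_inv_iff_mul_eq (by simp [hP, hJ])]
    exact genM_three_mul
  · rw [MvPowerSeries.eq_mul_inv_iff_mul_eq (by simp [hP, hJ])]
    exact genM_four_mul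
  · rw [MvPowerSeries.eq_inv_iff_mul_eq_one (by simp [hP, hJ])]
    have h := genM_one_mul
    change genM 1 * ((1 - J * P) * (1 - P ^ 2)) = 1 at h
    change (1 + P) * genM 1 * ((1 - J * P) * (1 - P)) = 1
    linear_combination h
  · rw [MvPowerSeries.eq_mul_inv_iff_mul_eq (by simp [hP, hJ])]
    have h := genM_two_mul
    change genM 2 * ((1 - J * P) ^ 2 * (1 - P ^ 2) ^ 3) = 1 + J * P ^ 2 at h
    change (1 + P) * genM 2 * ((1 - P ^ 2) ^ 3 * (1 - P * J) ^ 2) = _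
    linear_combination (1 + P) * h

end WQO

theorem mainTheorem6 :
    -- the master generating function
    (∃ S, WQO.IsMasterSqrt S) ∧
    (∀ S, WQO.IsMasterSqrt S →
      let ι : MvPowerSeries (Fin 3) ℚ →+* WQO.MasterField := algebraMap _ _
      let P : WQO.MasterField := ι (MvPowerSeries.X 0)
      let J : WQO.MasterField := ι (MvPowerSeries.X 1)
      let n : WQO.MasterField := ι (MvPowerSeries.X 2)
      J * n - (1 - P) * (1 - J * P) * (J - P) ≠ 0 ∧
      ι WQO.masterM =
        1 + 1 / 2 * (n * (1 - J) / (J * n - (1 - P) * (1 - J * P) * (J - P)))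
          - 1 / 2 * (n * (1 + J) / (J * n - (1 - P) * (1 - J * P) * (J - P))) * ι S) ∧
    -- the cases `N = 1, 2, 3, 4`
    (let P : MvPowerSeries (Fin 2) ℚ := MvPowerSeries.X 0
     let J : MvPowerSeries (Fin 2) ℚ := MvPowerSeries.X 1
     WQO.genM 1 = ((1 - J * P) * (1 - P ^ 2))⁻¹ ∧
     WQO.genM 2 = (1 + J * P ^ 2) * ((1 - J * P) ^ 2 * (1 - P ^ 2) ^ 3)⁻¹ ∧
     WQO.genM 3 =
      (1 + 3 * J * P ^ 2 + P ^ 3 - J ^ 2 * P ^ 3 - 3 * J * P ^ 4 - J ^ 2 * P ^ 6) *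
        ((1 - J * P) ^ 3 * (1 - P ^ 2) ^ 6)⁻¹ ∧
     WQO.genM 4 =
      (J ^ 3 * P ^ 10 + J ^ 3 * P ^ 8 + 6 * J ^ 2 * P ^ 8 + 4 * J ^ 3 * P ^ 7 - 4 * J * P ^ 7
        + J ^ 3 * P ^ 6 - 10 * J ^ 2 * P ^ 6 + P ^ 6 - 10 * J * P ^ 4 + P ^ 4 + J ^ 3 * P ^ 4
        - 4 * J ^ 2 * P ^ 3 + 4 * P ^ 3 + 6 * J * P ^ 2 + P ^ 2 + 1) *
        ((1 - J * P) ^ 4 * (1 - P ^ 2) ^ 9)⁻¹ ∧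
     WQO.genG 1 = ((1 - J * P) * (1 - P))⁻¹ ∧
     WQO.genG 2 = (1 + P) * (1 + P ^ 2 * J) * ((1 - P ^ 2) ^ 3 * (1 - P * J) ^ 2)⁻¹) ∧
    -- the multiplicities for `SO(3) ⊂ GL(3N)` and for `so(3) ⊂ gl(3N)` agree
    (∀ p j N : ℕ,
      WQO.lieMult j ((WQO.symLie (N * 3) p).comp (WQO.so3ToGl N)) = WQO.mult p j N) ∧
    -- the modules `V(p)` of `gl(1|3N)`
    (∀ N p : ℕ, 1 ≤ N → 1 ≤ p →
      (∃ (W : Type) (_ : AddCommGroup W) (_ : Module ℂ W) (ρ : WQO.GLSuperRep (N * 3) W),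
        ρ.IsV p) ∧
      ∀ (W : Type*) [AddCommGroup W] [Module ℂ W] (ρ : WQO.GLSuperRep (N * 3) W), ρ.IsV p →
        (∃ Φ : W ≃ₗ[ℂ] WQO.SymPow (N * 3) p × WQO.SymPow (N * 3) (p - 1),
          (∀ w, Φ (ρ.act (Matrix.single 0 0 1) w) = (0, (Φ w).2)) ∧
          ∀ A w, Φ (ρ.toGl A w) =
            (WQO.symLie (N * 3) p A (Φ w).1, WQO.symLie (N * 3) (p - 1) A (Φ w).2)) ∧
        (∃ Ψ : W ≃ₗ[ℂ] ((j : Fin (p + 1)) →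
              Fin (WQO.lieMult (j : ℕ) (ρ.toGl.comp (WQO.so3ToGl N))) → WQO.harmonics (j : ℕ)),
          ∀ (A : WQO.so3) w j i, Ψ (ρ.toGl (WQO.so3ToGl N A) w) j i = WQO.spinLie j A (Ψ w j i)) ∧
        ∀ j : ℕ, (WQO.lieMult j (ρ.toGl.comp (WQO.so3ToGl N)) : ℚ) =
          MvPowerSeries.coeff (Finsupp.single 0 p + Finsupp.single 1 j) (WQO.genG N)) := by
  refine ⟨WQO.exists_isMasterSqrt, fun S hS => WQO.masterM_fraction hS, WQO.genM_genG_formulas,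
    fun p j N => WQO.lieMult_eq_mult p j N, ?_⟩
  intro N p hN hp
  obtain ⟨q, rfl⟩ : ∃ q, p = q + 1 := ⟨p - 1, (Nat.sub_add_cancel hp).symm⟩
  refine ⟨WQO.exists_isV hN q, fun W _ _ ρ hρ => ?_⟩
  obtain ⟨Φ, h0, hΦ⟩ := hρ.exists_equiv (by omega)
  have hσ : ∀ A w, Φ (ρ.toGl.comp (WQO.so3ToGl N) A w) =
      (WQO.symSo3 N (q + 1) A (Φ w).1, WQO.symSo3 N q A (Φ w).2) :=
    fun A w => hΦ (WQO.so3ToGl N A) w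
  exact ⟨⟨Φ, h0, hΦ⟩, WQO.exists_decomposition_sum hσ, fun j => WQO.lieMult_eq_coeff_genG hσ j⟩
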